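/- **Setting.** Let $d\ge 1$ and let $\mathfrak K:\mathbb R^d\to[0,\infty)$ be a continuous rotationally symmetric function, supported in the unit ball, with $\mathfrak K(0)=1$, whose Fourier transform satisfies, for some $s>(d+1)/2$ and some finite constant $c$, $0\le\hat{\mathfrak K}(\xi)\le c\,(1+|\xi|^2)^{-s}$ for all $\xi\in\mathbb R^d$. Let $\tilde{\mathfrak K}=\mathcal F^{-1}\sqrt{\mathcal F\mathfrak K}\in L^2(\mathbb R^d)$, $\alpha\in(0,\infty]$, $\mathfrak a\in[0,1]$ (with $e^{-\alpha u}=0$ for $u>0$ if $\alpha=\infty$), let $W$ be a white noise on $\mathbb R^d\times(0,\infty)$ and let $$X^{\mathfrak a}(x)=\int_{\mathbb R^d\times(0,\infty)}e^{du/2}\,\tilde{\mathfrak K}(e^u(z-x))\sqrt{1-\mathfrak a e^{-\alpha u}}\;dW(z,u),$$ a generalised function defined by testing: $\langle X^{\mathfrak a},\psi\rangle=\int e^{du/2}\sqrt{1-\mathfrak a e^{-\alpha u}}\,\big(\int_{\mathbb R^d}\tilde{\mathfrak K}(e^u(z-y))\psi(y)\,dy\big)\,dW(z,u)$. Let $\varphi:\mathbb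 R^d\to\mathbb R$ be smooth, supported in the unit ball, with $\int\varphi=1$, and for $\varepsilon>0$ let $\varphi_\varepsilon=\varepsilon^{-d}\varphi(\cdot/\varepsilon)$ and let $X_\varepsilon=X^{\mathfrak a}*\varphi_\varepsilon$, i.e. $X_\varepsilon(x)=\langle X^{\mathfrak a},\varphi_\varepsilon(x-\cdot)\rangle$ (in a version jointly measurable in $x$ and the randomness). For a centred Gaussian variable $Z$ of variance $\sigma^2$, $\gamma\in\mathbb R$ and an integer $k\ge0$, let $$:\!Z^ke^{\gamma Z}\!:\;=\sigma^kH_k\Big(\frac{Z-\gamma\sigma^2}{\sigma}\Big)e^{\gamma Z-\frac{\gamma^2}{2}\sigma^2},$$ where $H_k$ is the $k$-th monic Hermite polynomial (orthogonal with respect to $e^{-x^2/2}dx$). **Theorem.** Let $\gamma\in(-\sqrt{2d},\sqrt{2d})$. 1. For every bounded measurable $f:\mathbb R^d\to\mathbb R$ with compact support and every integer $k\ge0$, for each $\varepsilon>0$ the integral $$I_\varepsilon^{\mathfrak a}(f,k)=\int_{\mathbb R^d}f(x)\,:\!X_\varepsilon(x)^ke^{\gamma X_\varepsilon(x)}\!:\,dx$$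 converges absolutely almost surely and belongs to $L^1$, and $I_\varepsilon^{\mathfrak a}(f,k)$ converges in $L^1$, as $\varepsilon\to0$, to some random variable $I^{\mathfrak a}(f,k)$. 2. For every $\eta>0$ there is a finite constant $C$ such that for all $\varepsilon>0$, all integers $k\ge0$ and all bounded measurable $f:\mathbb R^d\to\mathbb R$ with support included in $[0,1]^d$, $$\mathbb E\big[|I_\varepsilon^{\mathfrak a}(f,k)|\big]\le C\,\|f\|_\infty\,k!\,\Big((1+\eta)\frac{\sqrt2}{\sqrt{2d}-|\gamma|}\Big)^k .$$ -/

import Mathlib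

open MeasureTheory ProbabilityTheory Filter Topology
open scoped FourierTransform ENNReal

/-- `ℝ^d` with its Euclidean norm. -/
abbrev RSpace (d : ℕ) : Type := EuclideanSpace ℝ (Fin d)

/-- The Fourier transform of a real function `K`, as a real number. For an even integrable `K`
(all that is used below) the Fourier integral is real, so that nothing is lost in taking its
real part. -/
noncomputable def realFourier {d : ℕ} (K : RSpace d → ℝ) (ξ : RSpace d) : ℝ :=
  (𝓕 (fun x => (K x : ℂ)) ξ).re

/-- Seed covariances. -/
structure IsSeedCovariance {d : ℕ} (K : RSpace d → ℝ) : Prop where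
  continuous : Continuous K
  nonneg : ∀ x, 0 ≤ K x
  at_zero : K 0 = 1
  rotation : ∀ x y, ‖x‖ = ‖y‖ → K x = K y
  support : tsupport K ⊆ Metric.closedBall 0 1
  fourier : ∃ s : ℝ, ((d : ℝ) + 1) / 2 < s ∧ ∃ C : ℝ, ∀ ξ : RSpace d,
    0 ≤ realFourier K ξ ∧ realFourier K ξ ≤ C * (1 + ‖ξ‖ ^ 2) ^ (-s)

/-- The Fourier transform of a seed covariance is really its `realFourier`. -/
theorem IsSeedCovariance.fourier_eq {d : ℕ} {K : RSpace d → ℝ} (hK : IsSeedCovariance K)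
    (ξ : RSpace d) : 𝓕 (fun x => (K x : ℂ)) ξ = (realFourier K ξ : ℂ) := by
  have h : (starRingEnd ℂ) (𝓕 (fun x => (K x : ℂ)) ξ) = 𝓕 (fun x => (K x : ℂ)) ξ := by
    rw [Real.fourier_eq', ← integral_conj,
      ← integral_neg_eq_self]
    refine integral_congr_ae (Eventually.of_forall fun x => ?_)
    have : K (-x) = K x := hK.rotation _ _ (norm_neg x)
    simp [this, ← Complex.exp_conj, Complex.conj_ofNat]
  exact ((Complex.conj_eq_iff_re).1 h).symm

theorem IsSeedCovariance.integrable {d : ℕ} {K : RSpace d → ℝ} (hK : IsSeedCovariance K) :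
    Integrable (fun x => (K x : ℂ)) := by
  have hc : HasCompactSupport K :=
    HasCompactSupport.of_support_subset_isCompact (isCompact_closedBall 0 1)
      ((subset_tsupport K).trans hK.support)
  exact (hK.continuous.integrable_of_hasCompactSupport hc).ofReal

/-- The square root of the Fourier transform of a seed covariance is square-integrable. -/
theorem IsSeedCovariance.memLp_sqrt {d : ℕ} {K : RSpace d → ℝ} (hK : IsSeedCovariance K) :
    MemLp (fun ξ : RSpace d => (Real.sqrt (realFourier K ξ) : ℂ)) 2 volume := by
  have hcont : Continuous (realFourier K) := by
    have : Continuous (𝓕 (fun x => (K x : ℂ))) :=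
      VectorFourier.fourierIntegral_continuous Real.continuous_fourierChar
        (innerSL ℝ).continuous₂ hK.integrable
    exact Complex.continuous_re.comp this
  obtain ⟨s, hs, C, hC⟩ := hK.fourier
  have hint : Integrable (fun ξ : RSpace d => C * (1 + ‖ξ‖ ^ 2) ^ (-s)) := by
    have h := integrable_rpow_neg_one_add_norm_sq (E := RSpace d) (μ := volume) (r := 2 * s)
      (by simp; linarith)
    have e : -(2 * s) / 2 = -s := by ring
    rw [e] at h
    exact h.const_mul C
  refine (MemLp.ofReal (K := ℂ) ?_)
  rw [memLp_two_iff_integrable_sq (by fun_prop)]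
  refine hint.mono' (by fun_prop) (Eventually.of_forall fun ξ => ?_)
  rw [Real.sq_sqrt (hC ξ).1, Real.norm_of_nonneg (hC ξ).1]
  exact (hC ξ).2

/-- The kernel `K̃ = 𝓕⁻¹ √(𝓕 K)`, the inverse Fourier transform being that of `L²`. The class
obtained is real almost everywhere since `𝓕 K` is even. -/
noncomputable def sqrtKernel {d : ℕ} {K : RSpace d → ℝ} (hK : IsSeedCovariance K)
    (x : RSpace d) : ℝ :=
  ((𝓕⁻ (hK.memLp_sqrt.toLp _) : Lp ℂ 2 (volume : Measure (RSpace d))) x).re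

/-- Lebesgue measure on the space-time `ℝ^d × (0, ∞)`. -/
noncomputable def spaceTime (d : ℕ) : Measure (RSpace d × ℝ) :=
  (volume : Measure (RSpace d)).prod (volume.restrict (Set.Ioi (0 : ℝ)))

/-- `W` is a white noise on `ℝ^d × (0, ∞)`: the centred Gaussian process indexed by
`L²(ℝ^d × (0, ∞))` whose covariance is the inner product. -/
structure IsWhiteNoise {d : ℕ} {Ω : Type*} [MeasurableSpace Ω] (P : Measure Ω)
    (W : Lp ℝ 2 (spaceTime d) → Ω → ℝ) : Prop where
  gaussian : IsGaussianProcess W P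
  centred : ∀ h, ∫ ω, W h ω ∂P = 0
  covariance : ∀ h g, ∫ ω, W h ω * W g ω ∂P = inner ℝ h g

open Classical in
/-- The stochastic integral `∫ h(z,u) dW(z,u)` of a deterministic square-integrable `h`
(and `0` if `h` is not square-integrable). -/
noncomputable def whiteNoiseIntegral {d : ℕ} {Ω : Type*} (W : Lp ℝ 2 (spaceTime d) → Ω → ℝ)
    (h : RSpace d × ℝ → ℝ) : Ω → ℝ :=
  if hh : MemLp h 2 (spaceTime d) then W (hh.toLp h) else 0

/-- `e^{-α u}` for `α ∈ (0, ∞]` and `u > 0`. -/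
noncomputable def expDecay (α : ℝ≥0∞) (u : ℝ) : ℝ :=
  if α = ⊤ then 0 else Real.exp (-(α.toReal * u))

/-- The almost `⋆`-scale invariant field
`X^a(x) = ∫ e^{du/2} K̃(e^u (z - x)) √(1 - a e^{-αu}) dW(z,u)`, which is a generalised function,
tested against `ψ`:
`⟨X^a, ψ⟩ = ∫ e^{du/2} √(1 - a e^{-αu}) (∫ K̃(e^u (z - y)) ψ(y) dy) dW(z,u)`. -/
noncomputable def starField {d : ℕ} {Ω : Type*} (W : Lp ℝ 2 (spaceTime d) → Ω → ℝ)
    {K : RSpace d → ℝ} (hK : IsSeedCovariance K) (α : ℝ≥0∞) (a : ℝ) (ψ : RSpace d → ℝ) : Ω → ℝ :=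
  whiteNoiseIntegral W fun p =>
    Real.exp ((d : ℝ) * p.2 / 2) * Real.sqrt (1 - a * expDecay α p.2) *
      ∫ y, sqrtKernel hK (Real.exp p.2 • (p.1 - y)) * ψ y

/-- Mollifiers: smooth, supported in the unit ball, of integral one (no sign is imposed). -/
structure IsMollifier {d : ℕ} (φ : RSpace d → ℝ) : Prop where
  smooth : ContDiff ℝ (⊤ : ℕ∞) φ
  support : tsupport φ ⊆ Metric.closedBall 0 1
  integral_eq_one : ∫ x, φ x = 1

/-- `φ_ε = ε^{-d} φ(· / ε)`. -/
noncomputable def scaledMollifier {d : ℕ} (φ : RSpace d → ℝ) (ε : ℝ) (x : RSpace d) : ℝ :=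
  (ε ^ d)⁻¹ * φ (ε⁻¹ • x)

/-- `X ε` is a version of the mollified field `X_ε = X^a * φ_ε`: for every `x`, almost surely
`X_ε(x) = ⟨X^a, φ_ε(x - ·)⟩`, and `X_ε` is jointly measurable (up to null sets) in `(x, ω)`, so
that it can be integrated in `x`. The version with smooth paths is such a version, and any two
versions give almost surely the same integrals in `x`. -/
structure IsMollifiedStarField {d : ℕ} {Ω : Type*} [MeasurableSpace Ω] (P : Measure Ω)
    (W : Lp ℝ 2 (spaceTime d) → Ω → ℝ) {K : RSpace d → ℝ} (hK : IsSeedCovariance K)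
    (α : ℝ≥0∞) (a : ℝ) (φ : RSpace d → ℝ) (X : ℝ → RSpace d → Ω → ℝ) : Prop where
  ae_eq : ∀ ε : ℝ, 0 < ε → ∀ x,
    X ε x =ᵐ[P] starField W hK α a (fun y => scaledMollifier φ ε (x - y))
  aemeasurable : ∀ ε : ℝ, 0 < ε →
    AEMeasurable (fun p : RSpace d × Ω => X ε p.1 p.2) ((volume : Measure (RSpace d)).prod P)

/-- `:Z^k e^{γZ}: = σ^k H_k((Z - γσ²)/σ) e^{γZ - γ²σ²/2}` for a centred Gaussian variable `Z` of
variance `σ²`, where `H_k` is the monic (probabilists') Hermite polynomial. -/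
noncomputable def wick {Ω : Type*} [MeasurableSpace Ω] (P : Measure Ω) (Z : Ω → ℝ) (k : ℕ)
    (γ : ℝ) (ω : Ω) : ℝ :=
  Real.sqrt (variance Z P) ^ k *
    Polynomial.aeval ((Z ω - γ * variance Z P) / Real.sqrt (variance Z P)) (Polynomial.hermite k) *
    Real.exp (γ * Z ω - γ ^ 2 / 2 * variance Z P)

/-- `I_ε(f, k) = ∫ f(x) :X_ε(x)^k e^{γ X_ε(x)}: dx`. -/
noncomputable def wickIntegral {d : ℕ} {Ω : Type*} [MeasurableSpace Ω] (P : Measure Ω)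
    (X : ℝ → RSpace d → Ω → ℝ) (γ : ℝ) (f : RSpace d → ℝ) (k : ℕ) (ε : ℝ) (ω : Ω) : ℝ :=
  ∫ x, f x * wick P (X ε x) k γ ω

/-! The Wick power `:Z^k e^{γZ}:` is the k-th derivative at `β = γ` of the Wick exponential `e^{βZ -
β²σ²/2}`, which is entire in `β`. Cauchy's formula on a circle of radius `r` about `γ`
(`wickPower_eq_integral`) therefore writes `I_ε(f, k)` as `k! r^{-k}` times an average of complex
chaos integrals `∫ f :e^{βX_ε}:` over that circle (`chaosDerivative_ae_eq`). Both claims follow once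
these integrals are bounded in some `L^p`, and Cauchy in `L^p` as `ε → 0`, uniformly over the
circle.

For `1 ≤ p ≤ 2`, a Wick exponential of variance `T` has `L^p` norm `exp(((p-1)(Re β)² + (Im β)²) T /
2)`. Cut the field at the scales `u = n log 2`. Adding scales finer than `2^{-n}` changes the Wick
exponential by an increment that is centred given the coarse field, and the finite range of the seed
covariance makes the fine field independent at points more than `4 · 2^{-n}` apart. Colour the
dyadic cells of side `2^{-n}` so that cells of one colour are that far apart. A von Bahr–Esseen
inequality (`IsIsonormal.integral_norm_sum_rpow_le`) bounds the p-th moment of each coloured sum by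
the sum of the p-th moments. There are of order `2^{nd}` cells, each of volume `2^{-nd}`, so if `Λ`
bounds the exponent above per unit of variance, the increment has `L^p` norm of order
`2^{-n(d(p-1)/p - Λ)}` (`IsIsonormal.norm_integral_increment_le`).

When `Λ < d(p-1)/p` these bounds sum geometrically, uniformly in `ε`
(`exists_norm_chaosIntegral_univ_sub_le`), which gives the moment bound. For the Cauchy property,
the fine scales are uniformly small, and for a fixed set of coarse scales two mollifications are
close in `L²` because the seed covariance is Lipschitz at the origin
(`exists_norm_chaosIntegral_sub_chaosIntegral_le`).

Finally `p = 2/(1+t)` with `t = |γ|/√(2d)` makes every circle of radius below `(√(2d) - |γ|)/√2`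
admissible, which is the source of the growth rate (`exists_subcritical_exponent`).

Integrals over space are Bochner integrals in the Hilbert space `L²`, where orthogonality is
available for each fixed `ε`; the uniform bounds hold only after the inclusion `lowerLp` into `L^p`.
-/

/-! ### Translations, autocorrelation and reality for the `L²` Fourier transform. -/

section Fourier

variable {d : ℕ}

/-- The Fourier transform of a translate of a Schwartz function. -/
theorem SchwartzMap.fourier_compSubConst (s : SchwartzMap (RSpace d) ℂ) (v ξ : RSpace d) :
    𝓕 (s.compSubConstCLM ℂ (-v)) ξ = Real.fourierChar (inner ℝ v ξ) • 𝓕 s ξ := by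
  have h := congrFun (VectorFourier.fourierIntegral_comp_add_right Real.fourierChar
    (volume : Measure (RSpace d)) (innerₗ (RSpace d)) (s : RSpace d → ℂ) v) ξ
  rw [SchwartzMap.fourier_coe, SchwartzMap.fourier_coe]
  have e : (s.compSubConstCLM ℂ (-v) : RSpace d → ℂ) = (s : RSpace d → ℂ) ∘ fun x => x + v := by
    funext x
    simp
  rw [e]
  exact h

/-- The character `ξ ↦ e^{2πi⟨v, ξ⟩}` as an element of `L^∞`. -/
noncomputable def charLp (v : RSpace d) : Lp ℂ ∞ (volume : Measure (RSpace d)) :=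
  MemLp.toLp (fun ξ => (Real.fourierChar (inner ℝ v ξ) : ℂ))
    (memLp_top_of_bound (by
      refine Continuous.aestronglyMeasurable ?_
      exact (continuous_subtype_val.comp (Real.continuous_fourierChar.comp (by fun_prop)))) 1
      (Eventually.of_forall fun ξ => (Circle.norm_coe _).le))

theorem coeFn_charLp (v : RSpace d) :
    charLp v =ᵐ[volume] fun ξ => (Real.fourierChar (inner ℝ v ξ) : ℂ) := MemLp.coeFn_toLp _

/-- Multiplication by a character on `L²`. -/
noncomputable def charMul (v : RSpace d) :
    Lp ℂ 2 (volume : Measure (RSpace d)) →L[ℂ] Lp ℂ 2 (volume : Measure (RSpace d)) :=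
  (ContinuousLinearMap.mul ℂ ℂ).holderL volume ∞ 2 2 (charLp v)

theorem coeFn_charMul (v : RSpace d) (F : Lp ℂ 2 (volume : Measure (RSpace d))) :
    charMul v F =ᵐ[volume] fun ξ => (Real.fourierChar (inner ℝ v ξ) : ℂ) * F ξ := by
  have h := ContinuousLinearMap.coeFn_holder (r := 2) (ContinuousLinearMap.mul ℂ ℂ) (charLp v) F
  have e : charMul v F = (ContinuousLinearMap.mul ℂ ℂ).holder 2 (charLp v) F := rfl
  rw [e]
  filter_upwards [h, coeFn_charLp v] with ξ h1 h2
  rw [h1, h2]; rfl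

/-- Translation on `L²`. -/
noncomputable def translateLp (v : RSpace d) (G : Lp ℂ 2 (volume : Measure (RSpace d))) :
    Lp ℂ 2 (volume : Measure (RSpace d)) :=
  Lp.compMeasurePreserving (· + v) (measurePreserving_add_right volume v) G

theorem continuous_translateLp (v : RSpace d) : Continuous (translateLp v) :=
  (Lp.isometry_compMeasurePreserving (measurePreserving_add_right volume v)).continuous

theorem coeFn_translateLp (v : RSpace d) (G : Lp ℂ 2 (volume : Measure (RSpace d))) :
    translateLp v G =ᵐ[volume] fun w => G (w + v) :=
  Lp.coeFn_compMeasurePreserving G (measurePreserving_add_right volume v)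

/-- On `L²`, the Fourier transform turns translations into multiplications by characters. -/
theorem fourier_translateLp (v : RSpace d) (G : Lp ℂ 2 (volume : Measure (RSpace d))) :
    𝓕 (translateLp v G) = charMul v (𝓕 G) := by
  -- Both sides are continuous in `G`, so the identity need only be checked on the dense set of
  -- Schwartz functions.
  apply DenseRange.induction_on
    (p := fun G : Lp ℂ 2 (volume : Measure (RSpace d)) => 𝓕 (translateLp v G) = charMul v (𝓕 G))
    (SchwartzMap.denseRange_toLpCLM (p := 2) ENNReal.ofNat_ne_top) G
  · apply isClosed_eq
    · exact (Lp.fourierTransformₗᵢ (RSpace d) ℂ).continuous.comp (continuous_translateLp v)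
    · exact (charMul v).continuous.comp (Lp.fourierTransformₗᵢ (RSpace d) ℂ).continuous
  · intro s
    rw [SchwartzMap.toLpCLM_apply, SchwartzMap.toLp_fourier_eq]
    have e : translateLp v (s.toLp 2) = (s.compSubConstCLM ℂ (-v)).toLp 2 := by
      apply Lp.ext
      have h1 := (measurePreserving_add_right (volume : Measure (RSpace d)) v).quasiMeasurePreserving.ae_eq
        (SchwartzMap.coeFn_toLp s 2)
      filter_upwards [coeFn_translateLp v (s.toLp 2), h1,
        SchwartzMap.coeFn_toLp (s.compSubConstCLM ℂ (-v)) 2] with w h1 h2 h3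
      rw [h1, h3]
      simpa using h2
    rw [e, SchwartzMap.toLp_fourier_eq]
    apply Lp.ext
    filter_upwards [SchwartzMap.coeFn_toLp (𝓕 (s.compSubConstCLM ℂ (-v))) 2,
      coeFn_charMul v ((𝓕 s).toLp 2), SchwartzMap.coeFn_toLp (𝓕 s) 2] with ξ h1 h2 h3
    rw [h1, h2, h3, SchwartzMap.fourier_compSubConst]
    rfl

/-- The autocorrelation of an inverse Fourier transform. -/
theorem integral_conj_mul_translate_fourierInv (F : Lp ℂ 2 (volume : Measure (RSpace d)))
    (v : RSpace d) :
    ∫ w, (starRingEnd ℂ) ((𝓕⁻ F : Lp ℂ 2 (volume : Measure (RSpace d))) w) *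
        (𝓕⁻ F : Lp ℂ 2 (volume : Measure (RSpace d))) (w + v) =
      ∫ ξ, (starRingEnd ℂ) (F ξ) * ((Real.fourierChar (inner ℝ v ξ) : ℂ) * F ξ) := by
  set G : Lp ℂ 2 (volume : Measure (RSpace d)) := 𝓕⁻ F with hG
  have hF : 𝓕 G = F := FourierTransform.fourier_fourierInv_eq F
  have h := Lp.inner_fourier_eq G (translateLp v G)
  rw [fourier_translateLp, hF, L2.inner_def, L2.inner_def] at h
  calc _ = ∫ w, inner ℂ (G w) (translateLp v G w) := by
        refine integral_congr_ae ?_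
        filter_upwards [coeFn_translateLp v G] with w hw
        rw [hw, RCLike.inner_apply, mul_comm]
    _ = _ := h.symm
    _ = _ := by
        refine integral_congr_ae ?_
        filter_upwards [coeFn_charMul v F] with ξ hξ
        rw [hξ, RCLike.inner_apply, mul_comm]

theorem fourier_conj_of_real (s : SchwartzMap (RSpace d) ℂ)
    (hs : ∀ x, (starRingEnd ℂ) (s x) = s x) (ξ : RSpace d) :
    (starRingEnd ℂ) (𝓕 s ξ) = 𝓕 s (-ξ) := by
  rw [SchwartzMap.fourier_coe, Real.fourier_eq', Real.fourier_eq', ← integral_conj]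
  congr 1
  funext x
  simp [hs, ← Complex.exp_conj, Complex.conj_ofNat]

/-- The inverse Fourier transform of a real even function is real. -/
theorem fourierInv_im_ae_eq_zero (F : Lp ℂ 2 (volume : Measure (RSpace d)))
    (hreal : ∀ᵐ ξ, (starRingEnd ℂ) (F ξ) = F ξ) (heven : ∀ᵐ ξ, F (-ξ) = F ξ) :
    ∀ᵐ x, ((𝓕⁻ F : Lp ℂ 2 (volume : Measure (RSpace d))) x).im = 0 := by
  set G : Lp ℂ 2 (volume : Measure (RSpace d)) := 𝓕⁻ F with hG
  have hF : 𝓕 G = F := FourierTransform.fourier_fourierInv_eq F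
  have hGm : MemLp (fun x => (G x).im) 2 (volume : Measure (RSpace d)) := by
    exact (Lp.memLp G).im
  have hloc : LocallyIntegrable (fun x => (G x).im) (volume : Measure (RSpace d)) :=
    hGm.locallyIntegrable (by norm_num)
  refine ae_eq_zero_of_integral_contDiff_smul_eq_zero hloc ?_
  intro g hg hgc
  have hgC : ContDiff ℝ (⊤ : ℕ∞) (fun x => (g x : ℂ)) := Complex.ofRealCLM.contDiff.comp hg
  have hgcC : HasCompactSupport (fun x => (g x : ℂ)) :=
    hgc.comp_left (g := fun x : ℝ => (x : ℂ)) (by simp)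
  set s : SchwartzMap (RSpace d) ℂ := hgcC.toSchwartzMap hgC with hs
  have hsv : ∀ x, s x = (g x : ℂ) := fun x => rfl
  have h := Lp.inner_fourier_eq (s.toLp 2) G
  rw [hF, SchwartzMap.toLp_fourier_eq, L2.inner_def, L2.inner_def] at h
  have h1 : ∫ x, inner ℂ ((s.toLp 2 : Lp ℂ 2 (volume : Measure (RSpace d))) x) (G x) = ∫ x, (g x : ℂ) * G x := by
    refine integral_congr_ae ?_
    filter_upwards [SchwartzMap.coeFn_toLp s 2] with x hx
    rw [hx, RCLike.inner_apply, hsv, Complex.conj_ofReal, mul_comm]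
  have h2 : ∫ ξ, inner ℂ (((𝓕 s).toLp 2 : Lp ℂ 2 (volume : Measure (RSpace d))) ξ) (F ξ) = ∫ ξ, F ξ * (starRingEnd ℂ) (𝓕 s ξ) := by
    refine integral_congr_ae ?_
    filter_upwards [SchwartzMap.coeFn_toLp (𝓕 s) 2] with x hx
    rw [hx, RCLike.inner_apply]
  -- Conjugating `𝓕 s` reflects its argument because `s` is real; as `F` is real and even, the
  -- reflection is undone by `ξ ↦ -ξ`.
  have h3 : (starRingEnd ℂ) (∫ ξ, F ξ * (starRingEnd ℂ) (𝓕 s ξ)) =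
      ∫ ξ, F ξ * (starRingEnd ℂ) (𝓕 s ξ) := by
    rw [← integral_conj, ← integral_neg_eq_self]
    have hr' := (Measure.measurePreserving_neg
      (volume : Measure (RSpace d))).quasiMeasurePreserving.ae hreal
    refine integral_congr_ae ?_
    filter_upwards [heven, hr', hreal] with ξ a1 a2 a3
    rw [map_mul, Complex.conj_conj, a2, a1, ← fourier_conj_of_real s (fun x => by simp [hsv])]
  rw [h1, h2] at h
  rw [h] at h3
  have him : (∫ x, (g x : ℂ) * G x).im = 0 := Complex.conj_eq_iff_im.1 h3
  have hint : Integrable (fun x => (g x : ℂ) * G x) := by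
    have := (s.memLp 2 (volume : Measure (RSpace d))).integrable_mul (Lp.memLp G)
    exact this
  calc ∫ x, g x • (G x).im = ∫ x, ((g x : ℂ) * G x).im := by simp
    _ = (∫ x, (g x : ℂ) * G x).im := integral_im hint
    _ = 0 := him

end Fourier

/-! ### Seed covariances and their square-root kernel. -/

namespace IsSeedCovariance

variable {d : ℕ} {K : RSpace d → ℝ}

theorem hasCompactSupport (hK : IsSeedCovariance K) : HasCompactSupport K :=
  HasCompactSupport.of_support_subset_isCompact (isCompact_closedBall 0 1)
    ((subset_tsupport K).trans hK.support)

theorem integrable_real (hK : IsSeedCovariance K) : Integrable K :=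
  hK.continuous.integrable_of_hasCompactSupport hK.hasCompactSupport

theorem eq_zero_of_one_lt_norm (hK : IsSeedCovariance K) {x : RSpace d} (hx : 1 < ‖x‖) :
    K x = 0 := by
  by_contra h
  have := hK.support (subset_tsupport K h)
  simp at this
  linarith

theorem neg_apply (hK : IsSeedCovariance K) (x : RSpace d) : K (-x) = K x :=
  hK.rotation _ _ (norm_neg x)

theorem continuous_realFourier (hK : IsSeedCovariance K) : Continuous (realFourier K) := by
  have : Continuous (𝓕 (fun x => (K x : ℂ))) :=
    VectorFourier.fourierIntegral_continuous Real.continuous_fourierChar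
      (innerSL ℝ).continuous₂ hK.integrable
  exact Complex.continuous_re.comp this

theorem realFourier_nonneg (hK : IsSeedCovariance K) (ξ : RSpace d) : 0 ≤ realFourier K ξ := by
  obtain ⟨s, hs, C, hC⟩ := hK.fourier
  exact (hC ξ).1

/-- The factor `1 + ‖ξ‖` costs half a power of `1 + ‖ξ‖²`, and `2s - 1 > d` is exactly the
assumption `s > (d+1)/2`. This first moment yields the Lipschitz bound at the origin. -/
theorem integrable_one_add_norm_mul_realFourier (hK : IsSeedCovariance K) :
    Integrable (fun ξ : RSpace d => (1 + ‖ξ‖) * realFourier K ξ) := by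
  obtain ⟨s, hs, C, hC⟩ := hK.fourier
  have hint : Integrable (fun ξ : RSpace d => 2 * C * (1 + ‖ξ‖ ^ 2) ^ (-(2 * s - 1) / 2)) := by
    exact (integrable_rpow_neg_one_add_norm_sq (E := RSpace d) (μ := volume) (r := 2 * s - 1)
      (by simp; linarith)).const_mul (2 * C)
  refine hint.mono' (Continuous.aestronglyMeasurable
    ((continuous_const.add continuous_norm).mul hK.continuous_realFourier))
    (Eventually.of_forall fun ξ => ?_)
  have h1 : (0 : ℝ) ≤ realFourier K ξ := (hC ξ).1
  have hp : (0 : ℝ) < 1 + ‖ξ‖ ^ 2 := by positivity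
  have hC0 : 0 ≤ C := by
    have := (hC ξ).1.trans (hC ξ).2
    by_contra hneg
    have h2 : 0 < (1 + ‖ξ‖ ^ 2) ^ (-s) := Real.rpow_pos_of_pos hp _
    nlinarith
  rw [Real.norm_of_nonneg (by positivity)]
  have h2 : 1 + ‖ξ‖ ≤ 2 * (1 + ‖ξ‖ ^ 2) ^ (1 / 2 : ℝ) := by
    rw [← Real.sqrt_eq_rpow]
    have a1 : 1 ≤ Real.sqrt (1 + ‖ξ‖ ^ 2) := Real.one_le_sqrt.2 (by nlinarith [sq_nonneg ‖ξ‖])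
    have a2 : ‖ξ‖ ≤ Real.sqrt (1 + ‖ξ‖ ^ 2) := Real.le_sqrt_of_sq_le (by linarith)
    linarith
  calc (1 + ‖ξ‖) * realFourier K ξ
      ≤ (2 * (1 + ‖ξ‖ ^ 2) ^ (1 / 2 : ℝ)) * (C * (1 + ‖ξ‖ ^ 2) ^ (-s)) := by
        gcongr
        exact (hC ξ).2
    _ = 2 * C * ((1 + ‖ξ‖ ^ 2) ^ (1 / 2 : ℝ) * (1 + ‖ξ‖ ^ 2) ^ (-s)) := by ring
    _ = _ := by
        rw [← Real.rpow_add hp]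
        congr 2
        ring

theorem integrable_realFourier (hK : IsSeedCovariance K) : Integrable (realFourier K) := by
  refine hK.integrable_one_add_norm_mul_realFourier.mono'
    hK.continuous_realFourier.aestronglyMeasurable (Eventually.of_forall fun ξ => ?_)
  rw [Real.norm_of_nonneg (hK.realFourier_nonneg ξ)]
  nlinarith [hK.realFourier_nonneg ξ, norm_nonneg ξ,
    mul_nonneg (norm_nonneg ξ) (hK.realFourier_nonneg ξ)]

/-- Fourier inversion for a seed covariance. -/
theorem eq_integral_realFourier (hK : IsSeedCovariance K) (v : RSpace d) :
    (K v : ℂ) = ∫ ξ, (Real.fourierChar (inner ℝ v ξ) : ℂ) * (realFourier K ξ : ℂ) := by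
  have hF : 𝓕 (fun x => (K x : ℂ)) = fun ξ => (realFourier K ξ : ℂ) := funext hK.fourier_eq
  have h := congrFun ((Complex.continuous_ofReal.comp hK.continuous).fourierInv_fourier_eq
    hK.integrable (by
      change Integrable (𝓕 (fun x => (K x : ℂ)))
      rw [hF]
      exact hK.integrable_realFourier.ofReal)) v
  have h' : 𝓕⁻ (𝓕 (fun x => (K x : ℂ))) v = (K v : ℂ) := h
  rw [← h', hF, Real.fourierInv_eq]
  refine integral_congr_ae (Eventually.of_forall fun ξ => ?_)
  simp only [real_inner_comm ξ v]
  rfl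

/-- A seed covariance is Lipschitz at the origin. -/
theorem exists_lipschitz_zero (hK : IsSeedCovariance K) :
    ∃ L : ℝ, 0 ≤ L ∧ ∀ v, |K v - 1| ≤ L * ‖v‖ := by
  have hint := hK.integrable_one_add_norm_mul_realFourier
  refine ⟨2 * Real.pi * ∫ ξ, (1 + ‖ξ‖) * realFourier K ξ, ?_, fun v => ?_⟩
  · refine mul_nonneg (by positivity) (integral_nonneg fun ξ => ?_)
    have := hK.realFourier_nonneg ξ
    positivity
  have hi : ∀ w : RSpace d,
      Integrable fun ξ => (Real.fourierChar (inner ℝ w ξ) : ℂ) * (realFourier K ξ : ℂ) := by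
    intro w
    refine hK.integrable_realFourier.mono' (Continuous.aestronglyMeasurable ?_)
      (Eventually.of_forall fun ξ => ?_)
    · exact (continuous_subtype_val.comp
        (Real.continuous_fourierChar.comp (by fun_prop))).mul
        (Complex.continuous_ofReal.comp hK.continuous_realFourier)
    · rw [norm_mul, Circle.norm_coe, one_mul, Complex.norm_real,
        Real.norm_of_nonneg (hK.realFourier_nonneg ξ)]
  have e : ((K v - 1 : ℝ) : ℂ) = ∫ ξ, ((Real.fourierChar (inner ℝ v ξ) : ℂ) - 1) *
      (realFourier K ξ : ℂ) := by
    have h0 := hK.eq_integral_realFourier 0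
    rw [hK.at_zero] at h0
    have e0 : ∀ ξ, ((Real.fourierChar (inner ℝ v ξ) : ℂ) - 1) * (realFourier K ξ : ℂ) =
        (Real.fourierChar (inner ℝ v ξ) : ℂ) * (realFourier K ξ : ℂ) -
          (Real.fourierChar (inner ℝ 0 ξ) : ℂ) * (realFourier K ξ : ℂ) := by
      intro ξ
      simp [sub_mul]
    simp_rw [e0]
    rw [integral_sub (hi v) (hi 0), ← h0, ← hK.eq_integral_realFourier v]
    push_cast
    rfl
  rw [← Real.norm_eq_abs, ← Complex.norm_real, e]
  calc ‖∫ ξ, ((Real.fourierChar (inner ℝ v ξ) : ℂ) - 1) * (realFourier K ξ : ℂ)‖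
      ≤ ∫ ξ, 2 * Real.pi * ‖v‖ * ((1 + ‖ξ‖) * realFourier K ξ) := by
        refine norm_integral_le_of_norm_le (hint.const_mul _) (Eventually.of_forall fun ξ => ?_)
        have hn := hK.realFourier_nonneg ξ
        rw [norm_mul, Complex.norm_real, Real.norm_of_nonneg hn]
        have h1 : ‖(Real.fourierChar (inner ℝ v ξ) : ℂ) - 1‖ ≤ 2 * Real.pi * (‖v‖ * ‖ξ‖) := by
          rw [Real.fourierChar_apply, mul_comm]
          refine (Real.norm_exp_I_mul_ofReal_sub_one_le).trans ?_
          rw [Real.norm_eq_abs, abs_mul, abs_of_pos (by positivity : 0 < 2 * Real.pi)]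
          gcongr
          exact abs_real_inner_le_norm v ξ
        calc _ ≤ (2 * Real.pi * (‖v‖ * ‖ξ‖)) * realFourier K ξ := by gcongr
          _ = 2 * Real.pi * ‖v‖ * (‖ξ‖ * realFourier K ξ) := by ring
          _ ≤ _ := by
            gcongr
            linarith
    _ = _ := by
        rw [integral_const_mul]
        ring

/-- `K` is the Fourier transform of a nonnegative density of total mass `K 0 = 1`. -/
theorem le_one (hK : IsSeedCovariance K) (v : RSpace d) : K v ≤ 1 := by
  have h0 := hK.eq_integral_realFourier 0
  have h0' : ((1 : ℝ) : ℂ) = ((∫ ξ, realFourier K ξ : ℝ) : ℂ) := by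
    rw [← integral_complex_ofReal, ← hK.at_zero, h0]
    simp
  have h1 : ∫ ξ, realFourier K ξ = 1 := (Complex.ofReal_injective h0').symm
  calc K v ≤ |K v| := le_abs_self _
    _ = ‖(K v : ℂ)‖ := by rw [Complex.norm_real, Real.norm_eq_abs]
    _ ≤ ∫ ξ, realFourier K ξ := by
        rw [hK.eq_integral_realFourier v]
        refine norm_integral_le_of_norm_le hK.integrable_realFourier
          (Eventually.of_forall fun ξ => ?_)
        rw [norm_mul, Circle.norm_coe, one_mul, Complex.norm_real,
          Real.norm_of_nonneg (hK.realFourier_nonneg ξ)]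
    _ = 1 := h1

theorem abs_le_one (hK : IsSeedCovariance K) (v : RSpace d) : |K v| ≤ 1 := by
  rw [abs_of_nonneg (hK.nonneg v)]
  exact hK.le_one v

/-- The square root of `𝓕 K` is real and even, so taking the real part in the definition of the
kernel loses nothing. -/
theorem sqrtKernel_ae_eq (hK : IsSeedCovariance K) :
    ∀ᵐ x, (sqrtKernel hK x : ℂ) =
      (𝓕⁻ (hK.memLp_sqrt.toLp _) : Lp ℂ 2 (volume : Measure (RSpace d))) x := by
  have hc := hK.memLp_sqrt.coeFn_toLp
  have hev : ∀ ξ, realFourier K (-ξ) = realFourier K ξ := by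
    intro ξ
    have h : 𝓕 (fun x => (K x : ℂ)) (-ξ) = 𝓕 (fun x => (K x : ℂ)) ξ := by
      rw [Real.fourier_eq', Real.fourier_eq', ← integral_neg_eq_self]
      congr 1
      funext x
      simp [hK.neg_apply]
    rw [realFourier, h, realFourier]
  have h := fourierInv_im_ae_eq_zero (hK.memLp_sqrt.toLp _)
    (by filter_upwards [hc] with ξ h; rw [h, Complex.conj_ofReal])
    (by
      have hn := (Measure.measurePreserving_neg
        (volume : Measure (RSpace d))).quasiMeasurePreserving.ae hc
      filter_upwards [hc, hn] with ξ h1 h2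
      rw [h1, h2, hev])
  filter_upwards [h] with x hx
  apply Complex.ext
  · simp [sqrtKernel]
  · simp [hx]

theorem stronglyMeasurable_sqrtKernel (hK : IsSeedCovariance K) :
    StronglyMeasurable (sqrtKernel hK) :=
  Complex.continuous_re.comp_stronglyMeasurable (Lp.stronglyMeasurable _)

theorem measurable_sqrtKernel (hK : IsSeedCovariance K) : Measurable (sqrtKernel hK) :=
  hK.stronglyMeasurable_sqrtKernel.measurable

theorem memLp_sqrtKernel (hK : IsSeedCovariance K) : MemLp (sqrtKernel hK) 2 volume :=
  (Lp.memLp (𝓕⁻ (hK.memLp_sqrt.toLp _) : Lp ℂ 2 (volume : Measure (RSpace d)))).re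

/-- The autocorrelation of the square-root kernel is the seed covariance. -/
theorem integral_sqrtKernel_mul_translate (hK : IsSeedCovariance K) (v : RSpace d) :
    ∫ w, sqrtKernel hK w * sqrtKernel hK (w + v) = K v := by
  have h := integral_conj_mul_translate_fourierInv (hK.memLp_sqrt.toLp _) v
  have e1 : ∫ w, (starRingEnd ℂ)
      ((𝓕⁻ (hK.memLp_sqrt.toLp _) : Lp ℂ 2 (volume : Measure (RSpace d))) w) *
        (𝓕⁻ (hK.memLp_sqrt.toLp _) : Lp ℂ 2 (volume : Measure (RSpace d))) (w + v) =
      ((∫ w, sqrtKernel hK w * sqrtKernel hK (w + v) : ℝ) : ℂ) := by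
    rw [← integral_complex_ofReal]
    have ht := (measurePreserving_add_right
      (volume : Measure (RSpace d)) v).quasiMeasurePreserving.ae hK.sqrtKernel_ae_eq
    refine integral_congr_ae ?_
    filter_upwards [hK.sqrtKernel_ae_eq, ht] with w h1 h2
    rw [← h1, ← h2, Complex.conj_ofReal, Complex.ofReal_mul]
  have e2 : ∫ ξ, (starRingEnd ℂ) ((hK.memLp_sqrt.toLp _ : Lp ℂ 2 (volume : Measure (RSpace d))) ξ) *
      ((Real.fourierChar (inner ℝ v ξ) : ℂ) *
        (hK.memLp_sqrt.toLp _ : Lp ℂ 2 (volume : Measure (RSpace d))) ξ) = (K v : ℂ) := by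
    rw [hK.eq_integral_realFourier v]
    refine integral_congr_ae ?_
    filter_upwards [hK.memLp_sqrt.coeFn_toLp] with ξ h1
    rw [h1, Complex.conj_ofReal, mul_left_comm, ← Complex.ofReal_mul,
      Real.mul_self_sqrt (hK.realFourier_nonneg ξ)]
  rw [e1, e2] at h
  exact Complex.ofReal_injective h

end IsSeedCovariance

/-! ### Covariances of test functions at a single scale. -/

section Covariance

variable {d : ℕ} {K : RSpace d → ℝ}

/-- The covariance at scale `e^{-u}` of two test functions. -/
noncomputable def scaleCov (K : RSpace d → ℝ) (ψ₁ ψ₂ : RSpace d → ℝ) (u : ℝ) : ℝ :=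
  ∫ q : RSpace d × RSpace d, K (Real.exp u • (q.1 - q.2)) * (ψ₁ q.1 * ψ₂ q.2)

theorem IsSeedCovariance.integrable_scaleCov (hK : IsSeedCovariance K) {ψ₁ ψ₂ : RSpace d → ℝ}
    (h₁ : Integrable ψ₁) (h₂ : Integrable ψ₂) (u : ℝ) :
    Integrable (fun q : RSpace d × RSpace d => K (Real.exp u • (q.1 - q.2)) * (ψ₁ q.1 * ψ₂ q.2)) := by
  refine (h₁.mul_prod h₂).bdd_mul (c := 1) ?_ (Eventually.of_forall fun q => ?_)
  · exact (hK.continuous.comp (by fun_prop)).aestronglyMeasurable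
  · exact hK.abs_le_one _

theorem integral_comp_exp_smul_sub (g : RSpace d → ℝ) (u : ℝ) (s : RSpace d) :
    ∫ t, g (Real.exp u • (t - s)) = Real.exp (-(d * u)) * ∫ w, g w := by
  rw [integral_sub_right_eq_self (fun t => g (Real.exp u • t)) s, Measure.integral_comp_smul]
  simp only [finrank_euclideanSpace, Fintype.card_fin, smul_eq_mul]
  rw [abs_of_pos (by positivity), Real.exp_neg, Real.exp_nat_mul]

theorem integrable_comp_exp_smul_sub {g : RSpace d → ℝ} (hg : Integrable g) (u : ℝ)
    (s : RSpace d) : Integrable fun t => g (Real.exp u • (t - s)) :=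
  (hg.comp_smul (Real.exp_pos u).ne').comp_sub_right s

/-- Bound `ψ₂` by `M` and integrate its variable out first: the rescaled kernel has mass `e^{-du} ∫
K`. This decay is what makes the integral over all scales converge once the field is tested. -/
theorem IsSeedCovariance.abs_scaleCov_le_exp (hK : IsSeedCovariance K) {ψ₁ ψ₂ : RSpace d → ℝ}
    (h₁ : Integrable ψ₁) (h₂ : Integrable ψ₂) {M : ℝ} (hM : ∀ y, |ψ₂ y| ≤ M) (u : ℝ) :
    |scaleCov K ψ₁ ψ₂ u| ≤ Real.exp (-(d * u)) * ((∫ w, K w) * M * ∫ y, |ψ₁ y|) := by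
  have hM0 : 0 ≤ M := (abs_nonneg _).trans (hM 0)
  have hi := hK.integrable_scaleCov h₁ h₂ u
  have hKint : ∀ s, ∫ t, K (Real.exp u • (s - t)) = Real.exp (-(d * u)) * ∫ w, K w := by
    intro s
    rw [← integral_comp_exp_smul_sub K u s]
    congr 1
    funext t
    rw [← hK.neg_apply, ← smul_neg, neg_sub]
  have hKi : ∀ s, Integrable fun t => K (Real.exp u • (s - t)) := by
    intro s
    refine (integrable_comp_exp_smul_sub hK.integrable_real u s).congr
      (Eventually.of_forall fun t => ?_)
    change K _ = K _
    rw [← hK.neg_apply, ← smul_neg, neg_sub]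
  unfold scaleCov
  calc |∫ q : RSpace d × RSpace d, K (Real.exp u • (q.1 - q.2)) * (ψ₁ q.1 * ψ₂ q.2)|
      ≤ ∫ q : RSpace d × RSpace d, ‖K (Real.exp u • (q.1 - q.2)) * (ψ₁ q.1 * ψ₂ q.2)‖ :=
        norm_integral_le_integral_norm
          (fun q : RSpace d × RSpace d => K (Real.exp u • (q.1 - q.2)) * (ψ₁ q.1 * ψ₂ q.2))
    _ = ∫ s, ∫ t, ‖K (Real.exp u • (s - t)) * (ψ₁ s * ψ₂ t)‖ := integral_prod _ hi.norm
    _ ≤ ∫ s, |ψ₁ s| * (M * (Real.exp (-(d * u)) * ∫ w, K w)) := by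
        refine integral_mono_of_nonneg (Eventually.of_forall fun s => ?_)
          (h₁.abs.mul_const _) (Eventually.of_forall fun s => ?_)
        · exact integral_nonneg fun t => norm_nonneg _
        · have : ∫ t, |ψ₁ s| * (M * K (Real.exp u • (s - t))) =
              |ψ₁ s| * (M * (Real.exp (-(d * u)) * ∫ w, K w)) := by
            rw [integral_const_mul, integral_const_mul, hKint]
          beta_reduce
          rw [← this]
          refine integral_mono_of_nonneg (Eventually.of_forall fun t => norm_nonneg _)
            (((hKi s).const_mul M).const_mul _) (Eventually.of_forall fun t => ?_)
          change ‖_‖ ≤ _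
          rw [norm_mul, norm_mul, Real.norm_of_nonneg (hK.nonneg _), Real.norm_eq_abs,
            Real.norm_eq_abs]
          have := hM t
          have hk := hK.nonneg (Real.exp u • (s - t))
          calc _ ≤ K (Real.exp u • (s - t)) * (|ψ₁ s| * M) := by gcongr
            _ = _ := by ring
    _ = _ := by
        rw [integral_mul_const]
        ring

/-- Finite range of dependence: at scale `e^{-u}` the kernel vanishes beyond distance `e^{-u}`. -/
theorem IsSeedCovariance.scaleCov_eq_zero (hK : IsSeedCovariance K) {ψ₁ ψ₂ : RSpace d → ℝ} {u : ℝ}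
    (h : ∀ s t, ψ₁ s ≠ 0 → ψ₂ t ≠ 0 → Real.exp (-u) < ‖s - t‖) : scaleCov K ψ₁ ψ₂ u = 0 := by
  unfold scaleCov
  refine integral_eq_zero_of_ae (Eventually.of_forall fun q => ?_)
  change _ * _ = (0 : ℝ)
  by_cases h1 : ψ₁ q.1 = 0
  · simp [h1]
  by_cases h2 : ψ₂ q.2 = 0
  · simp [h2]
  rw [hK.eq_zero_of_one_lt_norm, zero_mul]
  rw [norm_smul, Real.norm_of_nonneg (Real.exp_pos u).le]
  calc 1 = Real.exp u * Real.exp (-u) := by rw [← Real.exp_add]; simp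
    _ < _ := by
      gcongr
      exact h _ _ h1 h2

/-- At scales coarse compared with the supports the kernel is nearly `K 0 = 1`, so the covariance
nearly factorises into the two total masses. -/
theorem IsSeedCovariance.abs_scaleCov_sub_le (hK : IsSeedCovariance K) {L : ℝ} (hL0 : 0 ≤ L)
    (hL : ∀ v, |K v - 1| ≤ L * ‖v‖) {ψ₁ ψ₂ : RSpace d → ℝ}
    (h₁ : Integrable ψ₁) (h₂ : Integrable ψ₂) {D : ℝ}
    (hD : ∀ s t, ψ₁ s ≠ 0 → ψ₂ t ≠ 0 → ‖s - t‖ ≤ D) (u : ℝ) :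
    |scaleCov K ψ₁ ψ₂ u - (∫ y, ψ₁ y) * ∫ y, ψ₂ y| ≤
      L * Real.exp u * D * ((∫ y, |ψ₁ y|) * ∫ y, |ψ₂ y|) := by
  unfold scaleCov
  rw [← integral_prod_mul, ← Measure.volume_eq_prod,
    ← integral_sub (hK.integrable_scaleCov h₁ h₂ u) (h₁.mul_prod h₂),
    ← integral_prod_mul, ← integral_const_mul, ← Real.norm_eq_abs]
  refine norm_integral_le_of_norm_le ((h₁.abs.mul_prod h₂.abs).const_mul _)
    (Eventually.of_forall fun q => ?_)
  have e : K (Real.exp u • (q.1 - q.2)) * (ψ₁ q.1 * ψ₂ q.2) - ψ₁ q.1 * ψ₂ q.2 =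
      (K (Real.exp u • (q.1 - q.2)) - 1) * (ψ₁ q.1 * ψ₂ q.2) := by ring
  rw [e, norm_mul, norm_mul, Real.norm_eq_abs, Real.norm_eq_abs, Real.norm_eq_abs]
  by_cases h1 : ψ₁ q.1 = 0
  · simp [h1]
  by_cases h2 : ψ₂ q.2 = 0
  · simp [h2]
  refine mul_le_mul_of_nonneg_right ?_ (by positivity)
  calc _ ≤ L * ‖Real.exp u • (q.1 - q.2)‖ := hL _
    _ = L * (Real.exp u * ‖q.1 - q.2‖) := by
        rw [norm_smul, Real.norm_of_nonneg (Real.exp_pos u).le]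
    _ ≤ L * (Real.exp u * D) := by
        gcongr
        exact hD _ _ h1 h2
    _ = _ := by ring

theorem IsSeedCovariance.scaleCov_sub_right (hK : IsSeedCovariance K) {ψ₁ ψ₂ ψ₃ : RSpace d → ℝ}
    (h₁ : Integrable ψ₁) (h₂ : Integrable ψ₂) (h₃ : Integrable ψ₃) (u : ℝ) :
    scaleCov K ψ₁ (fun y => ψ₂ y - ψ₃ y) u = scaleCov K ψ₁ ψ₂ u - scaleCov K ψ₁ ψ₃ u := by
  unfold scaleCov
  rw [← integral_sub (hK.integrable_scaleCov h₁ h₂ u) (hK.integrable_scaleCov h₁ h₃ u)]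
  congr 1
  funext q
  ring

/-- Covariances at a given scale are translation invariant. -/
theorem scaleCov_comp_sub (ψ₁ ψ₂ : RSpace d → ℝ) (x : RSpace d) (u : ℝ) :
    scaleCov K (fun y => ψ₁ (x - y)) (fun y => ψ₂ (x - y)) u =
      scaleCov K (fun y => ψ₁ (-y)) (fun y => ψ₂ (-y)) u := by
  unfold scaleCov
  rw [Measure.volume_eq_prod, ← integral_add_right_eq_self _ (x, x)]
  refine integral_congr_ae (Eventually.of_forall fun q => ?_)
  simp

end Covariance

/-! ### Convolution with the rescaled square-root kernel. -/

section Convolution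

variable {d : ℕ} {K : RSpace d → ℝ}

/-- Convolution of a test function with the square-root kernel at scale `e^{-u}`. -/
noncomputable def scaleConv (hK : IsSeedCovariance K) (ψ : RSpace d → ℝ) (u : ℝ) (z : RSpace d) :
    ℝ :=
  ∫ y, sqrtKernel hK (Real.exp u • (z - y)) * ψ y

theorem memLp_comp_exp_smul_sub (hK : IsSeedCovariance K) (u : ℝ) (y : RSpace d) :
    MemLp (fun z => sqrtKernel hK (Real.exp u • (z - y))) 2 volume := by
  rw [memLp_two_iff_integrable_sq]
  · exact integrable_comp_exp_smul_sub hK.memLp_sqrtKernel.integrable_sq u y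
  · exact (hK.measurable_sqrtKernel.comp (by fun_prop)).aestronglyMeasurable

theorem integral_sqrtKernel_scaled (hK : IsSeedCovariance K) (u : ℝ) (y y' : RSpace d) :
    ∫ z, sqrtKernel hK (Real.exp u • (z - y)) * sqrtKernel hK (Real.exp u • (z - y')) =
      Real.exp (-(d * u)) * K (Real.exp u • (y - y')) := by
  rw [← hK.integral_sqrtKernel_mul_translate (Real.exp u • (y - y')),
    ← integral_comp_exp_smul_sub _ u y]
  congr 1
  funext z
  rw [← smul_add, sub_add_sub_cancel]

/-- Justifies exchanging the integral over `z` with those over the two test variables. Since `2|ab|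
≤ a² + b²` and the square integral of a translated kernel does not depend on the translation, the
`z`-integral of the absolute value is at most `e^{-du} |ψ₁ ψ₂|`. -/
theorem integrable_scaleConv_triple (hK : IsSeedCovariance K) {ψ₁ ψ₂ : RSpace d → ℝ}
    (c₁ : Measurable ψ₁) (c₂ : Measurable ψ₂)
    (h₁ : Integrable ψ₁) (h₂ : Integrable ψ₂) (u : ℝ) :
    Integrable (fun q : RSpace d × (RSpace d × RSpace d) =>
      (sqrtKernel hK (Real.exp u • (q.1 - q.2.1)) * ψ₁ q.2.1) *
        (sqrtKernel hK (Real.exp u • (q.1 - q.2.2)) * ψ₂ q.2.2)) (volume.prod volume) := by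
  have hm := hK.measurable_sqrtKernel
  rw [integrable_prod_iff' (by
    refine Measurable.aestronglyMeasurable ?_
    exact ((hm.comp (by fun_prop)).mul (c₁.comp (by fun_prop))).mul
      ((hm.comp (by fun_prop)).mul (c₂.comp (by fun_prop))))]
  have hprod : ∀ y y', Integrable fun z => sqrtKernel hK (Real.exp u • (z - y)) *
      sqrtKernel hK (Real.exp u • (z - y')) := fun y y' =>
    (memLp_comp_exp_smul_sub hK u y).integrable_mul (memLp_comp_exp_smul_sub hK u y')
  have hrw : ∀ (z : RSpace d) (y y' : RSpace d),
      (sqrtKernel hK (Real.exp u • (z - y)) * ψ₁ y) *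
        (sqrtKernel hK (Real.exp u • (z - y')) * ψ₂ y') =
      (ψ₁ y * ψ₂ y') * (sqrtKernel hK (Real.exp u • (z - y)) *
        sqrtKernel hK (Real.exp u • (z - y'))) := fun z y y' => by ring
  simp_rw [hrw]
  refine ⟨Eventually.of_forall fun q => (hprod _ _).const_mul _, ?_⟩
  have hsq : ∀ y, ∫ z, sqrtKernel hK (Real.exp u • (z - y)) ^ 2 = Real.exp (-(d * u)) := by
    intro y
    have := integral_sqrtKernel_scaled hK u y y
    simpa [hK.at_zero, ← sq] using this
  refine ((h₁.mul_prod h₂).norm.mul_const (Real.exp (-(d * u)))).mono' ?_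
    (Eventually.of_forall fun q => ?_)
  · refine (StronglyMeasurable.integral_prod_right' (f := fun q : (RSpace d × RSpace d) × RSpace d =>
      ‖ψ₁ q.1.1 * ψ₂ q.1.2 * (sqrtKernel hK (Real.exp u • (q.2 - q.1.1)) *
        sqrtKernel hK (Real.exp u • (q.2 - q.1.2)))‖) ?_).aestronglyMeasurable
    refine Measurable.stronglyMeasurable (Measurable.norm ?_)
    exact ((c₁.comp (by fun_prop)).mul (c₂.comp (by fun_prop))).mul
      ((hm.comp (by fun_prop)).mul (hm.comp (by fun_prop)))
  · simp_rw [norm_mul (ψ₁ q.1 * ψ₂ q.2)]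
    rw [integral_const_mul, norm_mul, norm_norm]
    gcongr
    rw [Real.norm_of_nonneg (integral_nonneg fun z => norm_nonneg _)]
    have hb : ∀ z, ‖sqrtKernel hK (Real.exp u • (z - q.1)) * sqrtKernel hK (Real.exp u • (z - q.2))‖
        ≤ 2⁻¹ * (sqrtKernel hK (Real.exp u • (z - q.1)) ^ 2 +
          sqrtKernel hK (Real.exp u • (z - q.2)) ^ 2) := by
      intro z
      rw [Real.norm_eq_abs, abs_le]
      constructor <;> nlinarith [sq_nonneg (sqrtKernel hK (Real.exp u • (z - q.1)) +
        sqrtKernel hK (Real.exp u • (z - q.2))), sq_nonneg (sqrtKernel hK (Real.exp u • (z - q.1)) -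
        sqrtKernel hK (Real.exp u • (z - q.2)))]
    have i1 := (memLp_comp_exp_smul_sub hK u q.1).integrable_sq
    have i2 := (memLp_comp_exp_smul_sub hK u q.2).integrable_sq
    refine (integral_mono (hprod _ _).norm ((i1.add i2).const_mul _) hb).trans_eq ?_
    simp only [Pi.add_apply]
    rw [integral_const_mul, integral_add i1 i2, hsq, hsq]
    ring

theorem integrable_scaleConv_mul (hK : IsSeedCovariance K) {ψ₁ ψ₂ : RSpace d → ℝ}
    (c₁ : Measurable ψ₁) (c₂ : Measurable ψ₂)
    (h₁ : Integrable ψ₁) (h₂ : Integrable ψ₂) (u : ℝ) :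
    Integrable (fun z => scaleConv hK ψ₁ u z * scaleConv hK ψ₂ u z) := by
  refine (integrable_scaleConv_triple hK c₁ c₂ h₁ h₂ u).integral_prod_left.congr
    (Eventually.of_forall fun z => ?_)
  exact integral_prod_mul (fun y => sqrtKernel hK (Real.exp u • (z - y)) * ψ₁ y)
    (fun y => sqrtKernel hK (Real.exp u • (z - y)) * ψ₂ y)

theorem integral_scaleConv_mul (hK : IsSeedCovariance K) {ψ₁ ψ₂ : RSpace d → ℝ}
    (c₁ : Measurable ψ₁) (c₂ : Measurable ψ₂)
    (h₁ : Integrable ψ₁) (h₂ : Integrable ψ₂) (u : ℝ) :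
    ∫ z, scaleConv hK ψ₁ u z * scaleConv hK ψ₂ u z =
      Real.exp (-(d * u)) * scaleCov K ψ₁ ψ₂ u := by
  have h := integrable_scaleConv_triple hK c₁ c₂ h₁ h₂ u
  calc _ = ∫ z, ∫ q : RSpace d × RSpace d, (sqrtKernel hK (Real.exp u • (z - q.1)) * ψ₁ q.1) *
        (sqrtKernel hK (Real.exp u • (z - q.2)) * ψ₂ q.2) := by
        refine integral_congr_ae (Eventually.of_forall fun z => ?_)
        exact (integral_prod_mul (fun y => sqrtKernel hK (Real.exp u • (z - y)) * ψ₁ y)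
          (fun y => sqrtKernel hK (Real.exp u • (z - y)) * ψ₂ y)).symm
    _ = ∫ q : RSpace d × RSpace d, ∫ z, (sqrtKernel hK (Real.exp u • (z - q.1)) * ψ₁ q.1) *
        (sqrtKernel hK (Real.exp u • (z - q.2)) * ψ₂ q.2) := integral_integral_swap h
    _ = ∫ q : RSpace d × RSpace d, Real.exp (-(d * u)) *
        (K (Real.exp u • (q.1 - q.2)) * (ψ₁ q.1 * ψ₂ q.2)) := by
        refine integral_congr_ae (Eventually.of_forall fun q => ?_)
        beta_reduce
        rw [← mul_assoc, ← integral_sqrtKernel_scaled hK u q.1 q.2, ← integral_mul_const]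
        congr 1
        funext z
        ring
    _ = _ := integral_const_mul _ _

theorem measurable_scaleConv (hK : IsSeedCovariance K) {ψ : RSpace d → ℝ} (hψ : Measurable ψ) :
    Measurable fun p : RSpace d × ℝ => scaleConv hK ψ p.2 p.1 := by
  refine (StronglyMeasurable.integral_prod_right' (f := fun q : (RSpace d × ℝ) × RSpace d =>
    sqrtKernel hK (Real.exp q.1.2 • (q.1.1 - q.2)) * ψ q.2) ?_).measurable
  exact ((hK.measurable_sqrtKernel.comp (by fun_prop)).mul
    (hψ.comp (by fun_prop))).stronglyMeasurable

end Convolution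

/-! ### Decomposition of the field into layers of scales. -/

section Layers

variable {d : ℕ} {K : RSpace d → ℝ}

/-- Continuous compactly supported test functions. -/
structure IsTestFunction (ψ : RSpace d → ℝ) : Prop where
  continuous : Continuous ψ
  hasCompactSupport : HasCompactSupport ψ

theorem IsTestFunction.integrable {ψ : RSpace d → ℝ} (hψ : IsTestFunction ψ) : Integrable ψ :=
  hψ.continuous.integrable_of_hasCompactSupport hψ.hasCompactSupport

theorem IsTestFunction.measurable {ψ : RSpace d → ℝ} (hψ : IsTestFunction ψ) : Measurable ψ :=
  hψ.continuous.measurable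

theorem IsTestFunction.exists_bound {ψ : RSpace d → ℝ} (hψ : IsTestFunction ψ) :
    ∃ M, ∀ y, |ψ y| ≤ M :=
  hψ.continuous.bounded_above_of_compact_support hψ.hasCompactSupport

/-- The intensity `1 - a e^{-αu}` of the scale `e^{-u}`. -/
noncomputable def scaleRate (α : ℝ≥0∞) (a u : ℝ) : ℝ := 1 - a * expDecay α u

theorem measurable_scaleRate (α : ℝ≥0∞) (a : ℝ) : Measurable (scaleRate α a) := by
  unfold scaleRate expDecay
  split_ifs <;> fun_prop

theorem scaleRate_mem {α : ℝ≥0∞} {a : ℝ} (ha : a ∈ Set.Icc (0 : ℝ) 1) {u : ℝ} (hu : 0 < u) :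
    scaleRate α a u ∈ Set.Icc (0 : ℝ) 1 := by
  have h : expDecay α u ∈ Set.Icc (0 : ℝ) 1 := by
    unfold expDecay
    split_ifs
    · simp
    · refine ⟨(Real.exp_pos _).le, Real.exp_le_one_iff.2 ?_⟩
      have : 0 ≤ α.toReal * u := by positivity
      linarith
  obtain ⟨h0, h1⟩ := h
  obtain ⟨a0, a1⟩ := ha
  unfold scaleRate
  constructor <;> nlinarith

/-- The part at scales `e^{-u}`, `u ∈ A`, of the kernel of the field tested against `ψ`. -/
noncomputable def layerFun (hK : IsSeedCovariance K) (α : ℝ≥0∞) (a : ℝ) (A : Set ℝ)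
    (ψ : RSpace d → ℝ) (p : RSpace d × ℝ) : ℝ :=
  A.indicator (fun u => Real.exp ((d : ℝ) * u / 2) * Real.sqrt (scaleRate α a u) *
    scaleConv hK ψ u p.1) p.2

theorem measurable_layerFun (hK : IsSeedCovariance K) (α : ℝ≥0∞) (a : ℝ) {A : Set ℝ}
    (hA : MeasurableSet A) {ψ : RSpace d → ℝ} (hψ : Measurable ψ) :
    Measurable (layerFun hK α a A ψ) := by
  have h1 := measurable_scaleRate α a
  have h2 := measurable_scaleConv hK hψ
  have : layerFun hK α a A ψ = (Prod.snd ⁻¹' A).indicator fun p : RSpace d × ℝ =>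
      Real.exp ((d : ℝ) * p.2 / 2) * Real.sqrt (scaleRate α a p.2) * scaleConv hK ψ p.2 p.1 := rfl
  rw [this]
  exact (by fun_prop : Measurable _).indicator (measurable_snd hA)

theorem layerFun_mul (hK : IsSeedCovariance K) {α : ℝ≥0∞} {a : ℝ} (ha : a ∈ Set.Icc (0 : ℝ) 1)
    (A B : Set ℝ) (ψ₁ ψ₂ : RSpace d → ℝ) {u : ℝ} (hu : 0 < u) (z : RSpace d) :
    layerFun hK α a A ψ₁ (z, u) * layerFun hK α a B ψ₂ (z, u) =
      (A ∩ B).indicator (fun u => Real.exp (d * u) * scaleRate α a u) u *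
        (scaleConv hK ψ₁ u z * scaleConv hK ψ₂ u z) := by
  have hr := (scaleRate_mem (α := α) ha hu).1
  by_cases hA : u ∈ A <;> by_cases hB : u ∈ B <;> simp [layerFun, hA, hB]
  have e : Real.exp (d * u) = Real.exp (d * u / 2) * Real.exp (d * u / 2) := by
    rw [← Real.exp_add]; ring_nf
  rw [e]
  calc _ = Real.exp (d * u / 2) * Real.exp (d * u / 2) *
        (Real.sqrt (scaleRate α a u) * Real.sqrt (scaleRate α a u)) *
        (scaleConv hK ψ₁ u z * scaleConv hK ψ₂ u z) := by ring
    _ = _ := by rw [Real.mul_self_sqrt hr]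

/-- The weights `e^{du/2}` of the two factors multiply to `e^{du}`, which cancels the Jacobian
`e^{-du}` of the rescaled autocorrelation. -/
theorem integral_layerFun_mul (hK : IsSeedCovariance K) {α : ℝ≥0∞} {a : ℝ}
    (ha : a ∈ Set.Icc (0 : ℝ) 1) (A B : Set ℝ) {ψ₁ ψ₂ : RSpace d → ℝ}
    (h₁ : IsTestFunction ψ₁) (h₂ : IsTestFunction ψ₂) {u : ℝ} (hu : 0 < u) :
    ∫ z, layerFun hK α a A ψ₁ (z, u) * layerFun hK α a B ψ₂ (z, u) =
      (A ∩ B).indicator (fun u => scaleRate α a u * scaleCov K ψ₁ ψ₂ u) u := by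
  simp_rw [layerFun_mul hK ha A B ψ₁ ψ₂ hu]
  rw [integral_const_mul,
    integral_scaleConv_mul hK h₁.measurable h₂.measurable h₁.integrable h₂.integrable]
  by_cases h : u ∈ A ∩ B
  · rw [Set.indicator_of_mem h, Set.indicator_of_mem h]
    have : Real.exp (d * u) * Real.exp (-(d * u)) = 1 := by rw [← Real.exp_add]; simp
    calc _ = Real.exp (d * u) * Real.exp (-(d * u)) * (scaleRate α a u * scaleCov K ψ₁ ψ₂ u) := by
          ring
      _ = _ := by rw [this, one_mul]
  · rw [Set.indicator_of_notMem h, Set.indicator_of_notMem h, zero_mul]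

theorem integrableOn_exp_neg_mul {d : ℕ} (hd : 0 < d) :
    IntegrableOn (fun u : ℝ => Real.exp (-(d * u))) (Set.Ioi 0) := by
  have := exp_neg_integrableOn_Ioi 0 (b := (d : ℝ)) (by exact_mod_cast hd)
  simpa [neg_mul] using this

theorem memLp_layerFun (hd : 0 < d) (hK : IsSeedCovariance K) {α : ℝ≥0∞} {a : ℝ}
    (ha : a ∈ Set.Icc (0 : ℝ) 1) {A : Set ℝ} (hA : MeasurableSet A) {ψ : RSpace d → ℝ}
    (hψ : IsTestFunction ψ) : MemLp (layerFun hK α a A ψ) 2 (spaceTime d) := by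
  have hm := measurable_layerFun hK α a hA hψ.measurable
  rw [memLp_two_iff_integrable_sq hm.aestronglyMeasurable]
  unfold spaceTime
  rw [integrable_prod_iff' (hm.pow_const 2).aestronglyMeasurable]
  have hpos : ∀ᵐ u ∂(volume.restrict (Set.Ioi (0 : ℝ))), (0 : ℝ) < u :=
    ae_restrict_mem measurableSet_Ioi
  constructor
  · filter_upwards [hpos] with u hu
    simp_rw [sq, layerFun_mul hK ha A A ψ ψ hu]
    exact (integrable_scaleConv_mul hK hψ.measurable hψ.measurable hψ.integrable hψ.integrable
      u).const_mul _
  · obtain ⟨M, hM⟩ := hψ.exists_bound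
    refine Integrable.mono' ((integrableOn_exp_neg_mul hd).mul_const
      ((∫ w, K w) * M * ∫ y, |ψ y|)) ?_ ?_
    · refine (StronglyMeasurable.integral_prod_right' (f := fun q : ℝ × RSpace d =>
        ‖layerFun hK α a A ψ (q.2, q.1) ^ 2‖) ?_).aestronglyMeasurable
      exact ((hm.comp measurable_swap).pow_const 2).norm.stronglyMeasurable
    · filter_upwards [hpos] with u hu
      have e : ∀ z, ‖layerFun hK α a A ψ (z, u) ^ 2‖ =
          layerFun hK α a A ψ (z, u) * layerFun hK α a A ψ (z, u) := by
        intro z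
        rw [Real.norm_of_nonneg (sq_nonneg _), sq]
      simp_rw [e, integral_layerFun_mul hK ha A A hψ hψ hu]
      refine (norm_indicator_le_norm_self _ _).trans ?_
      have hr := scaleRate_mem (α := α) ha hu
      rw [norm_mul, Real.norm_of_nonneg hr.1, Real.norm_eq_abs]
      calc _ ≤ 1 * |scaleCov K ψ ψ u| := by
            gcongr
            exact hr.2
        _ ≤ _ := by
            rw [one_mul]
            exact hK.abs_scaleCov_le_exp hψ.integrable hψ.integrable hM u

open Classical in
/-- The class in `L²` of a function, and `0` if it is not square-integrable. -/
noncomputable def toL2 {X : Type*} [MeasurableSpace X] (μ : Measure X) (h : X → ℝ) : Lp ℝ 2 μ :=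
  if hh : MemLp h 2 μ then hh.toLp h else 0

theorem coeFn_toL2 {X : Type*} [MeasurableSpace X] {μ : Measure X} {h : X → ℝ}
    (hh : MemLp h 2 μ) : toL2 μ h =ᵐ[μ] h := by
  rw [toL2, dif_pos hh]
  exact hh.coeFn_toLp

/-- The part at scales `e^{-u}`, `u ∈ A`, of the kernel of the field tested against `ψ`, as an
element of `L²`. -/
noncomputable def layer (hK : IsSeedCovariance K) (α : ℝ≥0∞) (a : ℝ) (A : Set ℝ)
    (ψ : RSpace d → ℝ) : Lp ℝ 2 (spaceTime d) :=
  toL2 (spaceTime d) (layerFun hK α a A ψ)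

theorem starField_eq_layer (hd : 0 < d) {Ω : Type*} (W : Lp ℝ 2 (spaceTime d) → Ω → ℝ)
    (hK : IsSeedCovariance K) {α : ℝ≥0∞} {a : ℝ} (ha : a ∈ Set.Icc (0 : ℝ) 1) {ψ : RSpace d → ℝ}
    (hψ : IsTestFunction ψ) : starField W hK α a ψ = W (layer hK α a Set.univ ψ) := by
  have hm := memLp_layerFun hd hK (α := α) ha MeasurableSet.univ hψ
  have e : (fun p : RSpace d × ℝ => Real.exp ((d : ℝ) * p.2 / 2) *
      Real.sqrt (1 - a * expDecay α p.2) * ∫ y, sqrtKernel hK (Real.exp p.2 • (p.1 - y)) * ψ y) =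
      layerFun hK α a Set.univ ψ := by
    funext p
    simp [layerFun, scaleRate, scaleConv]
  rw [starField, e, whiteNoiseIntegral, dif_pos hm, layer, toL2, dif_pos hm]

/-- Only scales common to both sets contribute, since white noise is uncorrelated across scales.
Every covariance estimate below reduces to this one-dimensional integral. -/
theorem inner_layer (hd : 0 < d) (hK : IsSeedCovariance K) {α : ℝ≥0∞} {a : ℝ}
    (ha : a ∈ Set.Icc (0 : ℝ) 1) {A B : Set ℝ} (hA : MeasurableSet A) (hB : MeasurableSet B)
    {ψ₁ ψ₂ : RSpace d → ℝ} (h₁ : IsTestFunction ψ₁) (h₂ : IsTestFunction ψ₂) :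
    inner ℝ (layer hK α a A ψ₁) (layer hK α a B ψ₂) =
      ∫ u in Set.Ioi 0 ∩ (A ∩ B), scaleRate α a u * scaleCov K ψ₁ ψ₂ u := by
  have m₁ := memLp_layerFun hd hK (α := α) ha hA h₁
  have m₂ := memLp_layerFun hd hK (α := α) ha hB h₂
  have hi : Integrable (fun p => layerFun hK α a A ψ₁ p * layerFun hK α a B ψ₂ p) (spaceTime d) :=
    m₁.integrable_mul m₂
  rw [L2.inner_def]
  calc _ = ∫ p, layerFun hK α a A ψ₁ p * layerFun hK α a B ψ₂ p ∂(spaceTime d) := by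
        refine integral_congr_ae ?_
        filter_upwards [coeFn_toL2 m₁, coeFn_toL2 m₂] with p h1 h2
        rw [layer, layer, h1, h2, mul_comm]
        rfl
    _ = ∫ u in Set.Ioi (0 : ℝ), ∫ z, layerFun hK α a A ψ₁ (z, u) * layerFun hK α a B ψ₂ (z, u) :=
        integral_prod_symm _ hi
    _ = ∫ u in Set.Ioi (0 : ℝ),
          (A ∩ B).indicator (fun u => scaleRate α a u * scaleCov K ψ₁ ψ₂ u) u :=
        setIntegral_congr_fun measurableSet_Ioi fun u hu =>
          integral_layerFun_mul hK ha A B h₁ h₂ hu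
    _ = _ := setIntegral_indicator (hA.inter hB)

theorem measurable_scaleCov (hK : IsSeedCovariance K) {ψ₁ ψ₂ : RSpace d → ℝ}
    (h₁ : Measurable ψ₁) (h₂ : Measurable ψ₂) : Measurable (scaleCov K ψ₁ ψ₂) := by
  refine (StronglyMeasurable.integral_prod_right' (f := fun p : ℝ × (RSpace d × RSpace d) =>
    K (Real.exp p.1 • (p.2.1 - p.2.2)) * (ψ₁ p.2.1 * ψ₂ p.2.2)) ?_).measurable
  exact ((hK.continuous.measurable.comp (by fun_prop)).mul
    ((h₁.comp (by fun_prop)).mul (h₂.comp (by fun_prop)))).stronglyMeasurable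

theorem integrableOn_scaleRate_mul_scaleCov (hd : 0 < d) (hK : IsSeedCovariance K) {α : ℝ≥0∞}
    {a : ℝ} (ha : a ∈ Set.Icc (0 : ℝ) 1) {ψ₁ ψ₂ : RSpace d → ℝ} (h₁ : IsTestFunction ψ₁)
    (h₂ : IsTestFunction ψ₂) :
    IntegrableOn (fun u => scaleRate α a u * scaleCov K ψ₁ ψ₂ u) (Set.Ioi 0) := by
  obtain ⟨M, hM⟩ := h₂.exists_bound
  refine Integrable.mono' ((integrableOn_exp_neg_mul hd).mul_const
    ((∫ w, K w) * M * ∫ y, |ψ₁ y|)) ?_ ?_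
  · exact ((measurable_scaleRate α a).mul
      (measurable_scaleCov hK h₁.measurable h₂.measurable)).aestronglyMeasurable
  · filter_upwards [ae_restrict_mem measurableSet_Ioi] with u hu
    have hr := scaleRate_mem (α := α) ha hu
    rw [norm_mul, Real.norm_of_nonneg hr.1, Real.norm_eq_abs]
    calc _ ≤ 1 * |scaleCov K ψ₁ ψ₂ u| := by
          gcongr
          exact hr.2
      _ ≤ _ := by
          rw [one_mul]
          exact hK.abs_scaleCov_le_exp h₁.integrable h₂.integrable hM u

/-- Bound for scalar products of layers at the scales `e^{-u}`, `u > T`. -/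
theorem abs_setIntegral_scaleCov_le (hd : 0 < d) (hK : IsSeedCovariance K) {α : ℝ≥0∞}
    {a : ℝ} (ha : a ∈ Set.Icc (0 : ℝ) 1) {ψ₁ ψ₂ : RSpace d → ℝ} (h₁ : IsTestFunction ψ₁)
    (h₂ : IsTestFunction ψ₂) {M : ℝ} (hM : ∀ y, |ψ₂ y| ≤ M) {A : Set ℝ} (hA : MeasurableSet A)
    {T : ℝ} (hT : 0 ≤ T) (hAT : A ⊆ Set.Ici T) :
    |∫ u in Set.Ioi 0 ∩ A, scaleRate α a u * scaleCov K ψ₁ ψ₂ u| ≤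
      Real.exp (-(d * T)) / d * ((∫ w, K w) * M * ∫ y, |ψ₁ y|) := by
  have hdR : (0 : ℝ) < d := by exact_mod_cast hd
  set c := (∫ w, K w) * M * ∫ y, |ψ₁ y| with hc
  have hM0 : 0 ≤ M := (abs_nonneg _).trans (hM 0)
  have hc0 : 0 ≤ c := mul_nonneg (mul_nonneg (integral_nonneg hK.nonneg) hM0)
    (integral_nonneg fun y => abs_nonneg _)
  have hexp : IntegrableOn (fun u : ℝ => Real.exp (-(d * u))) (Set.Ioi T) :=
    (integrableOn_exp_neg_mul hd).mono_set (Set.Ioi_subset_Ioi hT)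
  have hval : ∫ u in Set.Ioi T, Real.exp (-(d * u)) = Real.exp (-(d * T)) / d := by
    have := integral_exp_mul_Ioi (a := -(d : ℝ)) (by linarith) T
    simp only [neg_mul] at this
    rw [this]
    rw [neg_div_neg_eq]
  have hexp' : IntegrableOn (fun u : ℝ => Real.exp (-(d * u))) (Set.Ici T) :=
    (integrableOn_Ici_iff_integrableOn_Ioi).2 hexp
  calc _ ≤ ∫ u in Set.Ioi 0 ∩ A, Real.exp (-(d * u)) * c := by
        rw [← Real.norm_eq_abs]
        refine norm_integral_le_of_norm_le
          ((hexp'.mono_set (Set.inter_subset_right.trans hAT)).mul_const c) ?_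
        filter_upwards [ae_restrict_mem (measurableSet_Ioi.inter hA)] with u hu
        have hr := scaleRate_mem (α := α) ha hu.1
        rw [norm_mul, Real.norm_of_nonneg hr.1, Real.norm_eq_abs]
        calc _ ≤ 1 * |scaleCov K ψ₁ ψ₂ u| := by
              gcongr
              exact hr.2
          _ ≤ _ := by
              rw [one_mul]
              exact hK.abs_scaleCov_le_exp h₁.integrable h₂.integrable hM u
    _ ≤ ∫ u in Set.Ici T, Real.exp (-(d * u)) * c := by
        refine setIntegral_mono_set (hexp'.mul_const c)
          (Eventually.of_forall fun u => mul_nonneg (Real.exp_pos _).le hc0)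
          (LE.le.eventuallyLE (Set.inter_subset_right.trans hAT))
    _ = _ := by rw [integral_Ici_eq_integral_Ioi, integral_mul_const, hval]

/-- Scalar products of layers at the scales `e^{-u}`, `u ≤ T`, for localized test functions of
integral one. -/
theorem abs_setIntegral_scaleCov_sub_le (hd : 0 < d) (hK : IsSeedCovariance K) {L : ℝ}
    (hL0 : 0 ≤ L) (hL : ∀ v, |K v - 1| ≤ L * ‖v‖) {α : ℝ≥0∞}
    {a : ℝ} (ha : a ∈ Set.Icc (0 : ℝ) 1) {ψ₁ ψ₂ : RSpace d → ℝ} (h₁ : IsTestFunction ψ₁)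
    (h₂ : IsTestFunction ψ₂) (i₁ : ∫ y, ψ₁ y = 1) (i₂ : ∫ y, ψ₂ y = 1) {D : ℝ} (hD0 : 0 ≤ D)
    (hD : ∀ s t, ψ₁ s ≠ 0 → ψ₂ t ≠ 0 → ‖s - t‖ ≤ D) (T : ℝ) :
    |(∫ u in Set.Ioi 0 ∩ Set.Iio T, scaleRate α a u * scaleCov K ψ₁ ψ₂ u) -
      ∫ u in Set.Ioi 0 ∩ Set.Iio T, scaleRate α a u| ≤
      L * D * ((∫ y, |ψ₁ y|) * ∫ y, |ψ₂ y|) * Real.exp T := by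
  set c := L * D * ((∫ y, |ψ₁ y|) * ∫ y, |ψ₂ y|) with hc
  have hc0 : 0 ≤ c := mul_nonneg (mul_nonneg hL0 hD0)
    (mul_nonneg (integral_nonneg fun y => abs_nonneg _) (integral_nonneg fun y => abs_nonneg _))
  have hS : (Set.Ioi 0 ∩ Set.Iio T : Set ℝ) = Set.Ioo 0 T := Set.Ioi_inter_Iio
  have hrate : IntegrableOn (scaleRate α a) (Set.Ioo 0 T) := by
    refine Integrable.mono' (g := fun _ => (1 : ℝ)) (integrableOn_const (by simp))
      (measurable_scaleRate α a).aestronglyMeasurable ?_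
    filter_upwards [ae_restrict_mem measurableSet_Ioo] with u hu
    have hr := scaleRate_mem (α := α) ha hu.1
    rw [Real.norm_of_nonneg hr.1]
    exact hr.2
  rw [hS, ← integral_sub ((integrableOn_scaleRate_mul_scaleCov hd hK ha h₁ h₂).mono_set
    Set.Ioo_subset_Ioi_self) hrate]
  have hexp : IntegrableOn (fun u : ℝ => c * Real.exp u) (Set.Iio T) :=
    ((integrableOn_exp_Iic T).mono_set Set.Iio_subset_Iic_self).const_mul c
  calc _ ≤ ∫ u in Set.Ioo 0 T, c * Real.exp u := by
        rw [← Real.norm_eq_abs]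
        refine norm_integral_le_of_norm_le (hexp.mono_set Set.Ioo_subset_Iio_self) ?_
        filter_upwards [ae_restrict_mem measurableSet_Ioo] with u hu
        have hr := scaleRate_mem (α := α) ha hu.1
        have e : scaleRate α a u * scaleCov K ψ₁ ψ₂ u - scaleRate α a u =
            scaleRate α a u * (scaleCov K ψ₁ ψ₂ u - (∫ y, ψ₁ y) * ∫ y, ψ₂ y) := by
          rw [i₁, i₂]; ring
        rw [e, norm_mul, Real.norm_of_nonneg hr.1, Real.norm_eq_abs]
        calc _ ≤ 1 * |scaleCov K ψ₁ ψ₂ u - (∫ y, ψ₁ y) * ∫ y, ψ₂ y| := by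
              gcongr
              exact hr.2
          _ ≤ L * Real.exp u * D * ((∫ y, |ψ₁ y|) * ∫ y, |ψ₂ y|) := by
              rw [one_mul]
              exact hK.abs_scaleCov_sub_le hL0 hL h₁.integrable h₂.integrable hD u
          _ = _ := by rw [hc]; ring
    _ ≤ ∫ u in Set.Iio T, c * Real.exp u :=
        setIntegral_mono_set hexp
          (Eventually.of_forall fun u => mul_nonneg hc0 (Real.exp_pos _).le)
          (LE.le.eventuallyLE Set.Ioo_subset_Iio_self)
    _ = _ := by
        rw [integral_const_mul, ← integral_Iic_eq_integral_Iio, integral_exp_Iic]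

end Layers

/-! ### Covariance geometry of the mollified layers. -/

section Mollified

variable {d : ℕ} {K : RSpace d → ℝ} {φ : RSpace d → ℝ}

theorem IsMollifier.hasCompactSupport (hφ : IsMollifier φ) : HasCompactSupport φ :=
  HasCompactSupport.of_support_subset_isCompact (isCompact_closedBall 0 1)
    ((subset_tsupport φ).trans hφ.support)

theorem IsMollifier.isTestFunction (hφ : IsMollifier φ) : IsTestFunction φ :=
  ⟨hφ.smooth.continuous, hφ.hasCompactSupport⟩

theorem IsMollifier.isTestFunction_scaled (hφ : IsMollifier φ) {ε : ℝ} (hε : 0 < ε)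
    (x : RSpace d) : IsTestFunction fun y => scaledMollifier φ ε (x - y) := by
  have hc := hφ.smooth.continuous
  refine ⟨?_, ?_⟩
  · unfold scaledMollifier
    fun_prop
  · have h1 : HasCompactSupport fun y => φ (ε⁻¹ • (x - y)) := by
      let e : RSpace d ≃ₜ RSpace d :=
        (Homeomorph.subLeft x).trans (Homeomorph.smulOfNeZero ε⁻¹ (inv_ne_zero hε.ne'))
      exact hφ.hasCompactSupport.comp_homeomorph e
    exact h1.mul_left

theorem integral_scaledMollifier (g : RSpace d → ℝ) {ε : ℝ} (hε : 0 < ε) (x : RSpace d) :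
    ∫ y, (ε ^ d)⁻¹ * g (ε⁻¹ • (x - y)) = ∫ y, g y := by
  rw [integral_const_mul, integral_sub_left_eq_self (fun y => g (ε⁻¹ • y)) volume x,
    Measure.integral_comp_smul]
  simp only [finrank_euclideanSpace, Fintype.card_fin, smul_eq_mul, inv_pow, inv_inv]
  rw [abs_of_pos (by positivity), ← mul_assoc, inv_mul_cancel₀ (by positivity), one_mul]

theorem IsMollifier.integral_scaled (hφ : IsMollifier φ) {ε : ℝ} (hε : 0 < ε) (x : RSpace d) :
    ∫ y, scaledMollifier φ ε (x - y) = 1 := by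
  rw [← hφ.integral_eq_one]
  exact integral_scaledMollifier φ hε x

theorem integral_abs_scaledMollifier {ε : ℝ} (hε : 0 < ε) (x : RSpace d) :
    ∫ y, |scaledMollifier φ ε (x - y)| = ∫ y, |φ y| := by
  rw [← integral_scaledMollifier (fun y => |φ y|) hε x]
  congr 1
  funext y
  rw [scaledMollifier, abs_mul, abs_of_pos (by positivity)]

theorem abs_scaledMollifier_le {M : ℝ} (hM : ∀ y, |φ y| ≤ M) {ε : ℝ} (hε : 0 < ε) (y : RSpace d) :
    |scaledMollifier φ ε y| ≤ (ε ^ d)⁻¹ * M := by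
  rw [scaledMollifier, abs_mul, abs_of_pos (by positivity)]
  gcongr
  exact hM _

theorem IsMollifier.norm_le_of_scaled_ne_zero (hφ : IsMollifier φ) {ε : ℝ} (hε : 0 < ε)
    {y : RSpace d} (h : scaledMollifier φ ε y ≠ 0) : ‖y‖ ≤ ε := by
  have h1 : φ (ε⁻¹ • y) ≠ 0 := right_ne_zero_of_mul h
  have h2 := hφ.support (subset_tsupport φ h1)
  rw [mem_closedBall_zero_iff, norm_smul, norm_inv, Real.norm_of_nonneg hε.le] at h2
  rwa [inv_mul_le_iff₀ hε, mul_one] at h2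

/-- The layer `A` of the kernel of the field mollified at scale `ε`, at the point `x`. -/
noncomputable def mollifiedLayer (hK : IsSeedCovariance K) (α : ℝ≥0∞) (a : ℝ) (φ : RSpace d → ℝ)
    (A : Set ℝ) (ε : ℝ) (x : RSpace d) : Lp ℝ 2 (spaceTime d) :=
  layer hK α a A fun y => scaledMollifier φ ε (x - y)

variable (hd : 0 < d) (hK : IsSeedCovariance K) {α : ℝ≥0∞} {a : ℝ} (ha : a ∈ Set.Icc (0 : ℝ) 1)
  (hφ : IsMollifier φ)

include hd hK ha hφ

theorem inner_mollifiedLayer {A B : Set ℝ} (hA : MeasurableSet A) (hB : MeasurableSet B)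
    {ε ε' : ℝ} (hε : 0 < ε) (hε' : 0 < ε') (x y : RSpace d) :
    inner ℝ (mollifiedLayer hK α a φ A ε x) (mollifiedLayer hK α a φ B ε' y) =
      ∫ u in Set.Ioi 0 ∩ (A ∩ B), scaleRate α a u *
        scaleCov K (fun z => scaledMollifier φ ε (x - z))
          (fun z => scaledMollifier φ ε' (y - z)) u :=
  inner_layer hd hK ha hA hB (hφ.isTestFunction_scaled hε x) (hφ.isTestFunction_scaled hε' y)

/-- Stationarity of the field; it makes variances independent of the point, so that the Wick
renormalisation is constant in `x`. -/
theorem inner_mollifiedLayer_translate {A B : Set ℝ} (hA : MeasurableSet A) (hB : MeasurableSet B)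
    {ε ε' : ℝ} (hε : 0 < ε) (hε' : 0 < ε') (x : RSpace d) :
    inner ℝ (mollifiedLayer hK α a φ A ε x) (mollifiedLayer hK α a φ B ε' x) =
      inner ℝ (mollifiedLayer hK α a φ A ε 0) (mollifiedLayer hK α a φ B ε' 0) := by
  rw [inner_mollifiedLayer hd hK ha hφ hA hB hε hε', inner_mollifiedLayer hd hK ha hφ hA hB hε hε']
  simp_rw [scaleCov_comp_sub (scaledMollifier φ ε) (scaledMollifier φ ε')]

theorem norm_mollifiedLayer {A : Set ℝ} (hA : MeasurableSet A) {ε : ℝ} (hε : 0 < ε)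
    (x : RSpace d) : ‖mollifiedLayer hK α a φ A ε x‖ = ‖mollifiedLayer hK α a φ A ε 0‖ := by
  rw [← sq_eq_sq₀ (norm_nonneg _) (norm_nonneg _), ← real_inner_self_eq_norm_sq,
    ← real_inner_self_eq_norm_sq, inner_mollifiedLayer_translate hd hK ha hφ hA hA hε hε]

/-- Both products integrate over the scales of `A` alone, as `A ∩ B = A`. For Gaussian variables
this orthogonality is independence of the added scales from the whole coarse field. -/
theorem inner_mollifiedLayer_sub_left {A B : Set ℝ} (hA : MeasurableSet A) (hB : MeasurableSet B)
    (hAB : A ⊆ B) {ε : ℝ} (hε : 0 < ε) (x y : RSpace d) :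
    inner ℝ (mollifiedLayer hK α a φ B ε x - mollifiedLayer hK α a φ A ε x)
      (mollifiedLayer hK α a φ A ε y) = 0 := by
  rw [inner_sub_left, inner_mollifiedLayer hd hK ha hφ hB hA hε hε,
    inner_mollifiedLayer hd hK ha hφ hA hA hε hε, Set.inter_eq_self_of_subset_right hAB,
    Set.inter_self, sub_self]

/-- Only scales finer than `e^{-T}` remain; mollification moves each point by at most `ε`, so the
supports are still farther apart than the range of the kernel. -/
theorem inner_mollifiedLayer_sub_sub {A B : Set ℝ} (hA : MeasurableSet A) (hB : MeasurableSet B)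
    (hAB : A ⊆ B) {T : ℝ} (hT : B \ A ⊆ Set.Ici T) {ε : ℝ} (hε : 0 < ε) {x y : RSpace d}
    (hxy : Real.exp (-T) + 2 * ε < ‖x - y‖) :
    inner ℝ (mollifiedLayer hK α a φ B ε x - mollifiedLayer hK α a φ A ε x)
      (mollifiedLayer hK α a φ B ε y - mollifiedLayer hK α a φ A ε y) = 0 := by
  rw [inner_sub_right, inner_mollifiedLayer_sub_left hd hK ha hφ hA hB hAB hε, sub_zero,
    inner_sub_left, inner_mollifiedLayer hd hK ha hφ hB hB hε hε,
    inner_mollifiedLayer hd hK ha hφ hA hB hε hε, Set.inter_self,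
    Set.inter_eq_self_of_subset_left hAB, ← setIntegral_sdiff (measurableSet_Ioi.inter hA)
      ((integrableOn_scaleRate_mul_scaleCov hd hK ha (hφ.isTestFunction_scaled hε x)
        (hφ.isTestFunction_scaled hε y)).mono_set Set.inter_subset_left)
      (Set.inter_subset_inter_right _ hAB)]
  refine setIntegral_eq_zero_of_forall_eq_zero fun u hu => ?_
  have hu' : T ≤ u := hT ⟨hu.1.2, fun h => hu.2 ⟨hu.1.1, h⟩⟩
  rw [hK.scaleCov_eq_zero, mul_zero]
  intro s t hs ht
  have h1 := hφ.norm_le_of_scaled_ne_zero hε hs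
  have h2 := hφ.norm_le_of_scaled_ne_zero hε ht
  have h3 : ‖x - y‖ ≤ ‖x - s‖ + ‖s - t‖ + ‖y - t‖ := by
    have e : x - y = (x - s) + (s - t) - (y - t) := by abel
    rw [e]
    exact (norm_sub_le _ _).trans (by gcongr; exact norm_add_le _ _)
  have h4 : Real.exp (-u) ≤ Real.exp (-T) := Real.exp_le_exp.2 (by linarith)
  linarith

/-- The mollifier is of size `ε^{-d}` and the scale `u` has mass `e^{-du}`. Hence the scales at or
below the mollification scale carry bounded variance. -/
theorem norm_sq_mollifiedLayer_Ici_le {M : ℝ} (hM : ∀ y, |φ y| ≤ M) {T : ℝ} (hT : 0 ≤ T) {ε : ℝ}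
    (hε : 0 < ε) (x : RSpace d) :
    ∫ u in Set.Ioi 0 ∩ Set.Ici T, scaleRate α a u *
        scaleCov K (fun z => scaledMollifier φ ε (x - z))
          (fun z => scaledMollifier φ ε (x - z)) u ≤
      ((ε * Real.exp T) ^ d)⁻¹ * ((∫ w, K w) * M * (∫ y, |φ y|) / d) := by
  have ht := hφ.isTestFunction_scaled hε x
  refine (le_abs_self _).trans ((abs_setIntegral_scaleCov_le hd hK ha ht ht
    (fun y => abs_scaledMollifier_le hM hε (x - y)) measurableSet_Ici hT subset_rfl).trans_eq ?_)
  rw [integral_abs_scaledMollifier hε, mul_pow, mul_inv, Real.exp_neg, Real.exp_nat_mul]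
  ring

/-- The errors `L e^u (ε + ε')` at the individual scales sum geometrically, so the total is governed
by the finest scale `T` and not by the number of scales. -/
theorem abs_inner_mollifiedLayer_Iio_sub_le {L : ℝ} (hL0 : 0 ≤ L)
    (hL : ∀ v, |K v - 1| ≤ L * ‖v‖) (T : ℝ) {ε ε' : ℝ} (hε : 0 < ε) (hε' : 0 < ε')
    (x : RSpace d) :
    |inner ℝ (mollifiedLayer hK α a φ (Set.Iio T) ε x) (mollifiedLayer hK α a φ (Set.Iio T) ε' x) -
      ∫ u in Set.Ioi 0 ∩ Set.Iio T, scaleRate α a u| ≤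
      L * (∫ y, |φ y|) ^ 2 * ((ε + ε') * Real.exp T) := by
  rw [inner_mollifiedLayer hd hK ha hφ measurableSet_Iio measurableSet_Iio hε hε', Set.inter_self]
  refine (abs_setIntegral_scaleCov_sub_le hd hK hL0 hL ha (hφ.isTestFunction_scaled hε x)
    (hφ.isTestFunction_scaled hε' x) (hφ.integral_scaled hε x) (hφ.integral_scaled hε' x)
    (D := ε + ε') (by positivity) ?_ T).trans_eq ?_
  · intro s t hs ht
    have h1 := hφ.norm_le_of_scaled_ne_zero hε hs
    have h2 := hφ.norm_le_of_scaled_ne_zero hε' ht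
    have e : s - t = (x - t) - (x - s) := by abel
    rw [e]
    exact (norm_sub_le _ _).trans (by linarith)
  · rw [integral_abs_scaledMollifier hε, integral_abs_scaledMollifier hε']
    ring

omit hd hK hφ in
theorem setIntegral_scaleRate_le {T : ℝ} (hT : 0 ≤ T) :
    ∫ u in Set.Ioi 0 ∩ Set.Iio T, scaleRate α a u ≤ T := by
  rw [Set.Ioi_inter_Iio]
  calc _ ≤ ∫ u in Set.Ioo 0 T, (1 : ℝ) := by
        refine integral_mono_of_nonneg ?_ (integrableOn_const (by simp)) ?_
        · filter_upwards [ae_restrict_mem measurableSet_Ioo] with u hu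
          exact (scaleRate_mem (α := α) ha hu.1).1
        · filter_upwards [ae_restrict_mem measurableSet_Ioo] with u hu
          exact (scaleRate_mem (α := α) ha hu.1).2
    _ = T := by simp [hT]

/-- The variance of the coarse layers of the mollified field grows like the number of layers. -/
theorem exists_norm_sq_mollifiedLayer_le :
    ∃ C : ℝ, 0 ≤ C ∧ ∀ ε : ℝ, 0 < ε → ∀ T : ℝ, 0 ≤ T → ∀ x : RSpace d,
      (ε * Real.exp T ≤ 1 → ‖mollifiedLayer hK α a φ (Set.Iio T) ε x‖ ^ 2 ≤ T + C) ∧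
      ((ε * Real.exp T ≤ 1 ∨ T = 0) → 1 / 2 ≤ ε * Real.exp T →
        ‖mollifiedLayer hK α a φ Set.univ ε x‖ ^ 2 ≤ T + C) := by
  obtain ⟨L, hL0, hL⟩ := hK.exists_lipschitz_zero
  obtain ⟨M, hM⟩ := hφ.isTestFunction.exists_bound
  have hM0 : 0 ≤ M := (abs_nonneg _).trans (hM 0)
  set c₁ := L * (∫ y, |φ y|) ^ 2 * 2 with hc₁
  set c₂ := (∫ w, K w) * M * (∫ y, |φ y|) / d with hc₂
  have hc₁0 : 0 ≤ c₁ := by positivity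
  have hc₂0 : 0 ≤ c₂ := div_nonneg (mul_nonneg (mul_nonneg (integral_nonneg hK.nonneg) hM0)
    (integral_nonneg fun y => abs_nonneg _)) (by positivity)
  have key : ∀ ε : ℝ, 0 < ε → ∀ T : ℝ, 0 ≤ T → ∀ x : RSpace d, ε * Real.exp T ≤ 1 →
      ‖mollifiedLayer hK α a φ (Set.Iio T) ε x‖ ^ 2 ≤ T + c₁ := by
    intro ε hε T hT x h
    have h1 := abs_inner_mollifiedLayer_Iio_sub_le hd hK (α := α) ha hφ hL0 hL T hε hε x
    rw [real_inner_self_eq_norm_sq] at h1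
    have h2 := (abs_le.1 h1).2
    have h3 := setIntegral_scaleRate_le (α := α) ha hT
    have h4 : L * (∫ y, |φ y|) ^ 2 * ((ε + ε) * Real.exp T) ≤ c₁ := by
      rw [hc₁]
      gcongr
      linarith
    linarith
  refine ⟨c₁ + 2 ^ d * c₂, by positivity, fun ε hε T hT x => ⟨fun h => ?_, fun h h' => ?_⟩⟩
  · have : 0 ≤ 2 ^ d * c₂ := by positivity
    linarith [key ε hε T hT x h]
  · have ht := hφ.isTestFunction_scaled hε x
    -- The factor `2^d` comes from `ε e^T ≥ 1/2`.
    have h2 : ((ε * Real.exp T) ^ d)⁻¹ * c₂ ≤ 2 ^ d * c₂ := by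
      gcongr
      rw [← inv_pow]
      gcongr
      rw [inv_le_comm₀ (by positivity) (by norm_num)]
      linarith
    have h3 := norm_sq_mollifiedLayer_Ici_le hd hK (α := α) ha hφ hM hT hε x
    have hi := integrableOn_scaleRate_mul_scaleCov hd hK (α := α) ha ht ht
    rw [← real_inner_self_eq_norm_sq, inner_mollifiedLayer hd hK ha hφ MeasurableSet.univ
      MeasurableSet.univ hε hε, Set.inter_univ]
    have hsplit : (Set.Ioi 0 ∩ Set.univ : Set ℝ) =
        (Set.Ioi 0 ∩ Set.Iio T) ∪ (Set.Ioi 0 ∩ Set.Ici T) := by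
      rw [← Set.inter_union_distrib_left, Set.Iio_union_Ici]
    rw [hsplit, setIntegral_union (Set.disjoint_left.2 fun u hu hu' => by
        have h1 : u < T := hu.2
        have h2 : T ≤ u := hu'.2
        linarith)
      (measurableSet_Ioi.inter measurableSet_Ici) (hi.mono_set Set.inter_subset_left)
      (hi.mono_set Set.inter_subset_left)]
    have h1 : ∫ u in Set.Ioi 0 ∩ Set.Iio T, scaleRate α a u *
        scaleCov K (fun z => scaledMollifier φ ε (x - z))
          (fun z => scaledMollifier φ ε (x - z)) u ≤ T + c₁ := by
      rcases h with h | h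
      · have := key ε hε T hT x h
        rwa [← real_inner_self_eq_norm_sq, inner_mollifiedLayer hd hK ha hφ measurableSet_Iio
          measurableSet_Iio hε hε, Set.inter_self] at this
      -- At `T = 0` there are no coarse scales; this case serves mollification parameters above `1`.
      · subst h
        rw [Set.Ioi_inter_Iio]
        simpa using hc₁0
    linarith

/-- The squared distance of two layers is a sum of two covariances against the difference of
translated mollifiers, each linear in its supremum, which is small by uniform continuity. This
continuity makes the Bochner integrals over space legitimate. -/
theorem continuous_mollifiedLayer {A : Set ℝ} (hA : MeasurableSet A) {ε : ℝ} (hε : 0 < ε) :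
    Continuous (mollifiedLayer hK α a φ A ε) := by
  have ht := hφ.isTestFunction_scaled hε
  set c := (∫ w, K w) * (∫ y, |φ y|) / d with hc
  have key : ∀ {M : ℝ} {x y : RSpace d},
      (∀ z, |scaledMollifier φ ε (x - z) - scaledMollifier φ ε (y - z)| ≤ M) →
      |inner ℝ (mollifiedLayer hK α a φ A ε x) (mollifiedLayer hK α a φ A ε x) -
        inner ℝ (mollifiedLayer hK α a φ A ε x) (mollifiedLayer hK α a φ A ε y)| ≤ c * M := by
    intro M x y hM
    have hδ : IsTestFunction fun z => scaledMollifier φ ε (x - z) - scaledMollifier φ ε (y - z) :=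
      ⟨(ht x).continuous.sub (ht y).continuous,
        (ht x).hasCompactSupport.sub (ht y).hasCompactSupport⟩
    rw [inner_mollifiedLayer hd hK ha hφ hA hA hε hε, inner_mollifiedLayer hd hK ha hφ hA hA hε hε,
      ← integral_sub ((integrableOn_scaleRate_mul_scaleCov hd hK ha (ht x) (ht x)).mono_set
        Set.inter_subset_left) ((integrableOn_scaleRate_mul_scaleCov hd hK ha (ht x)
        (ht y)).mono_set Set.inter_subset_left)]
    have e : ∀ u, scaleRate α a u * scaleCov K (fun z => scaledMollifier φ ε (x - z))
          (fun z => scaledMollifier φ ε (x - z)) u -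
        scaleRate α a u * scaleCov K (fun z => scaledMollifier φ ε (x - z))
          (fun z => scaledMollifier φ ε (y - z)) u =
        scaleRate α a u * scaleCov K (fun z => scaledMollifier φ ε (x - z))
          (fun z => scaledMollifier φ ε (x - z) - scaledMollifier φ ε (y - z)) u := by
      intro u
      rw [hK.scaleCov_sub_right (ht x).integrable (ht x).integrable (ht y).integrable]
      ring
    simp_rw [e]
    have h := abs_setIntegral_scaleCov_le hd hK (α := α) ha (ht x) hδ hM
      ((measurableSet_Ioi (a := (0 : ℝ))).inter (hA.inter hA)) le_rfl
      (Set.inter_subset_left.trans Set.Ioi_subset_Ici_self)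
    rw [← Set.inter_assoc, Set.inter_self] at h
    refine h.trans_eq ?_
    rw [integral_abs_scaledMollifier hε]
    simp only [mul_zero, neg_zero, Real.exp_zero]
    rw [hc]
    ring
  have hu : UniformContinuous (scaledMollifier φ ε) := by
    have := ht 0
    have h1 : (fun y => scaledMollifier φ ε y) = fun y => (fun z => scaledMollifier φ ε (0 - z)) (-y) := by
      funext y
      simp
    have hcont : Continuous (scaledMollifier φ ε) := by
      have hc := hφ.smooth.continuous
      unfold scaledMollifier
      fun_prop
    refine hcont.uniformContinuous_of_tendsto_cocompact (x := 0) ?_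
    refine HasCompactSupport.is_zero_at_infty ?_
    change HasCompactSupport fun y => scaledMollifier φ ε y
    rw [h1]
    exact this.hasCompactSupport.comp_homeomorph (Homeomorph.neg _)
  have hc0 : 0 ≤ c := div_nonneg (mul_nonneg (integral_nonneg hK.nonneg)
    (integral_nonneg fun y => abs_nonneg _)) (by positivity)
  rw [Metric.continuous_iff]
  intro x r hr
  -- Two covariance differences, each at most `c` times this bound and hence at most `r²/4`, add up
  -- to less than `r²`.
  obtain ⟨δ, hδ, h⟩ := Metric.uniformContinuous_iff.1 hu (r ^ 2 / (4 * (c + 1))) (by positivity)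
  refine ⟨δ, hδ, fun y hy => ?_⟩
  have hM : ∀ z, |scaledMollifier φ ε (y - z) - scaledMollifier φ ε (x - z)| ≤
      r ^ 2 / (4 * (c + 1)) := by
    intro z
    rw [← Real.dist_eq]
    exact (h (by simpa using hy)).le
  have k1 := (abs_le.1 (key hM)).2
  have k2 := (abs_le.1 (key (x := x) (y := y) (fun z => by rw [abs_sub_comm]; exact hM z))).2
  have hlt : 2 * (c * (r ^ 2 / (4 * (c + 1)))) < r ^ 2 := by
    have : c * (r ^ 2 / (4 * (c + 1))) ≤ r ^ 2 / 4 := by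
      rw [mul_div_assoc', div_le_div_iff₀ (by positivity) (by positivity)]
      nlinarith [sq_nonneg r]
    nlinarith [sq_pos_of_pos hr]
  rw [dist_eq_norm]
  refine lt_of_pow_lt_pow_left₀ 2 hr.le ?_
  rw [norm_sub_sq_real, ← real_inner_self_eq_norm_sq, ← real_inner_self_eq_norm_sq]
  rw [real_inner_comm (mollifiedLayer hK α a φ A ε y)] at k2
  linarith

end Mollified

/-! ### Complex Wick exponentials of an isonormal Gaussian process. -/

section Isonormal

variable {Ω : Type*} [MeasurableSpace Ω] {H : Type*} [NormedAddCommGroup H] [InnerProductSpace ℝ H]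

/-- A centred Gaussian process of measurable variables, indexed by an inner product space, whose
covariance is the inner product. -/
structure IsIsonormal (P : Measure Ω) (W : H → Ω → ℝ) : Prop where
  gaussian : IsGaussianProcess W P
  measurable : ∀ h, Measurable (W h)
  centred : ∀ h, ∫ ω, W h ω ∂P = 0
  covariance : ∀ h g, ∫ ω, W h ω * W g ω ∂P = inner ℝ h g

/-- The Wick exponential `e^{b W(h) - b² ‖h‖² / 2}` with complex parameter `b`. -/
noncomputable def wickExp (W : H → Ω → ℝ) (b : ℂ) (h : H) (ω : Ω) : ℂ :=
  Complex.exp (b * W h ω - b ^ 2 / 2 * (‖h‖ : ℂ) ^ 2)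

/-- The σ-algebra generated by the variables `W v`, `v ∈ V`. -/
abbrev generatedBy (W : H → Ω → ℝ) (V : Set H) : MeasurableSpace Ω :=
  MeasurableSpace.comap (fun ω (v : V) => W v ω) MeasurableSpace.pi

namespace IsIsonormal

variable {P : Measure Ω} {W : H → Ω → ℝ} (hW : IsIsonormal P W)

include hW

theorem isProbabilityMeasure : IsProbabilityMeasure P := hW.gaussian.isProbabilityMeasure

theorem memLp_two (h : H) : MemLp (W h) 2 P := (hW.gaussian.hasGaussianLaw_eval h).memLp_two

theorem variance_eq (h : H) : Var[W h; P] = ‖h‖ ^ 2 := by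
  rw [variance_of_integral_eq_zero (hW.measurable h).aemeasurable (hW.centred h),
    ← real_inner_self_eq_norm_sq, ← hW.covariance h h]
  simp_rw [sq]

theorem map_eq (h : H) : P.map (W h) = gaussianReal 0 (‖h‖₊ ^ 2) := by
  rw [(hW.gaussian.hasGaussianLaw_eval h).map_eq_gaussianReal, hW.centred, hW.variance_eq]
  congr 1
  rw [← Real.toNNReal_coe (r := ‖h‖₊ ^ 2)]
  simp

theorem integral_cexp (h : H) (z : ℂ) :
    ∫ ω, Complex.exp (z * W h ω) ∂P = Complex.exp (z ^ 2 / 2 * (‖h‖ : ℂ) ^ 2) := by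
  have := complexMGF_gaussianReal (hW.map_eq h) z
  rw [complexMGF] at this
  rw [this]
  congr 1
  simp
  ring

theorem integrable_exp (h : H) (t : ℝ) : Integrable (fun ω => Real.exp (t * W h ω)) P := by
  have h1 := integrable_exp_mul_gaussianReal (μ := 0) (v := ‖h‖₊ ^ 2) t
  rw [← hW.map_eq h] at h1
  exact h1.comp_measurable (hW.measurable h)

theorem integrable_cexp (h : H) (z : ℂ) : Integrable (fun ω => Complex.exp (z * W h ω)) P := by
  have hm := hW.measurable h
  refine (hW.integrable_exp h z.re).mono' (by fun_prop) (Eventually.of_forall fun ω => ?_)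
  rw [Complex.norm_exp]
  simp

theorem integral_exp (h : H) (t : ℝ) :
    ∫ ω, Real.exp (t * W h ω) ∂P = Real.exp (t ^ 2 / 2 * ‖h‖ ^ 2) := by
  have h1 := hW.integral_cexp h t
  have h2 : ∫ ω, Complex.exp (t * W h ω) ∂P = ((∫ ω, Real.exp (t * W h ω) ∂P : ℝ) : ℂ) := by
    rw [← integral_complex_ofReal]
    congr 1
    funext ω
    push_cast
    rfl
  rw [h2] at h1
  apply Complex.ofReal_injective
  rw [h1]
  push_cast
  rfl

/-- Linearity is not assumed of the process: it follows, up to null sets, because the second moment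
of the defect expands into inner products that cancel. -/
theorem ae_eq_add {h g k : H} (hk : k = h + g) : ∀ᵐ ω ∂P, W k ω = W h ω + W g ω := by
  have i : ∀ x y, Integrable (fun ω => W x ω * W y ω) P := fun x y =>
    (hW.memLp_two x).integrable_mul (hW.memLp_two y)
  have e : ∀ ω, (W k ω - (W h ω + W g ω)) ^ 2 = W k ω * W k ω + W h ω * W h ω + W g ω * W g ω
      - 2 * (W k ω * W h ω) - 2 * (W k ω * W g ω) + 2 * (W h ω * W g ω) := fun ω => by ring
  have hz : ∫ ω, (W k ω - (W h ω + W g ω)) ^ 2 ∂P = 0 := by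
    simp_rw [e]
    rw [integral_add (by fun_prop) (by fun_prop), integral_sub (by fun_prop) (by fun_prop),
      integral_sub (by fun_prop) (by fun_prop), integral_add (by fun_prop) (by fun_prop),
      integral_add (by fun_prop) (by fun_prop)]
    simp_rw [integral_const_mul, hW.covariance]
    subst hk
    simp only [inner_add_left, inner_add_right, real_inner_comm g h]
    ring
  have hz := (integral_eq_zero_iff_of_nonneg (f := fun ω => (W k ω - (W h ω + W g ω)) ^ 2)
    (fun ω => sq_nonneg _)
    (((hW.memLp_two k).sub ((hW.memLp_two h).add (hW.memLp_two g))).integrable_sq)).1 hz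
  filter_upwards [hz] with ω hω
  have : (W k ω - (W h ω + W g ω)) ^ 2 = 0 := hω
  have := pow_eq_zero_iff (two_ne_zero) |>.1 this
  linarith

theorem ae_eq_smul {h k : H} {c : ℝ} (hk : k = c • h) : ∀ᵐ ω ∂P, W k ω = c * W h ω := by
  have i : ∀ x y, Integrable (fun ω => W x ω * W y ω) P := fun x y =>
    (hW.memLp_two x).integrable_mul (hW.memLp_two y)
  have e : ∀ ω, (W k ω - c * W h ω) ^ 2 = W k ω * W k ω - 2 * c * (W k ω * W h ω) +
      c ^ 2 * (W h ω * W h ω) := fun ω => by ring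
  have hz : ∫ ω, (W k ω - c * W h ω) ^ 2 ∂P = 0 := by
    simp_rw [e]
    rw [integral_add (by fun_prop) (by fun_prop), integral_sub (by fun_prop) (by fun_prop)]
    simp_rw [integral_const_mul, hW.covariance]
    subst hk
    simp only [inner_smul_left, inner_smul_right]
    simp
    ring
  have hz := (integral_eq_zero_iff_of_nonneg (f := fun ω => (W k ω - c * W h ω) ^ 2)
    (fun ω => sq_nonneg _)
    (((hW.memLp_two k).sub ((hW.memLp_two h).const_mul c)).integrable_sq)).1 hz
  filter_upwards [hz] with ω hω
  have : (W k ω - c * W h ω) ^ 2 = 0 := hω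
  have := pow_eq_zero_iff (two_ne_zero) |>.1 this
  linarith

/-- Orthogonality implies independence. -/
theorem indep_generatedBy {V : Set H} {k : H} (hk : ∀ v ∈ V, inner ℝ v k = 0) :
    IndepFun (fun ω (v : V) => W v ω) (W k) P := by
  have hg : IsGaussianProcess (Sum.elim (fun v : V => W v) (fun _ : Unit => W k)) P := by
    have h := hW.gaussian.comp_right (Sum.elim (fun v : V => (v : H)) (fun _ : Unit => k))
    have e : Sum.elim (fun v : V => W v) (fun _ : Unit => W k) =
        W ∘ Sum.elim (fun v : V => (v : H)) (fun _ : Unit => k) := by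
      funext s
      cases s <;> rfl
    rw [e]
    exact h
  have := hg.indepFun_of_covariance_eq_zero (fun v => (hW.measurable v).aemeasurable)
    (fun _ => (hW.measurable k).aemeasurable) (fun v _ => by
      have := hW.isProbabilityMeasure
      rw [covariance_eq_sub (hW.memLp_two v) (hW.memLp_two k), hW.centred]
      simp only [Pi.mul_apply, zero_mul, sub_zero]
      rw [hW.covariance, hk v v.2])
  exact this.comp (φ := id) (ψ := fun f : Unit → ℝ => f ()) measurable_id (measurable_pi_apply ())

theorem generatedBy_le (V : Set H) : generatedBy W V ≤ ‹MeasurableSpace Ω› :=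
  (measurable_pi_lambda _ fun v : V => hW.measurable v).comap_le

omit hW [MeasurableSpace Ω] [NormedAddCommGroup H] [InnerProductSpace ℝ H] in
theorem _root_.measurable_generatedBy {V : Set H} {v : H} (hv : v ∈ V) :
    Measurable[generatedBy W V] (W v) := by
  have h : Measurable[generatedBy W V] (fun ω (v : V) => W v ω) := comap_measurable _
  exact (measurable_pi_apply (⟨v, hv⟩ : V)).comp h

theorem measurable_wickExp (b : ℂ) (h : H) : Measurable (wickExp W b h) := by
  have := hW.measurable h
  unfold wickExp
  fun_prop

omit hW [MeasurableSpace Ω] [InnerProductSpace ℝ H] in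
theorem _root_.norm_wickExp (b : ℂ) (h : H) (ω : Ω) :
    ‖wickExp W b h ω‖ = Real.exp (b.re * W h ω - (b.re ^ 2 - b.im ^ 2) / 2 * ‖h‖ ^ 2) := by
  rw [wickExp, Complex.norm_exp]
  congr 1
  rw [Complex.sub_re, Complex.re_mul_ofReal, ← Complex.ofReal_pow, Complex.re_mul_ofReal]
  have : (b ^ 2 / 2).re = (b.re ^ 2 - b.im ^ 2) / 2 := by
    rw [sq]
    simp
    ring
  rw [this]

omit hW [MeasurableSpace Ω] [InnerProductSpace ℝ H] in
theorem _root_.norm_wickExp_rpow (b : ℂ) (h : H) (p : ℝ) (ω : Ω) :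
    ‖wickExp W b h ω‖ ^ p = Real.exp (-(p * (b.re ^ 2 - b.im ^ 2) / 2 * ‖h‖ ^ 2)) *
      Real.exp (p * b.re * W h ω) := by
  rw [norm_wickExp, ← Real.exp_mul, ← Real.exp_add]
  congr 1
  ring

theorem integrable_norm_wickExp_rpow (b : ℂ) (h : H) (p : ℝ) :
    Integrable (fun ω => ‖wickExp W b h ω‖ ^ p) P := by
  simp_rw [norm_wickExp_rpow]
  exact (hW.integrable_exp h (p * b.re)).const_mul _

/-- The imaginary part of `b` only rotates the phase of `e^{bW}` but enters the renormalisation with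
the opposite sign, so it costs `b.im²` at every `p`; the real part costs only `(p-1) b.re²`. -/
theorem integral_norm_wickExp_rpow (b : ℂ) (h : H) (p : ℝ) :
    ∫ ω, ‖wickExp W b h ω‖ ^ p ∂P =
      Real.exp (p * ((p - 1) * b.re ^ 2 + b.im ^ 2) / 2 * ‖h‖ ^ 2) := by
  simp_rw [norm_wickExp_rpow]
  rw [integral_const_mul, hW.integral_exp, ← Real.exp_add]
  congr 1
  ring

theorem memLp_wickExp (b : ℂ) (h : H) : MemLp (wickExp W b h) 2 P := by
  rw [memLp_two_iff_integrable_sq_norm (hW.measurable_wickExp b h).aestronglyMeasurable]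
  have := hW.integrable_norm_wickExp_rpow b h 2
  exact_mod_cast this

theorem integral_wickExp (b : ℂ) (h : H) : ∫ ω, wickExp W b h ω ∂P = 1 := by
  unfold wickExp
  simp_rw [Complex.exp_sub]
  rw [integral_div, hW.integral_cexp, div_self (Complex.exp_ne_zero _)]

theorem wickExp_add_ae {h g k : H} (hk : k = h + g) (hhg : inner ℝ h g = 0) (b : ℂ) :
    ∀ᵐ ω ∂P, wickExp W b k ω = wickExp W b h ω * wickExp W b g ω := by
  filter_upwards [hW.ae_eq_add hk] with ω hω
  have : ‖k‖ ^ 2 = ‖h‖ ^ 2 + ‖g‖ ^ 2 := by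
    rw [hk, norm_add_sq_real, hhg]
    ring
  have hC : (‖k‖ : ℂ) ^ 2 = (‖h‖ : ℂ) ^ 2 + (‖g‖ : ℂ) ^ 2 := by exact_mod_cast this
  rw [wickExp, wickExp, wickExp, ← Complex.exp_add, hω, hC]
  congr 1
  push_cast
  ring

/-- Products of Wick exponentials. -/
theorem integral_conj_wickExp_mul (b b' : ℂ) (h g : H) :
    ∫ ω, wickExp W b' g ω * (starRingEnd ℂ) (wickExp W b h ω) ∂P =
      Complex.exp ((starRingEnd ℂ) b * b' * (inner ℝ h g : ℝ)) := by
  -- One Gram–Schmidt step, so that the expectation splits over the independent variables `W h` and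
  -- `W k`; when `h = 0`, take `c = 0`.
  obtain ⟨c, k, hg, hk, hc⟩ : ∃ (c : ℝ) (k : H), g = c • h + k ∧ inner ℝ h k = 0 ∧
      c * ‖h‖ ^ 2 = inner ℝ h g := by
    by_cases h0 : h = 0
    · exact ⟨0, g, by simp, by simp [h0], by simp [h0]⟩
    · refine ⟨inner ℝ h g / ‖h‖ ^ 2, g - (inner ℝ h g / ‖h‖ ^ 2) • h, by simp, ?_, ?_⟩
      · rw [inner_sub_right, inner_smul_right, real_inner_self_eq_norm_sq]
        have : ‖h‖ ≠ 0 := norm_ne_zero_iff.2 h0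
        field_simp
        ring
      · have : ‖h‖ ≠ 0 := norm_ne_zero_iff.2 h0
        field_simp
  have hae : ∀ᵐ ω ∂P, wickExp W b' g ω * (starRingEnd ℂ) (wickExp W b h ω) =
      Complex.exp (-(b' ^ 2 / 2 * (‖g‖ : ℂ) ^ 2 + (starRingEnd ℂ) b ^ 2 / 2 * (‖h‖ : ℂ) ^ 2)) *
      (Complex.exp ((b' * c + (starRingEnd ℂ) b) * W h ω) * Complex.exp (b' * W k ω)) := by
    filter_upwards [hW.ae_eq_add hg, hW.ae_eq_smul (h := h) (k := c • h) rfl] with ω h1 h2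
    rw [wickExp, wickExp, ← Complex.exp_conj, ← Complex.exp_add, ← Complex.exp_add,
      ← Complex.exp_add]
    congr 1
    rw [h1, h2]
    simp only [map_sub, map_mul, map_div₀, map_pow, Complex.conj_ofReal, map_ofNat]
    push_cast
    ring
  have hind : IndepFun (fun ω => Complex.exp ((b' * c + (starRingEnd ℂ) b) * W h ω))
      (fun ω => Complex.exp (b' * W k ω)) P := by
    have h1 := hW.indep_generatedBy (V := {h}) (k := k) (by simpa using hk)
    refine h1.comp (φ := fun f : ({h} : Set H) → ℝ =>
        Complex.exp ((b' * c + (starRingEnd ℂ) b) * f ⟨h, rfl⟩))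
      (ψ := fun x : ℝ => Complex.exp (b' * x)) (by fun_prop) (by fun_prop)
  rw [integral_congr_ae hae, integral_const_mul, hind.integral_fun_mul_eq_mul_integral
    (hW.integrable_cexp _ _).aestronglyMeasurable (hW.integrable_cexp _ _).aestronglyMeasurable,
    hW.integral_cexp, hW.integral_cexp, ← Complex.exp_add, ← Complex.exp_add]
  congr 1
  have hn : ‖g‖ ^ 2 = c ^ 2 * ‖h‖ ^ 2 + ‖k‖ ^ 2 := by
    rw [hg, norm_add_sq_real, inner_smul_left, hk, norm_smul, mul_pow, Real.norm_eq_abs, sq_abs]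
    simp
  have hnC : (‖g‖ : ℂ) ^ 2 = (c : ℂ) ^ 2 * (‖h‖ : ℂ) ^ 2 + (‖k‖ : ℂ) ^ 2 := by exact_mod_cast hn
  have hcC : ((inner ℝ h g : ℝ) : ℂ) = (c : ℂ) * (‖h‖ : ℂ) ^ 2 := by exact_mod_cast hc.symm
  rw [hnC, hcC]
  ring

/-- The increment of a Wick exponential in a direction orthogonal to `V` is orthogonal to what is
generated by `V`. -/
theorem integral_mul_wickExp_sub {V : Set H} {g g' : H} (hg : g ∈ V)
    (horth : ∀ v ∈ V, inner ℝ v (g' - g) = 0) (b : ℂ) {S : Ω → ℂ} (hS : MemLp S 2 P)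
    (hSm : AEStronglyMeasurable[generatedBy W V] S P) :
    ∫ ω, S ω * (wickExp W b g' ω - wickExp W b g ω) ∂P = 0 := by
  have := hW.isProbabilityMeasure
  -- The increment factors as `wickExp g * (wickExp (g' - g) - 1)`; the last factor is independent
  -- of `V` and has mean zero.
  have hadd := hW.wickExp_add_ae (h := g) (g := g' - g) (k := g') (by abel) (horth g hg) b
  have hle := hW.generatedBy_le V
  -- `S` is measurable for the smaller σ-algebra only up to null sets, so independence is applied to
  -- a genuinely measurable representative.
  set S' := hSm.mk S with hS'
  have hS'm : Measurable[generatedBy W V] S' := hSm.stronglyMeasurable_mk.measurable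
  have hX : Measurable[generatedBy W V] fun ω => S' ω * wickExp W b g ω := by
    refine Measurable.mul hS'm ?_
    have := measurable_generatedBy (W := W) hg
    unfold wickExp
    exact Complex.continuous_exp.measurable.comp
      (((Complex.continuous_ofReal.measurable.comp this).const_mul b).sub_const _)
  have hS2 : MemLp S' 2 P := hS.ae_eq hSm.ae_eq_mk
  have hXi : Integrable (fun ω => S' ω * wickExp W b g ω) P :=
    hS2.integrable_mul (hW.memLp_wickExp b g)
  have hE : Integrable (wickExp W b (g' - g)) P := (hW.memLp_wickExp b _).integrable (by norm_num)
  have hind : IndepFun (fun ω => S' ω * wickExp W b g ω) (fun ω => wickExp W b (g' - g) ω - 1) P := by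
    have h1 := hW.indep_generatedBy horth
    rw [IndepFun_iff_Indep] at h1 ⊢
    have hk : Measurable[MeasurableSpace.comap (W (g' - g)) inferInstance]
        fun ω => wickExp W b (g' - g) ω - 1 := by
      have : Measurable[MeasurableSpace.comap (W (g' - g)) inferInstance] (W (g' - g)) :=
        comap_measurable _
      unfold wickExp
      exact (Complex.continuous_exp.measurable.comp
        (((Complex.continuous_ofReal.measurable.comp this).const_mul b).sub_const _)).sub_const _
    exact indep_of_indep_of_le_left (indep_of_indep_of_le_right h1 hk.comap_le) hX.comap_le
  calc _ = ∫ ω, (S' ω * wickExp W b g ω) * (wickExp W b (g' - g) ω - 1) ∂P := by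
        refine integral_congr_ae ?_
        filter_upwards [hadd, hSm.ae_eq_mk] with ω h1 h2
        rw [h1, h2]
        ring
    _ = (∫ ω, S' ω * wickExp W b g ω ∂P) * ∫ ω, (wickExp W b (g' - g) ω - 1) ∂P :=
        hind.integral_fun_mul_eq_mul_integral hXi.aestronglyMeasurable
          (hE.sub (integrable_const 1)).aestronglyMeasurable
    _ = 0 := by
        rw [integral_sub hE (integrable_const 1), hW.integral_wickExp]
        simp

/-- Wick exponentials as elements of `L²`. -/
noncomputable def wickExpLp (b : ℂ) (h : H) : Lp ℂ 2 P := (hW.memLp_wickExp b h).toLp _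

theorem coeFn_wickExpLp (b : ℂ) (h : H) : hW.wickExpLp b h =ᵐ[P] wickExp W b h :=
  MemLp.coeFn_toLp _

theorem inner_wickExpLp (b b' : ℂ) (h g : H) :
    inner ℂ (hW.wickExpLp b h) (hW.wickExpLp b' g) =
      Complex.exp ((starRingEnd ℂ) b * b' * (inner ℝ h g : ℝ)) := by
  rw [L2.inner_def, ← hW.integral_conj_wickExp_mul]
  refine integral_congr_ae ?_
  filter_upwards [hW.coeFn_wickExpLp b h, hW.coeFn_wickExpLp b' g] with ω h1 h2
  rw [h1, h2, RCLike.inner_apply]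

omit hW in
/-- A map into a Hilbert space is continuous if its Gram kernel is. -/
theorem _root_.continuous_of_continuous_inner {X E : Type*} [TopologicalSpace X]
    [NormedAddCommGroup E] [InnerProductSpace ℂ E] {F : X → E}
    (h : Continuous fun q : X × X => inner ℂ (F q.1) (F q.2)) : Continuous F := by
  rw [continuous_iff_continuousAt]
  intro x
  rw [ContinuousAt, tendsto_iff_norm_sub_tendsto_zero]
  have e : ∀ y, ‖F y - F x‖ = Real.sqrt (RCLike.re (inner ℂ (F y) (F y)) -
      2 * RCLike.re (inner ℂ (F y) (F x)) + RCLike.re (inner ℂ (F x) (F x))) := by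
    intro y
    rw [← Real.sqrt_sq (norm_nonneg (F y - F x)), @norm_sub_sq ℂ,
      ← inner_self_eq_norm_sq (𝕜 := ℂ), ← inner_self_eq_norm_sq (𝕜 := ℂ)]
  simp_rw [e]
  have hc : Continuous fun y => Real.sqrt (RCLike.re (inner ℂ (F y) (F y)) -
      2 * RCLike.re (inner ℂ (F y) (F x)) + RCLike.re (inner ℂ (F x) (F x))) := by
    have c1 : Continuous fun y => inner ℂ (F y) (F y) := h.comp (by fun_prop : Continuous fun y => (y, y))
    have c2 : Continuous fun y => inner ℂ (F y) (F x) := h.comp (by fun_prop : Continuous fun y => (y, x))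
    exact Real.continuous_sqrt.comp (((RCLike.continuous_re.comp c1).sub
      ((RCLike.continuous_re.comp c2).const_mul 2)).add continuous_const)
  have := hc.tendsto x
  convert this using 2
  ring_nf
  simp

theorem continuous_wickExpLp : Continuous fun q : ℂ × H => hW.wickExpLp q.1 q.2 := by
  refine continuous_of_continuous_inner ?_
  simp_rw [hW.inner_wickExpLp]
  fun_prop

theorem norm_wickExpLp_sub_sq (b : ℂ) (h g : H) :
    ‖hW.wickExpLp b h - hW.wickExpLp b g‖ ^ 2 = Real.exp (‖b‖ ^ 2 * ‖h‖ ^ 2) -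
      2 * Real.exp (‖b‖ ^ 2 * inner ℝ h g) + Real.exp (‖b‖ ^ 2 * ‖g‖ ^ 2) := by
  have key : ∀ h g : H, RCLike.re (inner ℂ (hW.wickExpLp b h) (hW.wickExpLp b g)) =
      Real.exp (‖b‖ ^ 2 * inner ℝ h g) := by
    intro h g
    rw [hW.inner_wickExpLp, mul_comm ((starRingEnd ℂ) b), Complex.mul_conj,
      Complex.normSq_eq_norm_sq, ← Complex.ofReal_mul, ← Complex.ofReal_exp]
    exact Complex.ofReal_re _
  rw [@norm_sub_sq ℂ, ← inner_self_eq_norm_sq (𝕜 := ℂ), ← inner_self_eq_norm_sq (𝕜 := ℂ), key, key,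
    key, real_inner_self_eq_norm_sq, real_inner_self_eq_norm_sq]

end IsIsonormal

end Isonormal

/-! ### A one-step moment inequality of von Bahr–Esseen type. -/

section VonBahrEsseen

/-- A first-order expansion of `|a + b|^p` for `1 ≤ p ≤ 2`. -/
theorem norm_add_rpow_le {p : ℝ} (hp1 : 1 ≤ p) (hp2 : p ≤ 2) (a b : ℂ) :
    ‖a + b‖ ^ p ≤ ‖a‖ ^ p + p * (‖a‖ ^ (p - 2) * ((starRingEnd ℂ) a * b).re) + 6 * ‖b‖ ^ p := by
  have hp0 : 0 < p := by linarith
  rcases eq_or_ne a 0 with rfl | ha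
  · have : 0 ≤ ‖b‖ ^ p := by positivity
    simp [Real.zero_rpow hp0.ne']
    linarith
  have hA : 0 < ‖a‖ := norm_pos_iff.2 ha
  have hre : |((starRingEnd ℂ) a * b).re| ≤ ‖a‖ * ‖b‖ := by
    refine (Complex.abs_re_le_norm _).trans_eq ?_
    rw [norm_mul, RCLike.norm_conj]
  have hsplit : ‖a‖ ^ p = ‖a‖ ^ (p - 2) * ‖a‖ ^ 2 := by
    rw [← Real.rpow_natCast, ← Real.rpow_add hA]
    congr 1
    push_cast
    ring
  have hsplit1 : ‖a‖ ^ (p - 1) = ‖a‖ ^ (p - 2) * ‖a‖ := by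
    rw [← Real.rpow_add_one hA.ne']
    congr 1
    ring
  -- For `|b| ≤ |a|`, write `|a+b|² = |a|²(1+y)` and use Bernoulli's inequality with exponent `p/2 ≤
  -- 1`; the quadratic remainder is at most `|b|^p`. For `|b| > |a|`, both `|a+b|^p ≤ 4|b|^p` and
  -- the linear term, at most `2|b|^p` in modulus, are crude, whence `6 = 4 + 2`.
  rcases le_or_gt ‖b‖ ‖a‖ with hba | hba
  · set r := ((starRingEnd ℂ) a * b).re with hr
    have hsq : ‖a + b‖ ^ 2 = ‖a‖ ^ 2 + (2 * r + ‖b‖ ^ 2) := by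
      rw [← Complex.normSq_eq_norm_sq, Complex.normSq_add, Complex.normSq_eq_norm_sq,
        Complex.normSq_eq_norm_sq, hr]
      have : (a * (starRingEnd ℂ) b).re = ((starRingEnd ℂ) a * b).re := by simp
      rw [this]
      ring
    have hA2 : 0 < ‖a‖ ^ 2 := by positivity
    set y := (2 * r + ‖b‖ ^ 2) / ‖a‖ ^ 2 with hy
    have hsq' : ‖a + b‖ ^ 2 = ‖a‖ ^ 2 * (1 + y) := by
      rw [hsq, hy]
      field_simp
    have hy1 : 0 ≤ 1 + y := by
      have h0 : 0 ≤ ‖a‖ ^ 2 * (1 + y) := hsq' ▸ sq_nonneg _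
      exact nonneg_of_mul_nonneg_right h0 hA2
    have hb1 : ‖a + b‖ ^ p = ‖a‖ ^ p * (1 + y) ^ (p / 2) := by
      have e : ∀ t : ℝ, 0 ≤ t → t ^ p = (t ^ 2) ^ (p / 2) := by
        intro t ht
        rw [← Real.rpow_natCast, ← Real.rpow_mul ht]
        congr 1
        push_cast
        ring
      rw [e _ (norm_nonneg _), hsq', Real.mul_rpow hA2.le hy1, ← e _ hA.le]
    have hb2 : (1 + y) ^ (p / 2) ≤ 1 + p / 2 * y :=
      rpow_one_add_le_one_add_mul_self (by linarith) (by linarith) (by linarith)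
    have hb3 : ‖a‖ ^ (p - 2) * ‖b‖ ^ 2 ≤ ‖b‖ ^ p := by
      rcases eq_or_ne b 0 with rfl | hb
      · simp [Real.zero_rpow hp0.ne']
      have hB : 0 < ‖b‖ := norm_pos_iff.2 hb
      have : ‖b‖ ^ p = ‖b‖ ^ (p - 2) * ‖b‖ ^ 2 := by
        rw [← Real.rpow_natCast, ← Real.rpow_add hB]
        congr 1
        push_cast
        ring
      rw [this]
      gcongr ?_ * _
      exact Real.rpow_le_rpow_of_nonpos hB hba (by linarith)
    have hb4 : ‖a‖ ^ p * (p / 2 * y) = p * (‖a‖ ^ (p - 2) * r) +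
        p / 2 * (‖a‖ ^ (p - 2) * ‖b‖ ^ 2) := by
      rw [hsplit, hy]
      field_simp
    have hb5 : 0 ≤ ‖b‖ ^ p := by positivity
    calc ‖a + b‖ ^ p ≤ ‖a‖ ^ p * (1 + p / 2 * y) := by
          rw [hb1]
          gcongr
      _ = ‖a‖ ^ p + p * (‖a‖ ^ (p - 2) * r) + p / 2 * (‖a‖ ^ (p - 2) * ‖b‖ ^ 2) := by
          rw [mul_add, hb4]
          ring
      _ ≤ ‖a‖ ^ p + p * (‖a‖ ^ (p - 2) * r) + 6 * ‖b‖ ^ p := by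
          have : p / 2 * (‖a‖ ^ (p - 2) * ‖b‖ ^ 2) ≤ 1 * ‖b‖ ^ p := by
            gcongr
            linarith
          linarith
  · have hB : 0 < ‖b‖ := hA.trans hba
    have h1 : ‖a + b‖ ^ p ≤ 4 * ‖b‖ ^ p := by
      calc ‖a + b‖ ^ p ≤ (2 * ‖b‖) ^ p := by
            refine Real.rpow_le_rpow (norm_nonneg _) ?_ hp0.le
            linarith [norm_add_le a b]
        _ = 2 ^ p * ‖b‖ ^ p := Real.mul_rpow (by norm_num) hB.le
        _ ≤ 4 * ‖b‖ ^ p := by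
            gcongr
            calc (2 : ℝ) ^ p ≤ 2 ^ (2 : ℝ) := Real.rpow_le_rpow_of_exponent_le (by norm_num) hp2
              _ = 4 := by norm_num
    have h2 : -(2 * ‖b‖ ^ p) ≤ p * (‖a‖ ^ (p - 2) * ((starRingEnd ℂ) a * b).re) := by
      have h3 : |p * (‖a‖ ^ (p - 2) * ((starRingEnd ℂ) a * b).re)| ≤ 2 * ‖b‖ ^ p := by
        rw [abs_mul, abs_mul, abs_of_pos hp0, abs_of_nonneg (by positivity)]
        calc _ ≤ 2 * (‖a‖ ^ (p - 2) * (‖a‖ * ‖b‖)) := by gcongr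
          _ = 2 * (‖a‖ ^ (p - 1) * ‖b‖) := by rw [hsplit1]; ring
          _ ≤ 2 * (‖b‖ ^ (p - 1) * ‖b‖) := by
              gcongr
          _ = _ := by
              rw [← Real.rpow_add_one hB.ne']
              congr 2
              ring
      exact (abs_le.1 h3).1
    have h4 : 0 ≤ ‖a‖ ^ p := by positivity
    linarith

variable {Ω : Type*} [MeasurableSpace Ω] {P : Measure Ω}

/-- The duality map `s ↦ |s|^{p-2} s`. -/
noncomputable def dualityMap (p : ℝ) (s : ℂ) : ℂ := ((‖s‖ ^ (p - 2) : ℝ) : ℂ) * s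

theorem norm_dualityMap_le {p : ℝ} (hp1 : 1 ≤ p) (hp2 : p ≤ 2) (s : ℂ) :
    ‖dualityMap p s‖ ≤ 1 + ‖s‖ := by
  rcases eq_or_ne s 0 with rfl | hs
  · simp [dualityMap]
  have hs' : 0 < ‖s‖ := norm_pos_iff.2 hs
  rw [dualityMap, norm_mul, Complex.norm_real, Real.norm_of_nonneg (by positivity),
    ← Real.rpow_add_one hs'.ne']
  rcases le_total ‖s‖ 1 with h | h
  · have := Real.rpow_le_one hs'.le h (by linarith : 0 ≤ p - 2 + 1)
    linarith
  · have := Real.rpow_le_rpow_of_exponent_le h (by linarith : p - 2 + 1 ≤ 1)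
    rw [Real.rpow_one] at this
    linarith

theorem measurable_dualityMap (p : ℝ) : Measurable (dualityMap p) := by
  unfold dualityMap
  fun_prop

theorem memLp_dualityMap [IsFiniteMeasure P] {p : ℝ} (hp1 : 1 ≤ p) (hp2 : p ≤ 2) {S : Ω → ℂ}
    (hS : MemLp S 2 P) : MemLp (fun ω => dualityMap p (S ω)) 2 P := by
  have h0 : MemLp (fun _ : Ω => (1 : ℝ)) 2 P := memLp_const 1
  have h1 : MemLp (fun ω => 1 + ‖S ω‖) 2 P := h0.add hS.norm
  have h2 : AEStronglyMeasurable (fun ω => dualityMap p (S ω)) P :=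
    ((measurable_dualityMap p).comp_aemeasurable
      hS.aestronglyMeasurable.aemeasurable).aestronglyMeasurable
  exact h1.mono' h2 (Eventually.of_forall fun ω => norm_dualityMap_le hp1 hp2 _)

theorem integrable_norm_rpow_of_le_two [IsFiniteMeasure P] {p : ℝ} (hp1 : 1 ≤ p)
    (hp2 : p ≤ 2) {S : Ω → ℂ} (hS : MemLp S 2 P) : Integrable (fun ω => ‖S ω‖ ^ p) P := by
  have h := (hS.mono_exponent (p := ENNReal.ofReal p) (by
    rw [← ENNReal.ofReal_ofNat]
    exact ENNReal.ofReal_le_ofReal hp2)).integrable_norm_rpow'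
  rwa [ENNReal.toReal_ofReal (by linarith)] at h

/-- A one-step von Bahr–Esseen inequality. -/
theorem integral_norm_add_rpow_le [IsFiniteMeasure P] {p : ℝ} (hp1 : 1 ≤ p) (hp2 : p ≤ 2)
    {S Z : Ω → ℂ} (hS : MemLp S 2 P) (hZ : MemLp Z 2 P)
    (horth : ∫ ω, (starRingEnd ℂ) (dualityMap p (S ω)) * Z ω ∂P = 0) :
    ∫ ω, ‖S ω + Z ω‖ ^ p ∂P ≤ ∫ ω, ‖S ω‖ ^ p ∂P + 6 * ∫ ω, ‖Z ω‖ ^ p ∂P := by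
  have hD : Integrable (fun ω => (starRingEnd ℂ) (dualityMap p (S ω)) * Z ω) P :=
    (memLp_dualityMap hp1 hp2 hS).star.integrable_mul hZ
  have hpt : ∀ ω, ‖S ω + Z ω‖ ^ p ≤ (‖S ω‖ ^ p +
      p * ((starRingEnd ℂ) (dualityMap p (S ω)) * Z ω).re) + 6 * ‖Z ω‖ ^ p := by
    intro ω
    refine (norm_add_rpow_le hp1 hp2 (S ω) (Z ω)).trans_eq ?_
    rw [dualityMap, map_mul, Complex.conj_ofReal, mul_assoc, Complex.re_ofReal_mul]
  have iS := integrable_norm_rpow_of_le_two hp1 hp2 hS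
  have iZ := integrable_norm_rpow_of_le_two hp1 hp2 hZ
  have iD : Integrable (fun ω => p * ((starRingEnd ℂ) (dualityMap p (S ω)) * Z ω).re) P :=
    hD.re.const_mul p
  have iSD : Integrable (fun ω => ‖S ω‖ ^ p +
      p * ((starRingEnd ℂ) (dualityMap p (S ω)) * Z ω).re) P := iS.add iD
  refine (integral_mono (integrable_norm_rpow_of_le_two hp1 hp2 (hS.add hZ))
    (iSD.add (iZ.const_mul 6)) hpt).trans_eq ?_
  simp only [Pi.add_apply]
  rw [integral_add iSD (iZ.const_mul 6), integral_add iS iD, integral_const_mul,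
    integral_const_mul]
  have : ∫ ω, ((starRingEnd ℂ) (dualityMap p (S ω)) * Z ω).re ∂P = 0 := by
    have h := integral_re hD
    rw [horth] at h
    simpa using h
  rw [this]
  ring

/-- A Bochner integral of elements of a closed subspace of a Hilbert space. -/
theorem integral_mem_submodule {E V : Type*} [MeasurableSpace E] {μ : Measure E}
    [NormedAddCommGroup V] [InnerProductSpace ℂ V] [CompleteSpace V] (U : Submodule ℂ V)
    [U.HasOrthogonalProjection] {F : E → V} (hF : Integrable F μ) (h : ∀ᵐ x ∂μ, F x ∈ U) :
    ∫ x, F x ∂μ ∈ U := by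
  rw [← Submodule.orthogonal_orthogonal U, Submodule.mem_orthogonal]
  intro w hw
  rw [← integral_inner hF]
  refine integral_eq_zero_of_ae ?_
  filter_upwards [h] with x hx
  exact (Submodule.mem_orthogonal' U w).1 hw _ hx

end VonBahrEsseen

/-! ### Moments of sums of increments over separated cells. -/

section Increments

variable {Ω : Type*} [MeasurableSpace Ω] {H : Type*} [NormedAddCommGroup H] [InnerProductSpace ℝ H]
  {P : Measure Ω} {W : H → Ω → ℝ}

/-- Von Bahr–Esseen inequality for the increments of integrated Wick exponentials over cells on
which the increments of the field are independent. -/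
theorem IsIsonormal.integral_norm_sum_rpow_le (hW : IsIsonormal P W) {p : ℝ} (hp1 : 1 ≤ p)
    (hp2 : p ≤ 2) {E ι : Type*} [MeasurableSpace E] {μ : Measure E} {g g' : E → H} {f : E → ℂ} (b : ℂ)
    (hF : Integrable (fun x => f x • (hW.wickExpLp b (g' x) - hW.wickExpLp b (g x))) μ)
    (Q : ι → Set E) (hQ : ∀ i, MeasurableSet (Q i)) (s : Finset ι)
    (hgg : ∀ x y, inner ℝ (g y) (g' x - g x) = 0)
    (hsep : ∀ i ∈ s, ∀ j ∈ s, i ≠ j → ∀ x ∈ Q i, ∀ y ∈ Q j,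
      inner ℝ (g' y - g y) (g' x - g x) = 0) :
    ∫ ω, ‖(∑ i ∈ s, ∫ x in Q i, f x • (hW.wickExpLp b (g' x) - hW.wickExpLp b (g x)) ∂μ :
        Lp ℂ 2 P) ω‖ ^ p ∂P ≤
      6 * ∑ i ∈ s, ∫ ω, ‖(∫ x in Q i, f x • (hW.wickExpLp b (g' x) - hW.wickExpLp b (g x)) ∂μ :
        Lp ℂ 2 P) ω‖ ^ p ∂P := by
  classical
  have := hW.isProbabilityMeasure
  have hp0 : p ≠ 0 := by linarith
  set F : E → Lp ℂ 2 P := fun x => f x • (hW.wickExpLp b (g' x) - hW.wickExpLp b (g x)) with hFdef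
  induction s using Finset.induction_on with
  | empty =>
    simp only [Finset.sum_empty, mul_zero]
    refine (integral_eq_zero_of_ae ?_).le
    filter_upwards [Lp.coeFn_zero ℂ 2 P] with ω hω
    rw [hω]
    simp [Real.zero_rpow hp0]
  | insert i s hi ih =>
    have ih' := ih fun j hj k hk => hsep j (Finset.mem_insert_of_mem hj) k
      (Finset.mem_insert_of_mem hk)
    rw [Finset.sum_insert hi, Finset.sum_insert hi]
    set S : Lp ℂ 2 P := ∑ j ∈ s, ∫ x in Q j, F x ∂μ with hS
    set Z : Lp ℂ 2 P := ∫ x in Q i, F x ∂μ with hZ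
    -- Condition on the coarse field everywhere and on the fine field over the cells already summed.
    -- The increment over the new cell is centred given this information, which also determines the
    -- partial sum `S`.
    set V : Set H := Set.range g ∪ {v | ∃ j ∈ s, ∃ x ∈ Q j, g' x = v} with hV
    have hVk : ∀ x ∈ Q i, ∀ v ∈ V, inner ℝ v (g' x - g x) = 0 := by
      rintro x hx v (⟨y, rfl⟩ | ⟨j, hj, y, hy, rfl⟩)
      · exact hgg x y
      · have h1 := hsep i (Finset.mem_insert_self i s) j (Finset.mem_insert_of_mem hj)
          (fun h => hi (h ▸ hj)) x hx y hy
        rwa [inner_sub_left, hgg, sub_zero] at h1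
    have hle := hW.generatedBy_le V
    have : Fact (generatedBy W V ≤ ‹MeasurableSpace Ω›) := ⟨hle⟩
    have hmem : ∀ v ∈ V, hW.wickExpLp b v ∈ lpMeas ℂ ℂ (generatedBy W V) 2 P := by
      intro v hv
      rw [mem_lpMeas_iff_aestronglyMeasurable]
      have h1 : Measurable[generatedBy W V] (wickExp W b v) := by
        have := measurable_generatedBy (W := W) hv
        unfold wickExp
        exact Complex.continuous_exp.measurable.comp
          (((Complex.continuous_ofReal.measurable.comp this).const_mul b).sub_const _)
      exact ⟨_, h1.stronglyMeasurable, hW.coeFn_wickExpLp b v⟩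
    have hSm : S ∈ lpMeas ℂ ℂ (generatedBy W V) 2 P := by
      refine Submodule.sum_mem _ fun j hj => ?_
      refine integral_mem_submodule _ hF.integrableOn ?_
      filter_upwards [ae_restrict_mem (hQ j)] with x hx
      exact Submodule.smul_mem _ _ (Submodule.sub_mem _ (hmem _ (Or.inr ⟨j, hj, x, hx, rfl⟩))
        (hmem _ (Or.inl ⟨x, rfl⟩)))
    rw [mem_lpMeas_iff_aestronglyMeasurable] at hSm
    have hD : MemLp (fun ω => dualityMap p (S ω)) 2 P := memLp_dualityMap hp1 hp2 (Lp.memLp S)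
    have hDm : AEStronglyMeasurable[generatedBy W V]
        (fun ω => (starRingEnd ℂ) (dualityMap p (S ω))) P := by
      obtain ⟨S', hS', hae⟩ := hSm
      refine ⟨fun ω => (starRingEnd ℂ) (dualityMap p (S' ω)), ?_, ?_⟩
      · exact Complex.continuous_conj.comp_stronglyMeasurable
          ((measurable_dualityMap p).comp hS'.measurable).stronglyMeasurable
      · filter_upwards [hae] with ω hω
        rw [hω]
    have horth : ∫ ω, (starRingEnd ℂ) (dualityMap p (S ω)) * Z ω ∂P = 0 := by
      have e1 : ∀ G : Lp ℂ 2 P, inner ℂ (hD.toLp _) G =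
          ∫ ω, (starRingEnd ℂ) (dualityMap p (S ω)) * G ω ∂P := by
        intro G
        rw [L2.inner_def]
        refine integral_congr_ae ?_
        filter_upwards [hD.coeFn_toLp] with ω hω
        rw [hω, RCLike.inner_apply, mul_comm]
      rw [← e1, hZ, ← integral_inner hF.integrableOn]
      refine setIntegral_eq_zero_of_forall_eq_zero fun x hx => ?_
      rw [hFdef, inner_smul_right, e1]
      have h0 := hW.integral_mul_wickExp_sub (g := g x) (g' := g' x) (Or.inl ⟨x, rfl⟩)
        (hVk x hx) b hD.star hDm
      have h1 : ∫ ω, (starRingEnd ℂ) (dualityMap p (S ω)) *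
          (hW.wickExpLp b (g' x) - hW.wickExpLp b (g x) : Lp ℂ 2 P) ω ∂P = 0 := by
        rw [← h0]
        refine integral_congr_ae ?_
        filter_upwards [Lp.coeFn_sub (hW.wickExpLp b (g' x)) (hW.wickExpLp b (g x)),
          hW.coeFn_wickExpLp b (g' x), hW.coeFn_wickExpLp b (g x)] with ω h1 h2 h3
        rw [h1, Pi.sub_apply, h2, h3]
        rfl
      rw [h1, mul_zero]
    have hstep := integral_norm_add_rpow_le hp1 hp2 (Lp.memLp S) (Lp.memLp Z) horth
    have hadd : ∫ ω, ‖(Z + S : Lp ℂ 2 P) ω‖ ^ p ∂P = ∫ ω, ‖S ω + Z ω‖ ^ p ∂P := by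
      refine integral_congr_ae ?_
      filter_upwards [Lp.coeFn_add Z S] with ω hω
      rw [hω, Pi.add_apply, add_comm]
    rw [hadd, mul_add]
    linarith

end Increments

/-! ### The inclusion of `L²` into `L^p`. -/

section Lowering

variable {Ω : Type*} [MeasurableSpace Ω] {P : Measure Ω} [IsProbabilityMeasure P] {p : ℝ}

theorem ofReal_le_two (hp2 : p ≤ 2) : ENNReal.ofReal p ≤ 2 := by
  rw [← ENNReal.ofReal_ofNat]
  exact ENNReal.ofReal_le_ofReal hp2

variable (P) in
/-- The inclusion of `L²` into `L^p`, `1 ≤ p ≤ 2`, on a probability space. -/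
noncomputable def lowerLp [Fact (1 ≤ ENNReal.ofReal p)] (hp2 : p ≤ 2) :
    Lp ℂ 2 P →L[ℂ] Lp ℂ (ENNReal.ofReal p) P :=
  LinearMap.mkContinuous
    { toFun := fun F => ((Lp.memLp F).mono_exponent (ofReal_le_two hp2)).toLp F
      map_add' := fun F G => by
        apply Lp.ext
        filter_upwards [((Lp.memLp (F + G)).mono_exponent (ofReal_le_two hp2)).coeFn_toLp,
          ((Lp.memLp F).mono_exponent (ofReal_le_two hp2)).coeFn_toLp,
          ((Lp.memLp G).mono_exponent (ofReal_le_two hp2)).coeFn_toLp,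
          Lp.coeFn_add F G, Lp.coeFn_add
            (((Lp.memLp F).mono_exponent (ofReal_le_two hp2)).toLp F)
            (((Lp.memLp G).mono_exponent (ofReal_le_two hp2)).toLp G)] with ω h1 h2 h3 h4 h5
        rw [h1, h5, h4, Pi.add_apply, Pi.add_apply, h2, h3]
      map_smul' := fun c F => by
        apply Lp.ext
        filter_upwards [((Lp.memLp (c • F)).mono_exponent (ofReal_le_two hp2)).coeFn_toLp,
          ((Lp.memLp F).mono_exponent (ofReal_le_two hp2)).coeFn_toLp,
          Lp.coeFn_smul c F, Lp.coeFn_smul c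
            (((Lp.memLp F).mono_exponent (ofReal_le_two hp2)).toLp F)] with ω h1 h2 h3 h4
        rw [h1, RingHom.id_apply, h4, h3, Pi.smul_apply, Pi.smul_apply, h2] } 1
    (fun F => by
      change ‖((Lp.memLp F).mono_exponent (ofReal_le_two hp2)).toLp F‖ ≤ _
      rw [Lp.norm_toLp, one_mul, Lp.norm_def]
      exact ENNReal.toReal_mono (Lp.memLp F).eLpNorm_ne_top
        (eLpNorm_le_eLpNorm_of_exponent_le (ofReal_le_two hp2) (Lp.aestronglyMeasurable F)))

variable [hp : Fact (1 ≤ ENNReal.ofReal p)] (hp2 : p ≤ 2)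

theorem coeFn_lowerLp (F : Lp ℂ 2 P) : lowerLp P hp2 F =ᵐ[P] F :=
  ((Lp.memLp F).mono_exponent (ofReal_le_two hp2)).coeFn_toLp

theorem norm_lowerLp_le (F : Lp ℂ 2 P) : ‖lowerLp P hp2 F‖ ≤ ‖F‖ := by
  have h := (lowerLp P hp2).le_of_opNorm_le (LinearMap.mkContinuous_norm_le _ zero_le_one _) F
  rwa [one_mul] at h

omit [IsProbabilityMeasure P] in
include hp in
theorem one_le_of_fact : 1 ≤ p := by
  have := hp.out
  rwa [ENNReal.one_le_ofReal] at this

theorem norm_lowerLp (F : Lp ℂ 2 P) : ‖lowerLp P hp2 F‖ = (∫ ω, ‖F ω‖ ^ p ∂P) ^ p⁻¹ := by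
  have hp1 : 1 ≤ p := one_le_of_fact
  have hp0 : 0 < p := by linarith
  have hF := (Lp.memLp F).mono_exponent (ofReal_le_two hp2)
  rw [Lp.norm_def, eLpNorm_congr_ae (coeFn_lowerLp hp2 F),
    hF.eLpNorm_eq_integral_rpow_norm (by simpa using hp0) ENNReal.ofReal_ne_top,
    ENNReal.toReal_ofReal hp0.le, ENNReal.toReal_ofReal (by positivity)]

theorem norm_lowerLp_rpow (F : Lp ℂ 2 P) : ‖lowerLp P hp2 F‖ ^ p = ∫ ω, ‖F ω‖ ^ p ∂P := by
  have hp1 : 1 ≤ p := one_le_of_fact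
  rw [norm_lowerLp, ← Real.rpow_mul (integral_nonneg fun ω => by positivity),
    inv_mul_cancel₀ (by linarith), Real.rpow_one]

theorem eLpNorm_one_le_lowerLp (F : Lp ℂ 2 P) :
    eLpNorm F 1 P ≤ ENNReal.ofReal ‖lowerLp P hp2 F‖ := by
  rw [Lp.norm_def, ENNReal.ofReal_toReal (Lp.memLp _).eLpNorm_ne_top,
    eLpNorm_congr_ae (coeFn_lowerLp hp2 F)]
  exact eLpNorm_le_eLpNorm_of_exponent_le hp.out (Lp.aestronglyMeasurable F)

theorem IsIsonormal.norm_lowerLp_wickExpLp {H : Type*} [NormedAddCommGroup H]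
    [InnerProductSpace ℝ H] {W : H → Ω → ℝ} (hW : IsIsonormal P W) (b : ℂ) (h : H) :
    ‖lowerLp P hp2 (hW.wickExpLp b h)‖ =
      Real.exp (((p - 1) * b.re ^ 2 + b.im ^ 2) / 2 * ‖h‖ ^ 2) := by
  have hp1 : 1 ≤ p := one_le_of_fact
  have hp0 : p ≠ 0 := by linarith
  have e : ∫ ω, ‖hW.wickExpLp b h ω‖ ^ p ∂P = ∫ ω, ‖wickExp W b h ω‖ ^ p ∂P := by
    refine integral_congr_ae ?_
    filter_upwards [hW.coeFn_wickExpLp b h] with ω hω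
    rw [hω]
  rw [norm_lowerLp, e, hW.integral_norm_wickExp_rpow, ← Real.exp_mul]
  congr 1
  field_simp

end Lowering

/-! ### Dyadic cells and their colouring modulo five. -/

section Cells

variable {d : ℕ}

/-- The dyadic cell of generation `n` and index `j`. -/
def dyadicCell (n : ℕ) (j : Fin d → ℤ) : Set (RSpace d) :=
  {x | (fun i => ⌊(2 : ℝ) ^ n * x i⌋) = j}

theorem measurableSet_dyadicCell (n : ℕ) (j : Fin d → ℤ) : MeasurableSet (dyadicCell n j) := by
  have : Measurable fun x : RSpace d => fun i => ⌊(2 : ℝ) ^ n * x i⌋ := by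
    refine measurable_pi_lambda _ fun i => Int.measurable_floor.comp ?_
    fun_prop
  exact this (measurableSet_singleton j)

theorem volume_real_dyadicCell (n : ℕ) (j : Fin d → ℤ) :
    volume.real (dyadicCell n j) = (((2 : ℝ) ^ n)⁻¹) ^ d := by
  have h2 : (0 : ℝ) < 2 ^ n := by positivity
  have e : dyadicCell n j = (fun x : RSpace d => WithLp.ofLp x) ⁻¹'
      (Set.univ.pi fun i => Set.Ico ((j i : ℝ) / 2 ^ n) (((j i : ℝ) + 1) / 2 ^ n)) := by
    ext x
    simp only [dyadicCell, Set.mem_ofPred_eq, funext_iff, Int.floor_eq_iff, Set.mem_preimage,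
      Set.mem_pi, Set.mem_univ, true_implies, Set.mem_Ico]
    refine forall_congr' fun i => ?_
    rw [div_le_iff₀ h2, lt_div_iff₀ h2, mul_comm]
  rw [measureReal_def, e, (PiLp.volume_preserving_ofLp (Fin d)).measure_preimage
    (MeasurableSet.univ_pi fun i => measurableSet_Ico).nullMeasurableSet, Real.volume_pi_Ico]
  simp only [← sub_div, add_sub_cancel_left, one_div]
  rw [Finset.prod_const, ENNReal.toReal_pow, ENNReal.toReal_ofReal (by positivity)]
  simp

theorem pairwise_disjoint_dyadicCell (n : ℕ) :
    Pairwise fun j j' : Fin d → ℤ => Disjoint (dyadicCell n j) (dyadicCell n j') := by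
  intro j j' h
  rw [Set.disjoint_left]
  intro x hx hx'
  exact h (hx.symm.trans hx')

/-- Distinct cells of the same colour are far apart. -/
theorem lt_norm_sub_of_mem_dyadicCell {n : ℕ} {j j' : Fin d → ℤ} (hne : j ≠ j')
    (hcol : (fun i => (j i : ZMod 5)) = fun i => (j' i : ZMod 5)) {x y : RSpace d}
    (hx : x ∈ dyadicCell n j) (hy : y ∈ dyadicCell n j') : 4 * ((2 : ℝ) ^ n)⁻¹ < ‖x - y‖ := by
  have h2 : (0 : ℝ) < 2 ^ n := by positivity
  obtain ⟨i, hi⟩ : ∃ i, j i ≠ j' i := by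
    by_contra! h
    exact hne (funext h)
  -- Distinct indices of equal colour differ by at least `5` in some coordinate; the integer parts
  -- lose less than `1`, which leaves more than `4` cell sides.
  have hdvd : (5 : ℤ) ∣ j i - j' i := by
    have := congrFun hcol i
    have h3 := (ZMod.intCast_eq_intCast_iff_dvd_sub (j' i) (j i) 5).1 this.symm
    exact_mod_cast h3
  have habs : 5 ≤ |j i - j' i| := Int.le_of_dvd (abs_pos.2 (sub_ne_zero.2 hi)) ((dvd_abs _ _).2 hdvd)
  have habs' : (5 : ℝ) ≤ |(j i : ℝ) - j' i| := by exact_mod_cast habs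
  have hx1 := Int.floor_eq_iff.1 (congrFun hx i)
  have hy1 := Int.floor_eq_iff.1 (congrFun hy i)
  have hlt : 4 < |2 ^ n * x i - 2 ^ n * y i| := by
    rcases le_abs.1 habs' with h | h
    · exact lt_abs.2 (Or.inl (by linarith [hx1.1, hy1.2]))
    · exact lt_abs.2 (Or.inr (by linarith [hy1.1, hx1.2]))
  rw [← mul_sub, abs_mul, abs_of_pos h2] at hlt
  have hcoord : |x i - y i| ≤ ‖x - y‖ := by
    have := PiLp.norm_apply_le (x - y) i
    simpa using this
  rw [← div_eq_mul_inv, div_lt_iff₀ h2]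
  nlinarith

/-- The indices of the cells of generation `n` that meet the box `[-R, R]^d`. -/
noncomputable def boxIndices (d R n : ℕ) : Finset (Fin d → ℤ) :=
  Fintype.piFinset fun _ => Finset.Icc (-(R * 2 ^ n : ℤ)) (R * 2 ^ n)

theorem card_boxIndices_le {R : ℕ} (hR : 1 ≤ R) (n : ℕ) :
    ((boxIndices d R n).card : ℝ) ≤ (3 * R) ^ d * (2 ^ n) ^ d := by
  have hR' : (1 : ℝ) ≤ R := by exact_mod_cast hR
  have h1 : (1 : ℝ) ≤ 2 ^ n := one_le_pow₀ (by norm_num)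
  have hc : ((R * 2 ^ n + 1 - -(R * 2 ^ n) : ℤ).toNat : ℝ) = R * 2 ^ n + 1 + R * 2 ^ n := by
    have : (R * 2 ^ n + 1 - -(R * 2 ^ n) : ℤ).toNat = R * 2 ^ n + 1 + R * 2 ^ n := by
      have e : (R * 2 ^ n + 1 - -(R * 2 ^ n) : ℤ) = ((R * 2 ^ n + 1 + R * 2 ^ n : ℕ) : ℤ) := by
        push_cast
        ring
      rw [e, Int.toNat_natCast]
    rw [this]
    push_cast
    ring
  rw [boxIndices, Fintype.card_piFinset]
  simp only [Int.card_Icc, Finset.prod_const, Finset.card_univ, Fintype.card_fin]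
  push_cast
  rw [hc, ← mul_pow]
  gcongr
  nlinarith

theorem mem_boxIndices {R n : ℕ} {x : RSpace d} (hx : ∀ i, |x i| ≤ R) :
    (fun i => ⌊(2 : ℝ) ^ n * x i⌋) ∈ boxIndices d R n := by
  have h2 : (0 : ℝ) < 2 ^ n := by positivity
  rw [boxIndices, Fintype.mem_piFinset]
  intro i
  rw [Finset.mem_Icc]
  have h := abs_le.1 (hx i)
  constructor
  · rw [Int.le_floor]
    push_cast
    nlinarith
  · have : (⌊(2 : ℝ) ^ n * x i⌋ : ℝ) ≤ R * 2 ^ n := (Int.floor_le _).trans (by nlinarith)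
    exact_mod_cast this

end Cells

/-! ### The contribution of one scale. -/

section OneScale

variable {d : ℕ} {Ω : Type*} [MeasurableSpace Ω] {P : Measure Ω} [IsProbabilityMeasure P]
  {p : ℝ} [hp : Fact (1 ≤ ENNReal.ofReal p)] (hp2 : p ≤ 2)
  {H : Type*} [NormedAddCommGroup H] [InnerProductSpace ℝ H] {W : H → Ω → ℝ}

theorem integrable_smul_of_continuous {V : Type*} [NormedAddCommGroup V] [NormedSpace ℂ V]
    {f : RSpace d → ℂ} (hf : AEStronglyMeasurable f volume) {M : ℝ} (hM : ∀ᵐ x, ‖f x‖ ≤ M)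
    {R : ℝ} (hR : ∀ x, f x ≠ 0 → ∀ i, |x i| ≤ R) {F : RSpace d → V} (hF : Continuous F) :
    Integrable fun x => f x • F x := by
  classical
  -- A compact ball containing the box `[-R, R]^d`.
  set Kb : Set (RSpace d) := Metric.closedBall 0 (Real.sqrt (d * R ^ 2)) with hKb
  have hsub : ∀ x, f x ≠ 0 → x ∈ Kb := by
    intro x hx
    rw [hKb, mem_closedBall_zero_iff, EuclideanSpace.norm_eq]
    refine Real.sqrt_le_sqrt ?_
    calc ∑ i, ‖x i‖ ^ 2 ≤ ∑ _i : Fin d, R ^ 2 := by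
          refine Finset.sum_le_sum fun i _ => ?_
          exact pow_le_pow_left₀ (norm_nonneg _) (hR x hx i) 2
      _ = d * R ^ 2 := by simp
  have hFi : IntegrableOn F Kb := hF.continuousOn.integrableOn_compact (isCompact_closedBall _ _)
  have h1 : IntegrableOn (fun x => f x • F x) Kb := by
    refine Integrable.mono' (hFi.norm.const_mul M) (hf.restrict.smul hFi.aestronglyMeasurable) ?_
    filter_upwards [ae_restrict_of_ae hM] with x hx
    rw [norm_smul]
    gcongr
  rw [integrableOn_iff_integrable_of_support_subset] at h1
  · exact h1
  · intro x hx
    exact hsub x fun h => hx (by simp [h])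

/-- The contribution of the scales `2^{-n}` to the moments of integrated Wick exponentials. -/
theorem IsIsonormal.norm_integral_increment_le (hW : IsIsonormal P W) {g g' : RSpace d → H}
    (hg : Continuous g) (hg' : Continuous g') {f : RSpace d → ℂ}
    (hf : AEStronglyMeasurable f volume)
    {M : ℝ} (hM0 : 0 ≤ M) (hM : ∀ᵐ x, ‖f x‖ ≤ M) {R : ℕ} (hR1 : 1 ≤ R)
    (hR : ∀ x, f x ≠ 0 → ∀ i, |x i| ≤ R) (b : ℂ) (n : ℕ)
    (hgg : ∀ x y, inner ℝ (g y) (g' x - g x) = 0)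
    (hsep : ∀ x y, 4 * ((2 : ℝ) ^ n)⁻¹ < ‖x - y‖ → inner ℝ (g' y - g y) (g' x - g x) = 0)
    {B : ℝ} (hB : ∀ x, ‖lowerLp P hp2 (hW.wickExpLp b (g x))‖ ≤ B)
    (hB' : ∀ x, ‖lowerLp P hp2 (hW.wickExpLp b (g' x))‖ ≤ B) :
    ‖lowerLp P hp2 (∫ x, f x • (hW.wickExpLp b (g' x) - hW.wickExpLp b (g x)))‖ ≤
      5 ^ d * (12 * (3 * R) ^ d) * M * B * ((2 : ℝ) ^ n) ^ (-(d * (p - 1) / p)) := by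
  classical
  have hp1 : 1 ≤ p := one_le_of_fact
  have hp0 : 0 < p := by linarith
  have h2 : (0 : ℝ) < 2 ^ n := by positivity
  have hR' : (1 : ℝ) ≤ R := by exact_mod_cast hR1
  set e : H → Lp ℂ 2 P := hW.wickExpLp b with he
  have hec : Continuous e := hW.continuous_wickExpLp.comp (by fun_prop : Continuous fun h : H => (b, h))
  set F : RSpace d → Lp ℂ 2 P := fun x => f x • (e (g' x) - e (g x)) with hF
  have hFi : Integrable F :=
    integrable_smul_of_continuous hf hM hR ((hec.comp hg').sub (hec.comp hg))
  have hB0 : 0 ≤ B := (norm_nonneg _).trans (hB 0)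
  set J := lowerLp P hp2 with hJ
  have hcell : ∀ j, ‖J (∫ x in dyadicCell n j, F x)‖ ≤ M * (2 * B) * (((2 : ℝ) ^ n)⁻¹) ^ d := by
    intro j
    rw [← J.integral_comp_comm hFi.integrableOn, ← volume_real_dyadicCell n j]
    refine norm_setIntegral_le_of_norm_le_const_ae ?_ ?_
    · rw [lt_top_iff_ne_top]
      intro h
      have := volume_real_dyadicCell n j
      rw [measureReal_def, h, ENNReal.toReal_top] at this
      exact absurd this.symm (by positivity)
    · filter_upwards [ae_restrict_of_ae hM] with x hx
      rw [hF, map_smul, norm_smul, map_sub]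
      have : ‖J (e (g' x)) - J (e (g x))‖ ≤ 2 * B :=
        (norm_sub_le _ _).trans (by linarith [hB x, hB' x])
      gcongr
  set s := boxIndices d R n with hs
  set col : (Fin d → ℤ) → (Fin d → ZMod 5) := fun j i => (j i : ZMod 5) with hcol
  have hcolor : ∀ c, ‖J (∑ j ∈ s with col j = c, ∫ x in dyadicCell n j, F x)‖ ≤
      (12 * (3 * R) ^ d) * M * B * ((2 : ℝ) ^ n) ^ (-(d * (p - 1) / p)) := by
    intro c
    have h1 := hW.integral_norm_sum_rpow_le hp1 hp2 (f := f) b hFi (dyadicCell n)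
      (measurableSet_dyadicCell n) (s.filter fun j => col j = c) hgg (by
        intro i hi j hj hij x hx y hy
        refine hsep x y (lt_norm_sub_of_mem_dyadicCell hij ?_ hx hy)
        exact (Finset.mem_filter.1 hi).2.trans (Finset.mem_filter.1 hj).2.symm)
    simp_rw [← norm_lowerLp_rpow hp2] at h1
    set q : ℝ := ((2 : ℝ) ^ n) ^ (-(d * (p - 1) / p)) with hq
    have hq0 : 0 < q := by positivity
    have hD1 : (1 : ℝ) ≤ 6 * (3 * R) ^ d := by
      have : (1 : ℝ) ≤ (3 * R) ^ d := one_le_pow₀ (by linarith)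
      linarith
    have h3 : ‖J (∑ j ∈ s with col j = c, ∫ x in dyadicCell n j, F x)‖ ^ p ≤
        ((6 * (3 * R) ^ d) * (M * (2 * B)) * q) ^ p := by
      calc _ ≤ 6 * ∑ j ∈ s with col j = c, ‖J (∫ x in dyadicCell n j, F x)‖ ^ p := h1
        _ ≤ 6 * ∑ j ∈ s with col j = c, (M * (2 * B) * (((2 : ℝ) ^ n)⁻¹) ^ d) ^ p := by
            gcongr with j hj
            exact hcell j
        _ ≤ 6 * ∑ j ∈ s, (M * (2 * B) * (((2 : ℝ) ^ n)⁻¹) ^ d) ^ p := by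
            gcongr
            exact Finset.filter_subset _ _
        _ = 6 * (s.card * (M * (2 * B) * (((2 : ℝ) ^ n)⁻¹) ^ d) ^ p) := by
            rw [Finset.sum_const, nsmul_eq_mul]
        _ ≤ 6 * (((3 * R) ^ d * (2 ^ n) ^ d) * (M * (2 * B) * (((2 : ℝ) ^ n)⁻¹) ^ d) ^ p) := by
            gcongr
            exact card_boxIndices_le hR1 n
        _ = (6 * (3 * R) ^ d) * ((M * (2 * B)) ^ p * q ^ p) := by
            have hMB : 0 ≤ M * (2 * B) := by positivity
            rw [Real.mul_rpow hMB (by positivity)]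
            -- The number of cells against the p-th power of their volume: the net power
            -- `2^{-nd(p-1)}` is the gain over the triangle inequality.
            have : ((2 : ℝ) ^ n) ^ d * ((((2 : ℝ) ^ n)⁻¹) ^ d) ^ p = q ^ p := by
              rw [hq, ← Real.rpow_mul h2.le, ← Real.rpow_natCast (((2 : ℝ) ^ n)⁻¹),
                ← Real.rpow_natCast ((2 : ℝ) ^ n) d, Real.inv_rpow h2.le, ← Real.rpow_neg h2.le,
                ← Real.rpow_mul h2.le, ← Real.rpow_add h2]
              congr 1
              field_simp
              ring
            rw [← this]
            ring
        -- The constant is at least `1`, so it may be raised to the power `p`, which makes the p-th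
        -- root explicit.
        _ ≤ (6 * (3 * R) ^ d) ^ p * ((M * (2 * B)) ^ p * q ^ p) := by
            gcongr
            exact Real.self_le_rpow_of_one_le hD1 hp1
        _ = _ := by
            have hMB : 0 ≤ M * (2 * B) := by positivity
            rw [Real.mul_rpow (by positivity) hq0.le, Real.mul_rpow (by positivity) hMB]
            ring
    have h4 := (Real.rpow_le_rpow_iff (norm_nonneg _) (by positivity) hp0).1 h3
    refine h4.trans_eq (by ring)
  have hsum : ∫ x, F x = ∑ j ∈ s, ∫ x in dyadicCell n j, F x := by
    rw [← integral_biUnion_finset s (fun j _ => measurableSet_dyadicCell n j)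
      (fun i _ j _ hij => pairwise_disjoint_dyadicCell n hij) (fun j _ => hFi.integrableOn)]
    refine (setIntegral_eq_integral_of_forall_compl_eq_zero fun x hx => ?_).symm
    by_contra h
    have hfx : f x ≠ 0 := fun h0 => h (by simp [hF, h0])
    exact hx (Set.mem_biUnion (mem_boxIndices (hR x hfx)) rfl)
  change ‖J (∫ x, F x)‖ ≤ _
  -- The `5^d` colour classes are added by the triangle inequality.
  rw [hsum, ← Finset.sum_fiberwise s col, map_sum]
  refine (norm_sum_le _ _).trans ((Finset.sum_le_sum fun c _ => hcolor c).trans_eq ?_)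
  rw [Finset.sum_const, Finset.card_univ, Fintype.card_pi, Finset.prod_const, ZMod.card,
    Finset.card_univ, Fintype.card_fin, nsmul_eq_mul]
  push_cast
  ring

end OneScale

/-! ### Uniform bounds and Cauchy estimates for the complex chaos. -/

section Chaos

theorem two_pow_eq_exp (n : ℕ) : Real.exp (n * Real.log 2) = 2 ^ n := by
  rw [Real.exp_nat_mul, Real.exp_log (by norm_num)]

/-- Norm of a Bochner integral against a bounded function supported in a box. -/
theorem norm_integral_smul_le_of_box {d : ℕ} {V : Type*} [NormedAddCommGroup V] [NormedSpace ℂ V]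
    {f : RSpace d → ℂ} {M : ℝ} (hM0 : 0 ≤ M) (hM : ∀ᵐ x, ‖f x‖ ≤ M) {R : ℝ}
    (hR : ∀ x, f x ≠ 0 → ∀ i, |x i| ≤ R) {F : RSpace d → V} {B : ℝ} (hB : ∀ x, ‖F x‖ ≤ B) :
    ‖∫ x, f x • F x‖ ≤
      volume.real (Metric.closedBall (0 : RSpace d) (Real.sqrt (d * R ^ 2))) * M * B := by
  have hB0 : 0 ≤ B := (norm_nonneg _).trans (hB 0)
  rw [← setIntegral_eq_integral_of_forall_compl_eq_zero
    (s := Metric.closedBall (0 : RSpace d) (Real.sqrt (d * R ^ 2)))]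
  · refine (norm_setIntegral_le_of_norm_le_const_ae (C := M * B) measure_closedBall_lt_top
      ?_).trans_eq (by ring)
    filter_upwards [ae_restrict_of_ae hM] with x hx
    rw [norm_smul]
    gcongr
    exact hB x
  · intro x hx
    by_contra h
    have hfx : f x ≠ 0 := fun h0 => h (by simp [h0])
    apply hx
    rw [mem_closedBall_zero_iff, EuclideanSpace.norm_eq]
    refine Real.sqrt_le_sqrt ?_
    calc ∑ i, ‖x i‖ ^ 2 ≤ ∑ _i : Fin d, R ^ 2 := by
          refine Finset.sum_le_sum fun i _ => ?_
          exact pow_le_pow_left₀ (norm_nonneg _) (hR x hfx i) 2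
      _ = d * R ^ 2 := by simp

/-- The left side is the squared `L²` distance of two Wick exponentials, with `x`, `z` the squared
norms and `y` the inner product. If all three are close to `I` the distance is small, by `1 -
e^{-2se} ≤ 2se`. -/
theorem exp_sub_two_mul_exp_add_exp_le {s I e x y z : ℝ} (hs : 0 ≤ s) (hx : x ≤ I + e)
    (hy : I - e ≤ y) (hz : z ≤ I + e) :
    Real.exp (s * x) - 2 * Real.exp (s * y) + Real.exp (s * z) ≤
      4 * s * e * Real.exp (s * (I + e)) := by
  have f1 : Real.exp (s * x) ≤ Real.exp (s * (I + e)) := by gcongr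
  have f3 : Real.exp (s * z) ≤ Real.exp (s * (I + e)) := by gcongr
  have f2 : Real.exp (s * (I - e)) ≤ Real.exp (s * y) := by gcongr
  have h : s * (I - e) = s * (I + e) + -(2 * s * e) := by ring
  rw [h, Real.exp_add] at f2
  have := mul_le_mul_of_nonneg_left (Real.add_one_le_exp (-(2 * s * e)))
    (Real.exp_pos (s * (I + e))).le
  linarith

theorem norm_map_sub_le_of_norm_map_sub_le {E F 𝕜 : Type*} [NontriviallyNormedField 𝕜]
    [NormedAddCommGroup E] [NormedSpace 𝕜 E] [NormedAddCommGroup F] [NormedSpace 𝕜 F]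
    (T : E →L[𝕜] F) {u u' v v' : E} {r s t : ℝ} (h1 : ‖T (u - v)‖ ≤ r) (h2 : ‖T (v - v')‖ ≤ s)
    (h3 : ‖T (u' - v')‖ ≤ t) : ‖T (u - u')‖ ≤ r + s + t := by
  have h : u - u' = (u - v) + (v - v') - (u' - v') := by abel
  rw [h, map_sub, map_add]
  exact (norm_sub_le _ _).trans (add_le_add ((norm_add_le _ _).trans (add_le_add h1 h2)) h3)

variable {d : ℕ} {Ω : Type*} [MeasurableSpace Ω] {P : Measure Ω} [IsProbabilityMeasure P]
  {p : ℝ} [hp : Fact (1 ≤ ENNReal.ofReal p)] (hp2 : p ≤ 2)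
  {W : Lp ℝ 2 (spaceTime d) → Ω → ℝ} (hW : IsIsonormal P W)
  {K : RSpace d → ℝ} {φ : RSpace d → ℝ}
  (hd : 0 < d) (hK : IsSeedCovariance K) {α : ℝ≥0∞} {a : ℝ} (ha : a ∈ Set.Icc (0 : ℝ) 1)
  (hφ : IsMollifier φ)

/-- The integral of `f` against the Wick exponential of the layers `A` of the mollified field. -/
noncomputable def chaosIntegral (hW : IsIsonormal P W) (hK : IsSeedCovariance K) (α : ℝ≥0∞) (a : ℝ)
    (φ : RSpace d → ℝ) (f : RSpace d → ℂ) (b : ℂ) (A : Set ℝ) (ε : ℝ) : Lp ℂ 2 P :=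
  ∫ x, f x • hW.wickExpLp b (mollifiedLayer hK α a φ A ε x)

omit hp [IsProbabilityMeasure P] in
include hd ha hφ in
theorem integrable_chaosIntegral {f : RSpace d → ℂ} (hf : AEStronglyMeasurable f volume) {M : ℝ}
    (hM : ∀ᵐ x, ‖f x‖ ≤ M) {R : ℝ} (hR : ∀ x, f x ≠ 0 → ∀ i, |x i| ≤ R) (b : ℂ) {A : Set ℝ}
    (hA : MeasurableSet A) {ε : ℝ} (hε : 0 < ε) :
    Integrable fun x => f x • hW.wickExpLp b (mollifiedLayer hK α a φ A ε x) := by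
  refine integrable_smul_of_continuous hf hM hR ?_
  exact hW.continuous_wickExpLp.comp
    (continuous_const.prodMk (continuous_mollifiedLayer hd hK ha hφ hA hε))

include hd ha hφ hp in
/-- The layer estimate: the layers of index at least `n` contribute exponentially little. -/
theorem exists_norm_chaosIntegral_sub_le {R : ℕ} (hR1 : 1 ≤ R) {Λ : ℝ} (hΛ0 : 0 ≤ Λ) :
    ∃ C₀ : ℝ, 0 ≤ C₀ ∧ ∀ (f : RSpace d → ℂ) (_ : AEStronglyMeasurable f volume)
      (M : ℝ) (_ : 0 ≤ M) (_ : ∀ᵐ x, ‖f x‖ ≤ M) (_ : ∀ x, f x ≠ 0 → ∀ i, |x i| ≤ R)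
      (b : ℂ) (_ : ((p - 1) * b.re ^ 2 + b.im ^ 2) / 2 ≤ Λ) (ε : ℝ) (_ : 0 < ε) (n : ℕ)
      (_ : ε * 2 ^ n ≤ 1),
      (ε * 2 ^ (n + 1) ≤ 1 →
        ‖lowerLp P hp2 (chaosIntegral hW hK α a φ f b (Set.Iio ((n + 1 : ℕ) * Real.log 2)) ε -
          chaosIntegral hW hK α a φ f b (Set.Iio (n * Real.log 2)) ε)‖ ≤
          C₀ * M * ((2 : ℝ) ^ n) ^ (-(d * (p - 1) / p - Λ))) ∧
      (1 / 2 ≤ ε * 2 ^ n →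
        ‖lowerLp P hp2 (chaosIntegral hW hK α a φ f b Set.univ ε -
          chaosIntegral hW hK α a φ f b (Set.Iio (n * Real.log 2)) ε)‖ ≤
          C₀ * M * ((2 : ℝ) ^ n) ^ (-(d * (p - 1) / p - Λ))) := by
  obtain ⟨C, hC0, hC⟩ := exists_norm_sq_mollifiedLayer_le hd hK (α := α) ha hφ
  have hp1 : 1 ≤ p := one_le_of_fact
  have hlog : 0 < Real.log 2 := Real.log_pos (by norm_num)
  -- The exponential absorbs the bounded part `log 2 + C` of the variance; the main part `n log 2`
  -- produces the factor `(2^n)^Λ`.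
  refine ⟨5 ^ d * (12 * (3 * R) ^ d) * Real.exp (Λ * (Real.log 2 + C)), by positivity,
    fun f hf M hM0 hM hR b hb ε hε n hn => ?_⟩
  have hnR : (0 : ℝ) ≤ n := Nat.cast_nonneg n
  have key : ∀ A : Set ℝ, MeasurableSet A → Set.Iio (n * Real.log 2) ⊆ A →
      (∀ x, ‖mollifiedLayer hK α a φ A ε x‖ ^ 2 ≤ (n + 1) * Real.log 2 + C) →
      ‖lowerLp P hp2 (chaosIntegral hW hK α a φ f b A ε -
          chaosIntegral hW hK α a φ f b (Set.Iio (n * Real.log 2)) ε)‖ ≤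
        5 ^ d * (12 * (3 * R) ^ d) * Real.exp (Λ * (Real.log 2 + C)) * M *
          ((2 : ℝ) ^ n) ^ (-(d * (p - 1) / p - Λ)) := by
    intro A hA hsub hAn
    have hbound : ∀ h : Lp ℝ 2 (spaceTime d), ‖h‖ ^ 2 ≤ (n + 1) * Real.log 2 + C →
        ‖lowerLp P hp2 (hW.wickExpLp b h)‖ ≤
          Real.exp (Λ * (Real.log 2 + C)) * ((2 : ℝ) ^ n) ^ Λ := by
      intro h hh
      rw [hW.norm_lowerLp_wickExpLp, ← two_pow_eq_exp, ← Real.exp_mul, ← Real.exp_add]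
      refine Real.exp_le_exp.2 ?_
      calc _ ≤ Λ * ((n + 1) * Real.log 2 + C) := by gcongr
        _ = _ := by ring
    rw [chaosIntegral, chaosIntegral, ← integral_sub
      (integrable_chaosIntegral hW hd hK ha hφ hf hM hR b hA hε)
      (integrable_chaosIntegral hW hd hK ha hφ hf hM hR b measurableSet_Iio hε)]
    simp_rw [← smul_sub]
    refine (hW.norm_integral_increment_le hp2
      (continuous_mollifiedLayer hd hK ha hφ measurableSet_Iio hε)
      (continuous_mollifiedLayer hd hK ha hφ hA hε) hf hM0 hM hR1 hR b n ?_ ?_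
      (B := Real.exp (Λ * (Real.log 2 + C)) * ((2 : ℝ) ^ n) ^ Λ) ?_ ?_).trans_eq ?_
    · intro x y
      rw [real_inner_comm]
      exact inner_mollifiedLayer_sub_left hd hK ha hφ measurableSet_Iio hA hsub hε x y
    · intro x y hxy
      refine inner_mollifiedLayer_sub_sub hd hK ha hφ measurableSet_Iio hA hsub
        (T := n * Real.log 2) (fun u hu => Set.mem_Ici.2 (not_lt.1 fun h => hu.2 (Set.mem_Iio.2 h))) hε ?_
      rw [Real.exp_neg, two_pow_eq_exp, norm_sub_rev]
      have h2 : (0 : ℝ) < 2 ^ n := by positivity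
      -- The range of the fine field is then at most `2^{-n} + 2ε ≤ 3 · 2^{-n}`, below the
      -- separation `4 · 2^{-n}` of cells of one colour.
      have : ε ≤ ((2 : ℝ) ^ n)⁻¹ := by
        rw [← one_div, le_div_iff₀ h2]
        exact hn
      have : (0 : ℝ) < ((2 : ℝ) ^ n)⁻¹ := by positivity
      linarith
    · intro x
      refine hbound _ (((hC ε hε (n * Real.log 2) (by positivity) x).1
        (by rwa [two_pow_eq_exp])).trans ?_)
      linarith
    · exact fun x => hbound _ (hAn x)
    · have h2 : (0 : ℝ) < 2 ^ n := by positivity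
      have : -(d * (p - 1) / p - Λ) = Λ + -(d * (p - 1) / p) := by ring
      rw [this, Real.rpow_add h2]
      ring
  constructor
  · intro hn1
    refine key _ measurableSet_Iio (Set.Iio_subset_Iio (by push_cast; linarith)) fun x => ?_
    have := (hC ε hε ((n + 1 : ℕ) * Real.log 2) (by positivity) x).1 (by rwa [two_pow_eq_exp])
    push_cast at this ⊢
    exact this
  · intro hn1
    refine key _ MeasurableSet.univ (Set.subset_univ _) fun x => ?_
    have := (hC ε hε (n * Real.log 2) (by positivity) x).2 (Or.inl (by rwa [two_pow_eq_exp]))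
      (by rwa [two_pow_eq_exp])
    linarith

include hd ha hφ hp in
/-- The fine layers contribute exponentially little, uniformly in the mollification. -/
theorem exists_norm_chaosIntegral_univ_sub_le {R : ℕ} (hR1 : 1 ≤ R) {Λ : ℝ} (hΛ0 : 0 ≤ Λ)
    (hΛ : Λ < d * (p - 1) / p) :
    ∃ C₀ ρ : ℝ, 0 ≤ C₀ ∧ 0 ≤ ρ ∧ ρ < 1 ∧ ∀ (f : RSpace d → ℂ) (_ : AEStronglyMeasurable f volume)
      (M : ℝ) (_ : 0 ≤ M) (_ : ∀ᵐ x, ‖f x‖ ≤ M) (_ : ∀ x, f x ≠ 0 → ∀ i, |x i| ≤ R)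
      (b : ℂ) (_ : ((p - 1) * b.re ^ 2 + b.im ^ 2) / 2 ≤ Λ) (ε : ℝ) (_ : 0 < ε) (n : ℕ)
      (_ : ε * 2 ^ n ≤ 1),
        ‖lowerLp P hp2 (chaosIntegral hW hK α a φ f b Set.univ ε -
          chaosIntegral hW hK α a φ f b (Set.Iio (n * Real.log 2)) ε)‖ ≤ C₀ * M * ρ ^ n := by
  obtain ⟨C₀, hC₀, h⟩ := exists_norm_chaosIntegral_sub_le hp2 hW hd hK (α := α) ha hφ hR1 hΛ0
  set κ := d * (p - 1) / p - Λ with hκ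
  have hκ0 : 0 < κ := by linarith
  set ρ : ℝ := (2 : ℝ) ^ (-κ) with hρ
  have hρ0 : 0 < ρ := by positivity
  have hρ1 : ρ < 1 := Real.rpow_lt_one_of_one_lt_of_neg (by norm_num) (by linarith)
  have hpow : ∀ n : ℕ, ((2 : ℝ) ^ n) ^ (-κ) = ρ ^ n := by
    intro n
    rw [hρ, ← Real.rpow_natCast, ← Real.rpow_natCast, ← Real.rpow_mul (by norm_num),
      ← Real.rpow_mul (by norm_num), mul_comm]
  refine ⟨C₀ / (1 - ρ), ρ, div_nonneg hC₀ (by linarith), hρ0.le, hρ1, ?_⟩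
  intro f hf M hM0 hM hR b hb ε hε
  -- Telescoping from the level `n + k` of the mollification down to `n`; the constant `C₀/(1-ρ)` is
  -- a fixed point of the recursion, being the sum of the geometric series.
  have hind : ∀ k n : ℕ, ε * 2 ^ (n + k) ≤ 1 → 1 / 2 ≤ ε * 2 ^ (n + k) →
      ‖lowerLp P hp2 (chaosIntegral hW hK α a φ f b Set.univ ε -
          chaosIntegral hW hK α a φ f b (Set.Iio (n * Real.log 2)) ε)‖ ≤
        C₀ / (1 - ρ) * M * ρ ^ n := by
    have h1ρ : 0 < 1 - ρ := by linarith
    intro k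
    induction k with
    | zero =>
      intro n hn hn'
      refine ((h f hf M hM0 hM hR b hb ε hε n hn).2 hn').trans ?_
      rw [hpow]
      gcongr
      rw [le_div_iff₀ h1ρ]
      nlinarith
    | succ k ih =>
      intro n hn hn'
      have hle : ∀ m : ℕ, m ≤ n + (k + 1) → ε * 2 ^ m ≤ 1 := fun m hm =>
        (mul_le_mul_of_nonneg_left (pow_le_pow_right₀ (by norm_num) hm) hε.le).trans hn
      have e : n + (k + 1) = n + 1 + k := by omega
      rw [e] at hn hn'
      have h1 := ih (n + 1) hn hn'
      have h2 := (h f hf M hM0 hM hR b hb ε hε n (hle n (by omega))).1 (hle (n + 1) (by omega))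
      rw [hpow] at h2
      rw [← sub_add_sub_cancel _ (chaosIntegral hW hK α a φ f b
        (Set.Iio ((n + 1 : ℕ) * Real.log 2)) ε), map_add]
      refine (norm_add_le _ _).trans ((add_le_add h1 h2).trans_eq ?_)
      rw [pow_succ]
      field_simp
      ring
  intro n hn
  -- The last dyadic level `N` not finer than `ε`; below it all remaining scales are added at once.
  obtain ⟨N, hN1, hN2⟩ := exists_nat_pow_near (x := ε⁻¹) (y := 2)
    (by
      rw [one_le_inv₀ hε]
      have : (1 : ℝ) ≤ 2 ^ n := one_le_pow₀ (by norm_num)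
      nlinarith) (by norm_num)
  have hN1' : ε * 2 ^ N ≤ 1 := by
    rwa [le_inv_comm₀ (by positivity) hε, ← one_div, le_div_iff₀ (by positivity)] at hN1
  have hN2' : 1 < ε * 2 ^ (N + 1) := by
    rwa [inv_lt_comm₀ hε (by positivity), ← one_div, div_lt_iff₀ (by positivity)] at hN2
  have hnN : n ≤ N := by
    have : (2 : ℝ) ^ n < 2 ^ (N + 1) := by
      have h1 : ε * 2 ^ n < ε * 2 ^ (N + 1) := by linarith
      exact lt_of_mul_lt_mul_left h1 hε.le
    have := (pow_lt_pow_iff_right₀ (by norm_num : (1 : ℝ) < 2)).1 this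
    omega
  obtain ⟨k, rfl⟩ := Nat.exists_eq_add_of_le hnN
  refine hind k n hN1' ?_
  rw [pow_succ] at hN2'
  linarith

include hd ha hφ hp in
/-- Uniform bound on the moments of the chaos. -/
theorem exists_norm_chaosIntegral_le {R : ℕ} (hR1 : 1 ≤ R) {Λ : ℝ} (hΛ0 : 0 ≤ Λ)
    (hΛ : Λ < d * (p - 1) / p) :
    ∃ C₁ : ℝ, 0 ≤ C₁ ∧ ∀ (f : RSpace d → ℂ) (_ : AEStronglyMeasurable f volume)
      (M : ℝ) (_ : 0 ≤ M) (_ : ∀ᵐ x, ‖f x‖ ≤ M) (_ : ∀ x, f x ≠ 0 → ∀ i, |x i| ≤ R)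
      (b : ℂ) (_ : ((p - 1) * b.re ^ 2 + b.im ^ 2) / 2 ≤ Λ) (ε : ℝ) (_ : 0 < ε),
        ‖lowerLp P hp2 (chaosIntegral hW hK α a φ f b Set.univ ε)‖ ≤ C₁ * M := by
  obtain ⟨C₀, ρ, hC₀, hρ0, hρ1, h⟩ :=
    exists_norm_chaosIntegral_univ_sub_le hp2 hW hd hK (α := α) ha hφ hR1 hΛ0 hΛ
  obtain ⟨C, hC0, hC⟩ := exists_norm_sq_mollifiedLayer_le hd hK (α := α) ha hφ
  set V := volume.real (Metric.closedBall (0 : RSpace d) (Real.sqrt (d * (R : ℝ) ^ 2))) with hV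
  have hV0 : 0 ≤ V := measureReal_nonneg
  have hp1 : 1 ≤ p := one_le_of_fact
  refine ⟨C₀ + V * Real.exp (Λ * C), by positivity, ?_⟩
  intro f hf M hM0 hM hR b hb ε hε
  have key : ∀ A : Set ℝ, MeasurableSet A →
      (∀ x, ‖mollifiedLayer hK α a φ A ε x‖ ^ 2 ≤ 0 + C) →
      ‖lowerLp P hp2 (chaosIntegral hW hK α a φ f b A ε)‖ ≤ V * M * Real.exp (Λ * C) := by
    intro A hA hAn
    rw [chaosIntegral, ← (lowerLp P hp2).integral_comp_comm
      (integrable_chaosIntegral hW hd hK ha hφ hf hM hR b hA hε)]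
    simp_rw [map_smul]
    refine norm_integral_smul_le_of_box hM0 hM hR fun x => ?_
    rw [hW.norm_lowerLp_wickExpLp]
    refine Real.exp_le_exp.2 ?_
    have := hAn x
    rw [zero_add] at this
    gcongr
  -- For `ε ≤ 1`, compare with level `0`, where there are no scales. For `ε ≥ 1` the entire
  -- mollified field has bounded variance.
  rcases le_total ε 1 with hε1 | hε1
  · have h1 := h f hf M hM0 hM hR b hb ε hε 0 (by simpa using hε1)
    have h2 := key (Set.Iio ((0 : ℕ) * Real.log 2)) measurableSet_Iio fun x => by
      have := (hC ε hε 0 le_rfl x).1 (by simpa using hε1)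
      simpa using this
    rw [map_sub] at h1
    have h3 := norm_le_norm_add_norm_sub' (lowerLp P hp2 (chaosIntegral hW hK α a φ f b Set.univ ε))
      (lowerLp P hp2 (chaosIntegral hW hK α a φ f b (Set.Iio ((0 : ℕ) * Real.log 2)) ε))
    rw [pow_zero, mul_one] at h1
    nlinarith
  · have h2 := key Set.univ MeasurableSet.univ fun x =>
      (hC ε hε 0 le_rfl x).2 (Or.inr rfl) (by simp; linarith)
    have : 0 ≤ C₀ * M := by positivity
    linarith

include hd ha hφ in
omit hp [IsProbabilityMeasure P] in
/-- Two mollifications of the coarse layers have nearby Wick exponentials. -/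
theorem IsIsonormal.norm_wickExpLp_mollifiedLayer_sub_sq_le {L : ℝ} (hL0 : 0 ≤ L)
    (hL : ∀ x, |K x - 1| ≤ L * ‖x‖) {T : ℝ} (hT0 : 0 ≤ T) {ε ε' m : ℝ} (hε : 0 < ε) (hε' : 0 < ε')
    (hm : ε ≤ m) (hm' : ε' ≤ m) {b : ℂ} {β : ℝ} (hb : ‖b‖ ≤ β) (x : RSpace d) :
    ‖hW.wickExpLp b (mollifiedLayer hK α a φ (Set.Iio T) ε x) -
      hW.wickExpLp b (mollifiedLayer hK α a φ (Set.Iio T) ε' x)‖ ^ 2 ≤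
      8 * β ^ 2 * (L * (∫ y, |φ y|) ^ 2 * Real.exp T * m) *
        Real.exp (β ^ 2 * (T + 2 * (L * (∫ y, |φ y|) ^ 2 * Real.exp T * m))) := by
  have a1 := abs_inner_mollifiedLayer_Iio_sub_le hd hK (α := α) ha hφ hL0 hL T hε hε x
  have a2 := abs_inner_mollifiedLayer_Iio_sub_le hd hK (α := α) ha hφ hL0 hL T hε hε' x
  have a3 := abs_inner_mollifiedLayer_Iio_sub_le hd hK (α := α) ha hφ hL0 hL T hε' hε' x
  have hIT := setIntegral_scaleRate_le (α := α) ha hT0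
  rw [hW.norm_wickExpLp_sub_sq]
  rw [real_inner_self_eq_norm_sq] at a1 a3
  set I := ∫ u in Set.Ioi 0 ∩ Set.Iio T, scaleRate α a u
  set c := L * (∫ y, |φ y|) ^ 2 with hc
  have hc0 : 0 ≤ c := by positivity
  have hle : ∀ r ≤ 2 * m, c * (r * Real.exp T) ≤ 2 * (c * Real.exp T * m) := fun r hr => by
    calc c * (r * Real.exp T) ≤ c * (2 * m * Real.exp T) := by gcongr
      _ = _ := by ring
  have b1 := (abs_le.1 (a1.trans (hle _ (by linarith)))).2
  have b2 := (abs_le.1 (a2.trans (hle _ (by linarith)))).1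
  have b3 := (abs_le.1 (a3.trans (hle _ (by linarith)))).2
  have hm0 : 0 ≤ m := hε.le.trans hm
  have hbsq : ‖b‖ ^ 2 ≤ β ^ 2 := pow_le_pow_left₀ (norm_nonneg _) hb 2
  refine (exp_sub_two_mul_exp_add_exp_le (sq_nonneg ‖b‖) (sub_le_iff_le_add'.1 b1)
    (sub_le_iff_le_add'.2 (by linarith)) (sub_le_iff_le_add'.1 b3)).trans ?_
  calc 4 * ‖b‖ ^ 2 * (2 * (c * Real.exp T * m)) *
        Real.exp (‖b‖ ^ 2 * (I + 2 * (c * Real.exp T * m)))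
      ≤ 4 * β ^ 2 * (2 * (c * Real.exp T * m)) *
        Real.exp (β ^ 2 * (T + 2 * (c * Real.exp T * m))) := by
        refine mul_le_mul (by gcongr) (Real.exp_le_exp.2 ?_) (Real.exp_pos _).le (by positivity)
        calc _ ≤ ‖b‖ ^ 2 * (T + 2 * (c * Real.exp T * m)) := by gcongr
          _ ≤ _ := by gcongr
    _ = _ := by ring

include hd ha hφ hp in
/-- The chaos is Cauchy as the mollification is removed. -/
theorem exists_norm_chaosIntegral_sub_chaosIntegral_le {R : ℕ} (hR1 : 1 ≤ R) {Λ : ℝ} (hΛ0 : 0 ≤ Λ)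
    (hΛ : Λ < d * (p - 1) / p) (β : ℝ) {δ : ℝ} (hδ : 0 < δ) :
    ∃ ε₀ : ℝ, 0 < ε₀ ∧ ∀ (f : RSpace d → ℂ) (_ : AEStronglyMeasurable f volume)
      (M : ℝ) (_ : 0 ≤ M) (_ : ∀ᵐ x, ‖f x‖ ≤ M) (_ : ∀ x, f x ≠ 0 → ∀ i, |x i| ≤ R)
      (b : ℂ) (_ : ‖b‖ ≤ β) (_ : ((p - 1) * b.re ^ 2 + b.im ^ 2) / 2 ≤ Λ)
      (ε ε' : ℝ) (_ : 0 < ε) (_ : 0 < ε') (_ : ε < ε₀) (_ : ε' < ε₀),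
        ‖lowerLp P hp2 (chaosIntegral hW hK α a φ f b Set.univ ε -
          chaosIntegral hW hK α a φ f b Set.univ ε')‖ ≤ δ * M := by
  obtain ⟨C₀, ρ, hC₀, hρ0, hρ1, h⟩ :=
    exists_norm_chaosIntegral_univ_sub_le hp2 hW hd hK (α := α) ha hφ hR1 hΛ0 hΛ
  obtain ⟨L, hL0, hL⟩ := hK.exists_lipschitz_zero
  set V := volume.real (Metric.closedBall (0 : RSpace d) (Real.sqrt (d * (R : ℝ) ^ 2))) with hV
  have hV0 : 0 ≤ V := measureReal_nonneg
  -- The level is fixed before `ε₀`: the coarse estimate deteriorates with `n` but vanishes with `ε`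
  -- at fixed `n`.
  obtain ⟨n, hn⟩ : ∃ n : ℕ, C₀ * ρ ^ n < δ / 3 := by
    have ht : Tendsto (fun n : ℕ => C₀ * ρ ^ n) atTop (𝓝 (C₀ * 0)) :=
      (tendsto_pow_atTop_nhds_zero_of_lt_one hρ0 hρ1).const_mul C₀
    rw [mul_zero] at ht
    exact (ht.eventually (gt_mem_nhds (by positivity : (0 : ℝ) < δ / 3))).exists
  set T : ℝ := n * Real.log 2 with hT
  have hT0 : 0 ≤ T := mul_nonneg (Nat.cast_nonneg n) (Real.log_nonneg (by norm_num))
  set c : ℝ := L * (∫ y, |φ y|) ^ 2 * 2 ^ n with hc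
  have hc0 : 0 ≤ c := by positivity
  set D : ℝ := 4 * β ^ 2 * c * Real.exp (β ^ 2 * (T + 2 * c)) with hD
  have hD0 : 0 ≤ D := by positivity
  set I := ∫ u in Set.Ioi 0 ∩ Set.Iio T, scaleRate α a u with hI
  have hIT : I ≤ T := setIntegral_scaleRate_le (α := α) ha hT0
  obtain ⟨τ, hτ0, hτ⟩ : ∃ τ : ℝ, 0 < τ ∧ D * (2 * τ) ≤ (δ / (3 * (V + 1))) ^ 2 := by
    refine ⟨(δ / (3 * (V + 1))) ^ 2 / (2 * (D + 1)), by positivity, ?_⟩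
    have hx : 0 < (δ / (3 * (V + 1))) ^ 2 := by positivity
    rw [mul_div_assoc', mul_div_assoc', div_le_iff₀ (by positivity)]
    nlinarith
  refine ⟨min (min τ 1) ((2 : ℝ) ^ n)⁻¹, by positivity, ?_⟩
  intro f hf M hM0 hM hR b hbβ hb ε ε' hε hε' hεlt hεlt'
  have hτε : ε < τ := hεlt.trans_le ((min_le_left _ _).trans (min_le_left _ _))
  have hτε' : ε' < τ := hεlt'.trans_le ((min_le_left _ _).trans (min_le_left _ _))
  have h1ε : ε < 1 := hεlt.trans_le ((min_le_left _ _).trans (min_le_right _ _))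
  have h1ε' : ε' < 1 := hεlt'.trans_le ((min_le_left _ _).trans (min_le_right _ _))
  have hscale : ∀ e : ℝ, e < ((2 : ℝ) ^ n)⁻¹ → e * 2 ^ n ≤ 1 := by
    intro e he
    rw [← one_div, lt_div_iff₀ (by positivity)] at he
    exact he.le
  have t1 := h f hf M hM0 hM hR b hb ε hε n (hscale ε (hεlt.trans_le (min_le_right _ _)))
  have t2 := h f hf M hM0 hM hR b hb ε' hε' n (hscale ε' (hεlt'.trans_le (min_le_right _ _)))
  rw [← hT] at t1 t2
  have hpt : ∀ x, ‖hW.wickExpLp b (mollifiedLayer hK α a φ (Set.Iio T) ε x) -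
      hW.wickExpLp b (mollifiedLayer hK α a φ (Set.Iio T) ε' x)‖ ≤ δ / (3 * (V + 1)) := by
    intro x
    refine le_of_sq_le_sq ?_ (by positivity)
    -- In `min τ 1`, the `τ` makes the prefactor small and the `1` keeps the exponential bounded.
    refine (hW.norm_wickExpLp_mollifiedLayer_sub_sq_le hd hK ha hφ hL0 hL hT0 hε hε'
      (m := min τ 1) (le_min hτε.le h1ε.le) (le_min hτε'.le h1ε'.le) hbβ x).trans ?_
    refine le_trans ?_ hτ
    rw [hD, hc, hT, two_pow_eq_exp, ← hT, ← hc]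
    have hm0 : 0 ≤ min τ 1 := le_min hτ0.le zero_le_one
    calc 8 * β ^ 2 * (c * min τ 1) * Real.exp (β ^ 2 * (T + 2 * (c * min τ 1)))
        ≤ 8 * β ^ 2 * (c * τ) * Real.exp (β ^ 2 * (T + 2 * (c * 1))) := by
          gcongr
          · exact min_le_left _ _
          · exact min_le_right _ _
      _ = _ := by ring_nf
  have t3 : ‖lowerLp P hp2 (chaosIntegral hW hK α a φ f b (Set.Iio T) ε -
      chaosIntegral hW hK α a φ f b (Set.Iio T) ε')‖ ≤ δ / 3 * M := by
    refine (norm_lowerLp_le hp2 _).trans ?_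
    rw [chaosIntegral, chaosIntegral, ← integral_sub
      (integrable_chaosIntegral hW hd hK ha hφ hf hM hR b measurableSet_Iio hε)
      (integrable_chaosIntegral hW hd hK ha hφ hf hM hR b measurableSet_Iio hε')]
    simp_rw [← smul_sub]
    refine (norm_integral_smul_le_of_box hM0 hM hR hpt).trans ?_
    rw [← hV]
    calc V * M * (δ / (3 * (V + 1))) = δ / 3 * M * (V / (V + 1)) := by field_simp
      _ ≤ δ / 3 * M * 1 := by
          gcongr
          rw [div_le_one (by positivity)]
          linarith
      _ = _ := mul_one _
  have t5 : C₀ * M * ρ ^ n ≤ δ / 3 * M := by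
    calc _ = C₀ * ρ ^ n * M := by ring
      _ ≤ _ := by gcongr
  exact (norm_map_sub_le_of_norm_map_sub_le _ (t1.trans t5) t3 (t2.trans t5)).trans_eq (by ring)

end Chaos

/-! ### Wick powers by Cauchy's formula. -/

section WickPower

/-- The derivatives of `β ↦ e^{βz - β²σ²/2}` are Wick powers times the exponential. -/
theorem iteratedDeriv_cexp_quadratic {σ : ℝ} (hσ : σ ≠ 0) (z : ℝ) (k : ℕ) :
    iteratedDeriv k (fun β : ℂ => Complex.exp (β * z - β ^ 2 / 2 * (σ : ℂ) ^ 2)) = fun β =>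
      (σ : ℂ) ^ k * Polynomial.aeval ((z - β * (σ : ℂ) ^ 2) / σ) (Polynomial.hermite k) *
        Complex.exp (β * z - β ^ 2 / 2 * (σ : ℂ) ^ 2) := by
  have hσ' : (σ : ℂ) ≠ 0 := by exact_mod_cast hσ
  induction k with
  | zero => ext β; simp
  | succ k ih =>
    ext β
    rw [iteratedDeriv_succ, ih]
    have h1 : HasDerivAt (fun β : ℂ => (z - β * (σ : ℂ) ^ 2) / σ) (-(σ : ℂ)) β := by
      have := (((hasDerivAt_id β).mul_const ((σ : ℂ) ^ 2)).const_sub (z : ℂ)).div_const (σ : ℂ)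
      refine this.congr_deriv ?_
      field_simp
    have h2 : HasDerivAt (fun β : ℂ => Complex.exp (β * z - β ^ 2 / 2 * (σ : ℂ) ^ 2))
        (Complex.exp (β * z - β ^ 2 / 2 * (σ : ℂ) ^ 2) * (z - β * (σ : ℂ) ^ 2)) β := by
      have := (((hasDerivAt_id β).mul_const (z : ℂ)).sub
        ((((hasDerivAt_id β).pow 2).div_const 2).mul_const ((σ : ℂ) ^ 2))).cexp
      refine this.congr_deriv ?_
      simp
    have h3 := ((Polynomial.hermite k).hasDerivAt_aeval ((z - β * (σ : ℂ) ^ 2) / σ)).comp β h1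
    refine (show deriv _ _ = _ from ((h3.const_mul ((σ : ℂ) ^ k)).mul h2).deriv).trans ?_
    rw [Polynomial.hermite_succ]
    simp only [map_sub, map_mul, Polynomial.aeval_X, Function.comp_apply]
    field_simp
    ring

/-- Wick powers as contour integrals of Wick exponentials. -/
theorem wickPower_eq_integral {z v : ℝ} (hv : 0 ≤ v) (hz : v = 0 → z = 0) (γ : ℝ) {r : ℝ}
    (hr : 0 < r) (k : ℕ) :
    ((Real.sqrt v ^ k * Polynomial.aeval ((z - γ * v) / Real.sqrt v) (Polynomial.hermite k) *
      Real.exp (γ * z - γ ^ 2 / 2 * v) : ℝ) : ℂ) =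
    ((k.factorial / (2 * Real.pi * r ^ k) : ℝ) : ℂ) * ∫ θ in (0 : ℝ)..2 * Real.pi,
      Complex.exp (-(k * θ * Complex.I)) *
        Complex.exp (circleMap γ r θ * z - circleMap γ r θ ^ 2 / 2 * v) := by
  have hd : Differentiable ℂ fun β : ℂ => Complex.exp (β * z - β ^ 2 / 2 * v) := by fun_prop
  have hcauchy := hd.diffContOnCl.circleIntegral_one_div_sub_center_pow_smul (c := γ) (n := k) hr
  have hL : ((Real.sqrt v ^ k * Polynomial.aeval ((z - γ * v) / Real.sqrt v) (Polynomial.hermite k) *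
      Real.exp (γ * z - γ ^ 2 / 2 * v) : ℝ) : ℂ) =
      iteratedDeriv k (fun β : ℂ => Complex.exp (β * z - β ^ 2 / 2 * v)) γ := by
    -- For a degenerate variable the Wick exponential is identically `1`, and the convention `0 / 0
    -- = 0` agrees with its derivatives: `1` for `k = 0` and `0` otherwise.
    rcases hv.eq_or_lt with rfl | hv
    · rw [hz rfl]
      rcases k with _ | k
      · simp
      · simp [iteratedDeriv_succ']
    · have h := congrFun (iteratedDeriv_cexp_quadratic (Real.sqrt_pos.2 hv).ne' z k) γ
      have hs : ((Real.sqrt v : ℝ) : ℂ) ^ 2 = v := by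
        rw [← Complex.ofReal_pow, Real.sq_sqrt hv.le]
      simp only [hs] at h
      rw [h]
      push_cast
      congr 2
      rw [← Complex.ofReal_mul, ← Complex.ofReal_sub, ← Complex.ofReal_div,
        ← Complex.coe_algebraMap, Polynomial.aeval_algebraMap_apply]
  refine smul_right_injective ℂ (r := (2 * Real.pi * Complex.I / k.factorial : ℂ)) ?_ ?_
  rotate_left
  · beta_reduce
    rw [hL, ← hcauchy, circleIntegral]
    have hr' : (r : ℂ) ≠ 0 := by exact_mod_cast hr.ne'
    have hk : (k.factorial : ℂ) ≠ 0 := by exact_mod_cast k.factorial_ne_zero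
    have hpi : (Real.pi : ℂ) ≠ 0 := by exact_mod_cast Real.pi_ne_zero
    rw [smul_eq_mul, ← mul_assoc, ← intervalIntegral.integral_const_mul]
    refine intervalIntegral.integral_congr fun θ _ => ?_
    have he : Complex.exp (θ * Complex.I) ≠ 0 := Complex.exp_ne_zero _
    have h1 : Complex.exp (-(k * θ * Complex.I)) = (Complex.exp (θ * Complex.I) ^ k)⁻¹ := by
      rw [← Complex.exp_nat_mul, ← Complex.exp_neg]
      ring_nf
    simp only [deriv_circleMap, circleMap_sub_center, smul_eq_mul, h1]
    simp only [circleMap, zero_add]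
    push_cast
    field_simp
    ring
  · have hk : (k.factorial : ℂ) ≠ 0 := by exact_mod_cast k.factorial_ne_zero
    have hpi : (Real.pi : ℂ) ≠ 0 := by exact_mod_cast Real.pi_ne_zero
    simp [hk, hpi]

end WickPower

/-- A Bochner integral in `L²` is given by the pointwise integral of a measurable version. -/
theorem integral_Lp_ae_eq {T Ω : Type*} [MeasurableSpace T] [MeasurableSpace Ω] {μ : Measure T}
    [SFinite μ] {P : Measure Ω} [IsProbabilityMeasure P] {F : T → Lp ℂ 2 P} (hF : Integrable F μ)
    {G : T → Ω → ℂ} (hG : AEStronglyMeasurable (Function.uncurry G) (μ.prod P))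
    (hFG : ∀ t, F t =ᵐ[P] G t) :
    (∀ᵐ ω ∂P, Integrable (fun t => G t ω) μ) ∧ (∫ t, F t ∂μ : Lp ℂ 2 P) =ᵐ[P] fun ω => ∫ t, G t ω ∂μ := by
  have hint : Integrable (Function.uncurry G) (μ.prod P) := by
    rw [integrable_prod_iff hG]
    refine ⟨Eventually.of_forall fun t => ((Lp.memLp (F t)).integrable (by norm_num)).congr (hFG t), ?_⟩
    refine hF.norm.mono' hG.norm.integral_prod_right' (Eventually.of_forall fun t => ?_)
    rw [Real.norm_of_nonneg (integral_nonneg fun ω => norm_nonneg _)]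
    have h1 : ∫ ω, ‖Function.uncurry G (t, ω)‖ ∂P = ∫ ω, ‖F t ω‖ ∂P := by
      refine integral_congr_ae ?_
      filter_upwards [hFG t] with ω hω
      rw [hω]; rfl
    rw [h1, integral_norm_eq_lintegral_enorm (Lp.aestronglyMeasurable _), ← eLpNorm_one_eq_lintegral_enorm,
      Lp.norm_def]
    exact ENNReal.toReal_mono (Lp.memLp _).eLpNorm_ne_top
      (eLpNorm_le_eLpNorm_of_exponent_le (by norm_num) (Lp.aestronglyMeasurable _))
  refine ⟨hint.prod_left_ae, ?_⟩
  -- Compare integrals over every measurable set: on the `L²` side this is an inner product with an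
  -- indicator, which commutes with the Bochner integral; on the other side it is Fubini.
  refine ((Lp.memLp _).integrable (by norm_num)).ae_eq_of_forall_setIntegral_eq _ _
    hint.integral_prod_right fun s hs _ => ?_
  have hset : ∀ f : Lp ℂ 2 P, ∫ ω in s, f ω ∂P =
      inner ℂ (indicatorConstLp 2 hs (measure_ne_top P s) (1 : ℂ)) f := fun f =>
    (L2.inner_indicatorConstLp_one hs (measure_ne_top P s) f).symm
  rw [hset, ← integral_inner hF]
  simp_rw [← hset]
  rw [integral_integral_swap (f := fun ω t => G t ω)]
  · refine integral_congr_ae (Eventually.of_forall fun t => ?_)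
    exact setIntegral_congr_ae hs ((hFG t).mono fun ω h _ => h)
  · have := hint.swap.restrict (s := s ×ˢ Set.univ)
    rwa [← Measure.prod_restrict, Measure.restrict_univ] at this

/-! ### Wick integrals as contour averages of the chaos. -/

section ChaosDerivative

variable {d : ℕ} {Ω : Type*} [MeasurableSpace Ω] {P : Measure Ω}
  {W : Lp ℝ 2 (spaceTime d) → Ω → ℝ} (hW : IsIsonormal P W)
  {K : RSpace d → ℝ} {φ : RSpace d → ℝ}
  (hd : 0 < d) (hK : IsSeedCovariance K) {α : ℝ≥0∞} {a : ℝ} (ha : a ∈ Set.Icc (0 : ℝ) 1)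
  (hφ : IsMollifier φ)

theorem IsIsonormal.norm_wickExpLp_sq {H : Type*} [NormedAddCommGroup H] [InnerProductSpace ℝ H]
    {W : H → Ω → ℝ} (hW : IsIsonormal P W) (b : ℂ) (h : H) :
    ‖hW.wickExpLp b h‖ ^ 2 = Real.exp (‖b‖ ^ 2 * ‖h‖ ^ 2) := by
  have h1 := congrArg norm (hW.inner_wickExpLp b b h h)
  rw [inner_self_eq_norm_sq_to_K, mul_comm ((starRingEnd ℂ) b), Complex.mul_conj,
    Complex.normSq_eq_norm_sq, ← Complex.ofReal_mul, ← Complex.ofReal_exp, Complex.norm_real,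
    Real.norm_of_nonneg (Real.exp_pos _).le, real_inner_self_eq_norm_sq] at h1
  rw [← h1]
  simp

theorem IsIsonormal.ae_eq_zero {H : Type*} [NormedAddCommGroup H] [InnerProductSpace ℝ H]
    {W : H → Ω → ℝ} (hW : IsIsonormal P W) {h : H} (hh : ‖h‖ = 0) : W h =ᵐ[P] 0 := by
  have h1 := hW.covariance h h
  rw [real_inner_self_eq_norm_sq, hh, zero_pow two_ne_zero,
    integral_eq_zero_iff_of_nonneg (fun ω => mul_self_nonneg _)] at h1
  · filter_upwards [h1] with ω hω
    exact mul_self_eq_zero.1 hω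
  · exact (hW.memLp_two h).integrable_mul (hW.memLp_two h)

/-- The Wick powers tested against `f`, as contour integrals of Wick exponentials tested
against `f`. -/
noncomputable def chaosDerivative (hW : IsIsonormal P W) (hK : IsSeedCovariance K) (α : ℝ≥0∞)
    (a : ℝ) (φ : RSpace d → ℝ) (f : RSpace d → ℂ) (γ r : ℝ) (k : ℕ) (ε : ℝ) : Lp ℂ 2 P :=
  ((k.factorial / (2 * Real.pi * r ^ k) : ℝ) : ℂ) • ∫ θ in Set.Ioc 0 (2 * Real.pi),
    Complex.exp (-(k * θ * Complex.I)) •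
      chaosIntegral hW hK α a φ f (circleMap γ r θ) Set.univ ε

theorem norm_circleMap_ofReal_le (γ : ℝ) {r : ℝ} (hr : 0 ≤ r) (θ : ℝ) :
    ‖circleMap γ r θ‖ ≤ |γ| + r := by
  rw [circleMap]
  refine (norm_add_le _ _).trans ?_
  simp [abs_of_nonneg hr]

theorem norm_exp_neg_mul_I (k : ℕ) (θ : ℝ) : ‖Complex.exp (-(k * θ * Complex.I))‖ = 1 := by
  have : -((k : ℂ) * θ * Complex.I) = ((-(k * θ) : ℝ) : ℂ) * Complex.I := by push_cast; ring
  rw [this, Complex.norm_exp_ofReal_mul_I]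

theorem continuous_exp_neg_mul_I (k : ℕ) :
    Continuous fun θ : ℝ => Complex.exp (-(k * θ * Complex.I)) := by
  fun_prop

-- Integrability on space times circle, for exchanging the two integrals in `L²`. The norm of the
-- Wick exponential is bounded because the variance is stationary and the circle is bounded.
include hd ha hφ in
theorem integrable_prod_chaos {f : RSpace d → ℂ} (hf : AEStronglyMeasurable f volume) {M : ℝ}
    (hM : ∀ᵐ x, ‖f x‖ ≤ M) {R : ℝ} (hR : ∀ x, f x ≠ 0 → ∀ i, |x i| ≤ R) (γ : ℝ) {r : ℝ}
    (hr : 0 ≤ r) (k : ℕ) {ε : ℝ} (hε : 0 < ε) :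
    Integrable (fun q : RSpace d × ℝ => Complex.exp (-(k * q.2 * Complex.I)) • f q.1 •
      hW.wickExpLp (circleMap γ r q.2) (mollifiedLayer hK α a φ Set.univ ε q.1))
      (volume.prod (volume.restrict (Set.Ioc 0 (2 * Real.pi)))) := by
  have hfi : Integrable f := by
    have := integrable_smul_of_continuous hf hM hR (continuous_const (y := (1 : ℂ)))
    simpa using this
  set B := Real.sqrt (Real.exp ((|γ| + r) ^ 2 * ‖mollifiedLayer hK α a φ Set.univ ε 0‖ ^ 2)) with hB
  have hint : Integrable (fun q : RSpace d × ℝ => ‖f q.1‖ * B)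
      (volume.prod (volume.restrict (Set.Ioc 0 (2 * Real.pi)))) :=
    hfi.norm.mul_prod (integrable_const B)
  refine hint.mono' ?_ (Eventually.of_forall fun q => ?_)
  · refine AEStronglyMeasurable.smul
      ((continuous_exp_neg_mul_I k).comp continuous_snd).aestronglyMeasurable
      (hf.comp_fst.smul (Continuous.aestronglyMeasurable ?_))
    exact hW.continuous_wickExpLp.comp (((continuous_circleMap _ _).comp continuous_snd).prodMk
      ((continuous_mollifiedLayer hd hK ha hφ MeasurableSet.univ hε).comp continuous_fst))
  · rw [norm_smul, norm_smul, norm_exp_neg_mul_I, one_mul]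
    gcongr
    refine Real.le_sqrt_of_sq_le ?_
    rw [hW.norm_wickExpLp_sq, norm_mollifiedLayer hd hK ha hφ MeasurableSet.univ hε]
    have := norm_circleMap_ofReal_le γ hr q.2
    gcongr

/-- The Wick power of a variable of the process as a contour integral in `L²`. -/
theorem IsIsonormal.contourIntegral_wickExpLp_ae_eq {H : Type*} [NormedAddCommGroup H]
    [InnerProductSpace ℝ H] {W : H → Ω → ℝ} (hW : IsIsonormal P W) (h : H) {Y : Ω → ℝ}
    (hY : Y =ᵐ[P] W h) (γ : ℝ) {r : ℝ} (hr : 0 < r) (k : ℕ) :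
    (((k.factorial / (2 * Real.pi * r ^ k) : ℝ) : ℂ) • ∫ θ in Set.Ioc 0 (2 * Real.pi),
      Complex.exp (-(k * θ * Complex.I)) • hW.wickExpLp (circleMap γ r θ) h : Lp ℂ 2 P) =ᵐ[P]
      fun ω => (wick P Y k γ ω : ℂ) := by
  have := hW.isProbabilityMeasure
  have hpi : (0 : ℝ) ≤ 2 * Real.pi := by positivity
  have hvar : Var[Y; P] = ‖h‖ ^ 2 := by rw [variance_congr hY, hW.variance_eq]
  have hcont : Continuous fun θ : ℝ => Complex.exp (-(k * θ * Complex.I)) •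
      hW.wickExpLp (circleMap γ r θ) h :=
    (continuous_exp_neg_mul_I k).smul (hW.continuous_wickExpLp.comp
      ((continuous_circleMap _ _).prodMk continuous_const))
  have h1 := (integral_Lp_ae_eq (P := P) (F := fun θ : ℝ => Complex.exp (-(k * θ * Complex.I)) •
      hW.wickExpLp (circleMap γ r θ) h) (μ := volume.restrict (Set.Ioc 0 (2 * Real.pi)))
    (G := fun θ ω => Complex.exp (-(k * θ * Complex.I)) * wickExp W (circleMap γ r θ) h ω)
    hcont.integrableOn_Ioc ?_ ?_).2
  · have h0 : ∀ᵐ ω ∂P, ‖h‖ ^ 2 = 0 → W h ω = 0 := by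
      by_cases hh : ‖h‖ = 0
      · exact (hW.ae_eq_zero hh).mono fun ω hω _ => hω
      · exact Eventually.of_forall fun ω hω => absurd (pow_eq_zero_iff two_ne_zero |>.1 hω) hh
    filter_upwards [Lp.coeFn_smul ((k.factorial / (2 * Real.pi * r ^ k) : ℝ) : ℂ)
      (∫ θ in Set.Ioc 0 (2 * Real.pi), Complex.exp (-(k * θ * Complex.I)) •
      hW.wickExpLp (circleMap γ r θ) h : Lp ℂ 2 P), h1, hY, h0] with ω e1 e2 e3 e4
    rw [e1, Pi.smul_apply, e2, wick, hvar, e3,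
      wickPower_eq_integral (sq_nonneg ‖h‖) e4 γ hr k, smul_eq_mul,
      intervalIntegral.integral_of_le hpi]
    simp only [wickExp, Complex.ofReal_pow]
  · have := hW.measurable h
    refine Measurable.aestronglyMeasurable ?_
    unfold Function.uncurry wickExp circleMap
    fun_prop
  · intro θ
    filter_upwards [Lp.coeFn_smul (Complex.exp (-(k * θ * Complex.I)))
      (hW.wickExpLp (circleMap γ r θ) h), hW.coeFn_wickExpLp (circleMap γ r θ) h] with ω e1 e2
    rw [e1, Pi.smul_apply, e2, smul_eq_mul]

-- Exchange the contour and space integrals: the contour integral at a fixed point is the Wick power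
-- there. The same argument yields almost sure absolute convergence of the space integral and shows
-- that any jointly measurable version may be used.
include hd ha hφ in
theorem chaosDerivative_ae_eq {f : RSpace d → ℝ} (hf : Measurable f) {M : ℝ}
    (hM : ∀ᵐ x, ‖(f x : ℂ)‖ ≤ M) {R : ℝ} (hR : ∀ x, (f x : ℂ) ≠ 0 → ∀ i, |x i| ≤ R) (γ : ℝ) {r : ℝ}
    (hr : 0 < r) (k : ℕ) {ε : ℝ} (hε : 0 < ε) {Y : RSpace d → Ω → ℝ}
    (hY : ∀ x, Y x =ᵐ[P] W (mollifiedLayer hK α a φ Set.univ ε x))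
    (hYm : AEMeasurable (fun p : RSpace d × Ω => Y p.1 p.2) (volume.prod P)) :
    (∀ᵐ ω ∂P, Integrable fun x => f x * wick P (Y x) k γ ω) ∧
      chaosDerivative hW hK α a φ (fun x => (f x : ℂ)) γ r k ε =ᵐ[P]
        fun ω => ((∫ x, f x * wick P (Y x) k γ ω : ℝ) : ℂ) := by
  have := hW.isProbabilityMeasure
  have hfm : AEStronglyMeasurable (fun x => (f x : ℂ)) (volume : Measure (RSpace d)) :=
    (Complex.measurable_ofReal.comp hf).aestronglyMeasurable
  have hprod := integrable_prod_chaos hW hd hK (α := α) ha hφ hfm hM hR γ hr.le k hε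
  set c : ℂ := ((k.factorial / (2 * Real.pi * r ^ k) : ℝ) : ℂ) with hc
  set h := mollifiedLayer hK α a φ Set.univ ε with hh
  set w : RSpace d → Lp ℂ 2 P := fun x => c • ∫ θ in Set.Ioc 0 (2 * Real.pi),
      Complex.exp (-(k * θ * Complex.I)) • hW.wickExpLp (circleMap γ r θ) (h x) with hw
  have hww : ∀ x, w x =ᵐ[P] fun ω => (wick P (Y x) k γ ω : ℂ) := fun x =>
    hW.contourIntegral_wickExpLp_ae_eq (h x) (hY x) γ hr k
  have hfw : (fun x => (f x : ℂ) • w x) = fun x => c • ∫ θ in Set.Ioc 0 (2 * Real.pi),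
      Complex.exp (-(k * θ * Complex.I)) • (f x : ℂ) • hW.wickExpLp (circleMap γ r θ) (h x) := by
    ext1 x
    rw [hw, smul_comm, ← integral_smul]
    simp_rw [smul_comm (f x : ℂ)]
  have hint : Integrable fun x => (f x : ℂ) • w x := by
    rw [hfw]
    exact hprod.integral_prod_left.smul c
  have hvar : ∀ x, Var[Y x; P] = ‖h 0‖ ^ 2 := fun x => by
    rw [variance_congr (hY x), hW.variance_eq, hh,
      norm_mollifiedLayer hd hK ha hφ MeasurableSet.univ hε]
  have hmain := integral_Lp_ae_eq hint (G := fun x ω => ((f x * wick P (Y x) k γ ω : ℝ) : ℂ)) ?_ ?_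
  · refine ⟨?_, ?_⟩
    · filter_upwards [hmain.1] with ω hω
      simpa using hω.re
    · have e : chaosDerivative hW hK α a φ (fun x => (f x : ℂ)) γ r k ε = ∫ x, (f x : ℂ) • w x := by
        rw [chaosDerivative, hfw, integral_smul, integral_integral_swap hprod]
        simp_rw [integral_smul]
        rfl
      rw [e]
      filter_upwards [hmain.2] with ω hω
      rw [hω]
      exact integral_ofReal (𝕜 := ℂ)
  · refine AEMeasurable.aestronglyMeasurable ?_
    unfold Function.uncurry wick
    simp_rw [hvar]
    refine Complex.measurable_ofReal.comp_aemeasurable ((hf.comp measurable_fst).aemeasurable.mul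
      (AEMeasurable.mul (AEMeasurable.const_mul ?_ _) ?_))
    · exact (Polynomial.continuous_aeval _).measurable.comp_aemeasurable
        ((hYm.sub_const _).div_const _)
    · exact Real.measurable_exp.comp_aemeasurable ((hYm.const_mul _).sub_const _)
  · intro x
    filter_upwards [Lp.coeFn_smul (f x : ℂ) (w x), hww x] with ω e1 e2
    rw [e1, Pi.smul_apply, e2, smul_eq_mul, Complex.ofReal_mul]

variable [IsProbabilityMeasure P] {p : ℝ} [hp : Fact (1 ≤ ENNReal.ofReal p)] (hp2 : p ≤ 2)

theorem norm_contourIntegral_le {V : Type*} [NormedAddCommGroup V] [NormedSpace ℂ V]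
    {r : ℝ} (hr : 0 < r) (k : ℕ) {F : ℝ → V} {B : ℝ} (hB : ∀ θ, ‖F θ‖ ≤ B) :
    ‖((k.factorial / (2 * Real.pi * r ^ k) : ℝ) : ℂ) • ∫ θ in Set.Ioc 0 (2 * Real.pi),
      Complex.exp (-(k * θ * Complex.I)) • F θ‖ ≤ B * k.factorial * r⁻¹ ^ k := by
  have hpi := Real.pi_pos
  rw [norm_smul, Complex.norm_real, Real.norm_of_nonneg (by positivity)]
  have h1 := norm_setIntegral_le_of_norm_le_const (μ := volume) (s := Set.Ioc 0 (2 * Real.pi))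
    (f := fun θ : ℝ => Complex.exp (-(k * θ * Complex.I)) • F θ) (C := B)
    measure_Ioc_lt_top
    (fun θ _ => by rw [norm_smul, norm_exp_neg_mul_I, one_mul]; exact hB θ)
  rw [Real.volume_real_Ioc_of_le (by positivity), sub_zero] at h1
  refine (mul_le_mul_of_nonneg_left h1 (by positivity)).trans_eq ?_
  rw [inv_pow]
  field_simp

include hd ha hφ in
omit [IsProbabilityMeasure P] in
theorem integrableOn_chaosIntegral {f : RSpace d → ℂ} (hf : AEStronglyMeasurable f volume) {M : ℝ}
    (hM : ∀ᵐ x, ‖f x‖ ≤ M) {R : ℝ} (hR : ∀ x, f x ≠ 0 → ∀ i, |x i| ≤ R) (γ : ℝ) {r : ℝ}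
    (hr : 0 ≤ r) (k : ℕ) {ε : ℝ} (hε : 0 < ε) :
    IntegrableOn (fun θ : ℝ => Complex.exp (-(k * θ * Complex.I)) •
      chaosIntegral hW hK α a φ f (circleMap γ r θ) Set.univ ε) (Set.Ioc 0 (2 * Real.pi)) := by
  have := (integrable_prod_chaos hW hd hK (α := α) ha hφ hf hM hR γ hr k hε).integral_prod_right
  simp_rw [integral_smul] at this
  exact this

include hd ha hφ in
theorem norm_lowerLp_chaosDerivative_le {f : RSpace d → ℂ} (hf : AEStronglyMeasurable f volume)
    {M : ℝ} (hM : ∀ᵐ x, ‖f x‖ ≤ M) {R : ℝ} (hR : ∀ x, f x ≠ 0 → ∀ i, |x i| ≤ R) (γ : ℝ) {r : ℝ}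
    (hr : 0 < r) (k : ℕ) {ε : ℝ} (hε : 0 < ε) {B : ℝ}
    (hB : ∀ θ, ‖lowerLp P hp2 (chaosIntegral hW hK α a φ f (circleMap γ r θ) Set.univ ε)‖ ≤ B) :
    ‖lowerLp P hp2 (chaosDerivative hW hK α a φ f γ r k ε)‖ ≤ B * k.factorial * r⁻¹ ^ k := by
  rw [chaosDerivative, map_smul, ← (lowerLp P hp2).integral_comp_comm
    (integrableOn_chaosIntegral hW hd hK ha hφ hf hM hR γ hr.le k hε)]
  simp_rw [map_smul]
  exact norm_contourIntegral_le hr k hB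

include hd ha hφ in
theorem norm_lowerLp_chaosDerivative_sub_le {f : RSpace d → ℂ}
    (hf : AEStronglyMeasurable f volume) {M : ℝ} (hM : ∀ᵐ x, ‖f x‖ ≤ M) {R : ℝ}
    (hR : ∀ x, f x ≠ 0 → ∀ i, |x i| ≤ R) (γ : ℝ) {r : ℝ} (hr : 0 < r) (k : ℕ) {ε ε' : ℝ}
    (hε : 0 < ε) (hε' : 0 < ε') {B : ℝ}
    (hB : ∀ θ, ‖lowerLp P hp2 (chaosIntegral hW hK α a φ f (circleMap γ r θ) Set.univ ε -
      chaosIntegral hW hK α a φ f (circleMap γ r θ) Set.univ ε')‖ ≤ B) :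
    ‖lowerLp P hp2 (chaosDerivative hW hK α a φ f γ r k ε -
      chaosDerivative hW hK α a φ f γ r k ε')‖ ≤ B * k.factorial * r⁻¹ ^ k := by
  have h1 := integrableOn_chaosIntegral hW hd hK (α := α) ha hφ hf hM hR γ hr.le k hε
  have h2 := integrableOn_chaosIntegral hW hd hK (α := α) ha hφ hf hM hR γ hr.le k hε'
  have h3 : IntegrableOn (fun θ : ℝ => Complex.exp (-(k * θ * Complex.I)) •
      (chaosIntegral hW hK α a φ f (circleMap γ r θ) Set.univ ε -
        chaosIntegral hW hK α a φ f (circleMap γ r θ) Set.univ ε')) (Set.Ioc 0 (2 * Real.pi)) :=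
    (h1.sub h2).congr (Eventually.of_forall fun θ => (smul_sub _ _ _).symm)
  rw [chaosDerivative, chaosDerivative, ← smul_sub, ← integral_sub h1 h2, map_smul]
  simp_rw [← smul_sub]
  rw [← (lowerLp P hp2).integral_comp_comm h3]
  simp_rw [map_smul]
  exact norm_contourIntegral_le hr k hB

end ChaosDerivative

/-! ### Choice of the moment exponent and the contour. -/

section Parameters

/-- The difference of the two sides is a nonnegative multiple of `(1 - κ c)²`. At `κ = √2` the right
side reaches the critical value `(1-t)/2`, and the square vanishes at `c = 1/√2`: the disc then
touches the subcritical boundary at 45 degrees. -/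
theorem subcritical_quadratic_le {t κ c s : ℝ} (ht0 : 0 ≤ t) (ht1 : t < 1)
    (hcs : c ^ 2 + s ^ 2 = 1) :
    (1 - t) / (1 + t) * (t + κ * (1 - t) / 2 * c) ^ 2 + (κ * (1 - t) / 2 * s) ^ 2 ≤
      (1 - t) / 2 * (1 - (1 - t) * (1 - κ ^ 2 / 2)) := by
  have h1 : 0 < 1 + t := by linarith
  have h2 : 0 ≤ 1 - t := by linarith
  rw [← sub_nonneg]
  have e : (1 - t) / 2 * (1 - (1 - t) * (1 - κ ^ 2 / 2)) -
      ((1 - t) / (1 + t) * (t + κ * (1 - t) / 2 * c) ^ 2 + (κ * (1 - t) / 2 * s) ^ 2) =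
      (1 - t) / (2 * (1 + t)) * (t * (1 - t) * (1 - κ * c) ^ 2) := by
    rw [mul_pow _ s, eq_sub_of_add_eq' hcs]
    field_simp
    ring
  rw [e]
  positivity

/-- The exponent and the growth rate for which the circle of centre `γ` and radius slightly below
`(√(2d) - |γ|) / √2` stays in the subcritical region. -/
theorem exists_subcritical_exponent {d : ℕ} {γ η : ℝ} (hγ : |γ| < Real.sqrt (2 * d)) (hη : 0 < η) :
    ∃ p Λ : ℝ, 1 ≤ p ∧ p ≤ 2 ∧ 0 ≤ Λ ∧ Λ < d * (p - 1) / p ∧ ∀ θ : ℝ,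
      ((p - 1) * (circleMap γ ((Real.sqrt (2 * d) - |γ|) / (Real.sqrt 2 * (1 + η))) θ).re ^ 2 +
        (circleMap γ ((Real.sqrt (2 * d) - |γ|) / (Real.sqrt 2 * (1 + η))) θ).im ^ 2) / 2 ≤ Λ := by
  set D := Real.sqrt (2 * d) with hD
  have hD0 : 0 < D := (abs_nonneg γ).trans_lt hγ
  have hD2 : D ^ 2 = 2 * d := Real.sq_sqrt (by positivity)
  have hd : (0 : ℝ) < d := by nlinarith
  set t := |γ| / D with ht
  have ht0 : 0 ≤ t := by positivity
  have ht1 : t < 1 := (div_lt_one hD0).2 hγ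
  have htD : |γ| = D * t := by rw [ht]; field_simp
  set κ := Real.sqrt 2 / (1 + η) with hκ
  have h22 : Real.sqrt 2 ^ 2 = 2 := Real.sq_sqrt (by norm_num)
  have h20 : 0 < Real.sqrt 2 := by positivity
  have hκ2 : κ ^ 2 / 2 = ((1 + η) ^ 2)⁻¹ := by
    rw [hκ, div_pow, h22]
    field_simp
  have hκ1 : κ ^ 2 / 2 < 1 := by
    rw [hκ2]
    exact inv_lt_one_of_one_lt₀ (by nlinarith)
  have hκ0 : 0 ≤ κ ^ 2 / 2 := by positivity
  have hr : (D - |γ|) / (Real.sqrt 2 * (1 + η)) = D * (κ * (1 - t) / 2) := by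
    rw [htD, hκ]
    field_simp
    rw [h22]
  have hp1 : 2 / (1 + t) - 1 = (1 - t) / (1 + t) := by field_simp; ring
  -- For `p = 2/(1+t)` the threshold `d(p-1)/p` equals `d(1-t)/2`; the last factor of `Λ` is below
  -- `1` because `η > 0` forces `κ² < 2`.
  refine ⟨2 / (1 + t), d * ((1 - t) / 2 * (1 - (1 - t) * (1 - κ ^ 2 / 2))), ?_, ?_, ?_, ?_, ?_⟩
  · rw [le_div_iff₀ (by linarith)]; linarith
  · rw [div_le_iff₀ (by linarith)]; linarith
  · have : (1 - t) * (1 - κ ^ 2 / 2) ≤ 1 := by nlinarith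
    have h3 : 0 ≤ 1 - t := by linarith
    have h4 : 0 ≤ 1 - (1 - t) * (1 - κ ^ 2 / 2) := by linarith
    positivity
  · have e : d * (2 / (1 + t) - 1) / (2 / (1 + t)) = d * ((1 - t) / 2 * 1) := by
      rw [hp1]
      field_simp
    rw [e]
    have h3 : 0 < (1 - t) / 2 := by linarith
    have h4 : 0 < (1 - t) * (1 - κ ^ 2 / 2) := mul_pos (by linarith) (by linarith)
    gcongr
    linarith
  · intro θ
    rw [hr, hp1]
    set ρ := κ * (1 - t) / 2 with hρ
    have hre : (circleMap γ (D * ρ) θ).re = γ + D * ρ * Real.cos θ := by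
      simp [circleMap, Complex.exp_re]
    have him : (circleMap γ (D * ρ) θ).im = D * ρ * Real.sin θ := by
      simp [circleMap, Complex.exp_im]
    rw [hre, him]
    have key : ∀ c : ℝ, c ^ 2 + Real.sin θ ^ 2 = 1 →
        (γ + D * ρ * Real.cos θ) ^ 2 = D ^ 2 * (t + ρ * c) ^ 2 →
        ((1 - t) / (1 + t) * (γ + D * ρ * Real.cos θ) ^ 2 + (D * ρ * Real.sin θ) ^ 2) / 2 ≤
          d * ((1 - t) / 2 * (1 - (1 - t) * (1 - κ ^ 2 / 2))) := by
      intro c hc h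
      have h5 := subcritical_quadratic_le (κ := κ) ht0 ht1 hc
      rw [← hρ] at h5
      have hd' : (d : ℝ) = D ^ 2 / 2 := by rw [hD2]; ring
      rw [h, hd']
      calc _ = D ^ 2 / 2 * ((1 - t) / (1 + t) * (t + ρ * c) ^ 2 + (ρ * Real.sin θ) ^ 2) := by ring
        _ ≤ _ := by gcongr
    -- For negative `γ`, reflect the circle, replacing `cos θ` by `-cos θ`.
    rcases abs_cases γ with ⟨h, _⟩ | ⟨h, _⟩
    · refine key (Real.cos θ) (by rw [add_comm]; exact Real.sin_sq_add_cos_sq θ) ?_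
      rw [← h, htD]
      ring
    · refine key (-Real.cos θ) (by rw [neg_sq, add_comm]; exact Real.sin_sq_add_cos_sq θ) ?_
      have : γ = -(D * t) := by linarith
      rw [this]
      ring

end Parameters

/-! ### From the chaos estimates to the theorem. -/

/-- A white noise has a version consisting of measurable variables. -/
theorem IsWhiteNoise.exists_isIsonormal {d : ℕ} {Ω : Type*} [MeasurableSpace Ω] {P : Measure Ω}
    {W : Lp ℝ 2 (spaceTime d) → Ω → ℝ} (hW : IsWhiteNoise P W) :
    ∃ W' : Lp ℝ 2 (spaceTime d) → Ω → ℝ, IsIsonormal P W' ∧ ∀ h, W h =ᵐ[P] W' h := by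
  have hm := fun h => hW.gaussian.aemeasurable h
  have hae : ∀ h, W h =ᵐ[P] (hm h).mk := fun h => (hm h).ae_eq_mk
  refine ⟨fun h => (hm h).mk, ⟨hW.gaussian.congr hae, fun h => (hm h).measurable_mk, fun h => ?_,
    fun h g => ?_⟩, hae⟩
  · rw [← hW.centred h]
    exact integral_congr_ae (hae h).symm
  · rw [← hW.covariance h g]
    exact integral_congr_ae ((hae h).symm.mul (hae g).symm)

theorem IsMollifiedStarField.ae_eq_mollifiedLayer {d : ℕ} (hd : 0 < d) {Ω : Type*}
    [MeasurableSpace Ω] {P : Measure Ω} {W W' : Lp ℝ 2 (spaceTime d) → Ω → ℝ}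
    (hWW' : ∀ h, W h =ᵐ[P] W' h) {K : RSpace d → ℝ} {hK : IsSeedCovariance K} {α : ℝ≥0∞} {a : ℝ}
    (ha : a ∈ Set.Icc (0 : ℝ) 1) {φ : RSpace d → ℝ} (hφ : IsMollifier φ) {X : ℝ → RSpace d → Ω → ℝ}
    (hX : IsMollifiedStarField P W hK α a φ X) {ε : ℝ} (hε : 0 < ε) (x : RSpace d) :
    X ε x =ᵐ[P] W' (mollifiedLayer hK α a φ Set.univ ε x) := by
  refine (hX.ae_eq ε hε x).trans ?_
  rw [starField_eq_layer hd W hK ha (hφ.isTestFunction_scaled hε x)]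
  exact hWW' _

theorem ae_norm_ofReal_le_eLpNorm_top {d : ℕ} {f : RSpace d → ℝ} (hf : Measurable f)
    (hb : ∃ M, ∀ x, |f x| ≤ M) : ∀ᵐ x, ‖(f x : ℂ)‖ ≤ (eLpNorm f ∞ volume).toReal := by
  obtain ⟨M, hM⟩ := hb
  have hfin := (memLp_top_of_bound hf.aestronglyMeasurable M
    (Eventually.of_forall hM) : MemLp f ∞ volume).eLpNorm_ne_top
  rw [eLpNorm_exponent_top] at hfin ⊢
  filter_upwards [ae_le_eLpNormEssSup (f := f) (μ := volume)] with x hx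
  rw [Complex.norm_real, ← toReal_enorm]
  exact ENNReal.toReal_mono hfin hx

theorem exists_box_of_hasCompactSupport {d : ℕ} {f : RSpace d → ℝ} (hf : HasCompactSupport f) :
    ∃ R : ℕ, 1 ≤ R ∧ ∀ x, (f x : ℂ) ≠ 0 → ∀ i, |x i| ≤ R := by
  obtain ⟨C, hC⟩ := hf.isCompact.isBounded.exists_norm_le
  obtain ⟨R, hR⟩ := exists_nat_ge C
  refine ⟨R + 1, by omega, fun x hx i => ?_⟩
  have h1 : f x ≠ 0 := by exact_mod_cast hx
  have h2 := hC x (subset_tsupport f h1)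
  have h3 := PiLp.norm_apply_le x i
  rw [Real.norm_eq_abs] at h3
  push_cast
  linarith

theorem integral_abs_le_norm_lowerLp {Ω : Type*} [MeasurableSpace Ω] {P : Measure Ω}
    [IsProbabilityMeasure P] {p : ℝ} [Fact (1 ≤ ENNReal.ofReal p)] (hp2 : p ≤ 2) {F : Lp ℂ 2 P}
    {Y : Ω → ℝ} (hFY : F =ᵐ[P] fun ω => (Y ω : ℂ)) : ∫ ω, |Y ω| ∂P ≤ ‖lowerLp P hp2 F‖ := by
  have h1 : ∫ ω, |Y ω| ∂P = ∫ ω, ‖F ω‖ ∂P := by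
    refine integral_congr_ae ?_
    filter_upwards [hFY] with ω hω
    rw [hω, Complex.norm_real, Real.norm_eq_abs]
  rw [h1, integral_norm_eq_lintegral_enorm (Lp.aestronglyMeasurable _),
    ← eLpNorm_one_eq_lintegral_enorm]
  exact ENNReal.toReal_le_of_le_ofReal (norm_nonneg _) (eLpNorm_one_le_lowerLp hp2 F)

theorem memLp_one_of_ae_eq_ofReal {Ω : Type*} [MeasurableSpace Ω] {P : Measure Ω}
    [IsProbabilityMeasure P] {F : Lp ℂ 2 P} {Y : Ω → ℝ} (hFY : F =ᵐ[P] fun ω => (Y ω : ℂ)) :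
    MemLp Y 1 P :=
  (((Lp.memLp F).mono_exponent (by norm_num)).ae_eq hFY).re

/-- A family that is Cauchy in `Lᵖ` converges in `L¹`. -/
theorem exists_tendsto_eLpNorm_one_of_cauchy {Ω : Type*} [MeasurableSpace Ω] {P : Measure Ω}
    [IsProbabilityMeasure P] {p : ℝ} [hp : Fact (1 ≤ ENNReal.ofReal p)] (hp2 : p ≤ 2)
    {F : ℝ → Lp ℂ 2 P} {Y : ℝ → Ω → ℝ} (hFY : ∀ ε, 0 < ε → F ε =ᵐ[P] fun ω => (Y ε ω : ℂ))
    (hF : ∀ δ, 0 < δ → ∃ ε₀, 0 < ε₀ ∧ ∀ ε ε', 0 < ε → 0 < ε' → ε < ε₀ → ε' < ε₀ →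
      ‖lowerLp P hp2 (F ε - F ε')‖ < δ) :
    ∃ I : Ω → ℝ, MemLp I 1 P ∧
      Tendsto (fun ε => eLpNorm (fun ω => Y ε ω - I ω) 1 P) (𝓝[>] 0) (𝓝 0) := by
  have hc : Cauchy (map (fun ε => lowerLp P hp2 (F ε)) (𝓝[>] (0 : ℝ))) := by
    rw [Metric.cauchy_iff]
    refine ⟨inferInstance, fun δ hδ => ?_⟩
    obtain ⟨ε₀, hε₀, h⟩ := hF δ hδ
    refine ⟨_, image_mem_map (Ioo_mem_nhdsGT hε₀), ?_⟩
    rintro _ ⟨ε, hε, rfl⟩ _ ⟨ε', hε', rfl⟩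
    rw [dist_eq_norm, ← map_sub]
    exact h ε ε' hε.1 hε'.1 hε.2 hε'.2
  obtain ⟨L, hL⟩ := cauchy_map_iff_exists_tendsto.1 hc
  refine ⟨fun ω => (L ω).re, ((Lp.memLp L).mono_exponent hp.out).re, ?_⟩
  have hle : ∀ ε, 0 < ε → eLpNorm (fun ω => Y ε ω - (L ω).re) 1 P ≤
      ENNReal.ofReal ‖lowerLp P hp2 (F ε) - L‖ := by
    intro ε hε
    rw [Lp.norm_def, ENNReal.ofReal_toReal (Lp.memLp _).eLpNorm_ne_top]
    refine le_trans ?_ (eLpNorm_le_eLpNorm_of_exponent_le hp.out (Lp.aestronglyMeasurable _))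
    refine eLpNorm_mono_ae ?_
    filter_upwards [hFY ε hε, coeFn_lowerLp hp2 (F ε), Lp.coeFn_sub (lowerLp P hp2 (F ε)) L]
      with ω h1 h2 h3
    rw [h3, Pi.sub_apply, h2, h1]
    have : Y ε ω - (L ω).re = ((Y ε ω : ℂ) - L ω).re := by simp
    rw [this]
    exact Complex.abs_re_le_norm _
  have ht : Tendsto (fun ε => ENNReal.ofReal ‖lowerLp P hp2 (F ε) - L‖) (𝓝[>] 0) (𝓝 0) := by
    have := ENNReal.tendsto_ofReal (tendsto_iff_norm_sub_tendsto_zero.1 hL)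
    rwa [ENNReal.ofReal_zero] at this
  refine tendsto_of_tendsto_of_tendsto_of_le_of_le' tendsto_const_nhds ht
    (Eventually.of_forall fun _ => zero_le) ?_
  filter_upwards [self_mem_nhdsWithin] with ε hε
  exact hle ε hε

theorem theorem2p1 {d : ℕ} {Ω : Type*} [MeasurableSpace Ω] (P : Measure Ω)
    [IsProbabilityMeasure P]
    (W : Lp ℝ 2 (spaceTime d) → Ω → ℝ) (hW : IsWhiteNoise P W)
    (K : RSpace d → ℝ) (hK : IsSeedCovariance K)
    (α : ℝ≥0∞) (hα : α ≠ 0) (a : ℝ) (ha : a ∈ Set.Icc (0 : ℝ) 1)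
    (φ : RSpace d → ℝ) (hφ : IsMollifier φ)
    (X : ℝ → RSpace d → Ω → ℝ) (hX : IsMollifiedStarField P W hK α a φ X)
    (γ : ℝ) (hγ : γ ∈ Set.Ioo (-Real.sqrt (2 * d)) (Real.sqrt (2 * d))) :
    (∀ f : RSpace d → ℝ, Measurable f → (∃ M, ∀ x, |f x| ≤ M) → HasCompactSupport f → ∀ k : ℕ,
      (∀ ε : ℝ, 0 < ε →
        (∀ᵐ ω ∂P, Integrable (fun x => f x * wick P (X ε x) k γ ω)) ∧
        MemLp (wickIntegral P X γ f k ε) 1 P) ∧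
      ∃ I : Ω → ℝ, MemLp I 1 P ∧
        Tendsto (fun ε : ℝ => eLpNorm (fun ω => wickIntegral P X γ f k ε ω - I ω) 1 P)
          (𝓝[>] 0) (𝓝 0)) ∧
    (∀ η : ℝ, 0 < η → ∃ C : ℝ, ∀ ε : ℝ, 0 < ε → ∀ k : ℕ, ∀ f : RSpace d → ℝ, Measurable f →
      (∃ M, ∀ x, |f x| ≤ M) → tsupport f ⊆ {x | ∀ i, x i ∈ Set.Icc (0 : ℝ) 1} →
      ∫ ω, |wickIntegral P X γ f k ε ω| ∂P ≤
        C * (eLpNorm f ∞ volume).toReal * (k.factorial : ℝ) *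
          ((1 + η) * (Real.sqrt 2 / (Real.sqrt (2 * d) - |γ|))) ^ k) := by

  have hγ' : |γ| < Real.sqrt (2 * d) := abs_lt.2 hγ
  -- In dimension zero the interval of admissible `γ` is empty.
  have hd : 0 < d := by
    rcases Nat.eq_zero_or_pos d with rfl | h
    · simp only [Nat.cast_zero, mul_zero, Real.sqrt_zero] at hγ'
      exact absurd hγ' (abs_nonneg γ).not_gt
    · exact h
  have hr : ∀ η : ℝ, 0 < η → 0 < (Real.sqrt (2 * d) - |γ|) / (Real.sqrt 2 * (1 + η)) :=
    fun η hη => div_pos (sub_pos.2 hγ') (by positivity)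
  obtain ⟨W', hW', hWW'⟩ := hW.exists_isIsonormal
  have hY := fun (ε : ℝ) (hε : 0 < ε) => hX.ae_eq_mollifiedLayer hd hWW' ha hφ hε
  refine ⟨fun f hf hfb hfc k => ?_, fun η hη => ?_⟩
  · have hM := ae_norm_ofReal_le_eLpNorm_top hf hfb
    obtain ⟨R, hR1, hR⟩ := exists_box_of_hasCompactSupport hfc
    have hmain := fun (ε : ℝ) (hε : 0 < ε) => chaosDerivative_ae_eq hW' hd hK ha hφ hf hM hR γ
      (hr 1 one_pos) k hε (hY ε hε) (hX.aemeasurable ε hε)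
    refine ⟨fun ε hε => ⟨(hmain ε hε).1, memLp_one_of_ae_eq_ofReal (hmain ε hε).2⟩, ?_⟩
    -- Convergence needs only some admissible circle; `η = 1` is an arbitrary choice.
    obtain ⟨p, Λ, hp1, hp2, hΛ0, hΛ, hΛθ⟩ := exists_subcritical_exponent hγ' one_pos
    have hp : Fact (1 ≤ ENNReal.ofReal p) := ⟨ENNReal.one_le_ofReal.2 hp1⟩
    refine exists_tendsto_eLpNorm_one_of_cauchy hp2 (fun ε hε => (hmain ε hε).2) fun δ hδ => ?_
    set r := (Real.sqrt (2 * d) - |γ|) / (Real.sqrt 2 * (1 + 1)) with hr_def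
    set M := (eLpNorm f ∞ volume).toReal with hM_def
    have hM0 : 0 ≤ M := ENNReal.toReal_nonneg
    have hr0 : 0 < r := hr 1 one_pos
    set Q := M * k.factorial * r⁻¹ ^ k with hQ
    have hQ0 : 0 ≤ Q := by positivity
    obtain ⟨ε₀, hε₀, h⟩ := exists_norm_chaosIntegral_sub_chaosIntegral_le hp2 hW' hd hK (α := α)
      ha hφ hR1 hΛ0 hΛ (|γ| + r) (δ := δ / (Q + 1)) (by positivity)
    refine ⟨ε₀, hε₀, fun ε ε' hε hε' hlt hlt' => ?_⟩
    have hfm : AEStronglyMeasurable (fun x => (f x : ℂ)) (volume : Measure (RSpace d)) :=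
      (Complex.measurable_ofReal.comp hf).aestronglyMeasurable
    refine (norm_lowerLp_chaosDerivative_sub_le hW' hd hK ha hφ hp2 hfm hM hR γ hr0 k hε hε'
      (B := δ / (Q + 1) * M) fun θ => h _ hfm M hM0 hM hR _ (norm_circleMap_ofReal_le γ hr0.le θ)
        (hΛθ θ) ε ε' hε hε' hlt hlt').trans_lt ?_
    calc δ / (Q + 1) * M * k.factorial * r⁻¹ ^ k = δ * Q / (Q + 1) := by rw [hQ]; ring
      _ < δ := by
        rw [div_lt_iff₀ (by positivity)]
        linarith
  · obtain ⟨p, Λ, hp1, hp2, hΛ0, hΛ, hΛθ⟩ := exists_subcritical_exponent hγ' hη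
    have hp : Fact (1 ≤ ENNReal.ofReal p) := ⟨ENNReal.one_le_ofReal.2 hp1⟩
    -- The constant depends on the circle only through `p` and `Λ`, so it serves all `k`, `f` and
    -- `ε`; the unit cube lies in the box with `R = 1`.
    obtain ⟨C, hC0, hC⟩ := exists_norm_chaosIntegral_le hp2 hW' hd hK (α := α) ha hφ
      (R := 1) le_rfl hΛ0 hΛ
    refine ⟨C, fun ε hε k f hf hfb hfs => ?_⟩
    have hM := ae_norm_ofReal_le_eLpNorm_top hf hfb
    have hR : ∀ x, (f x : ℂ) ≠ 0 → ∀ i, |x i| ≤ ((1 : ℕ) : ℝ) := by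
      intro x hx i
      have h1 : f x ≠ 0 := by exact_mod_cast hx
      have h2 := hfs (subset_tsupport f h1) i
      rw [Nat.cast_one, abs_of_nonneg h2.1]
      exact h2.2
    have hfm : AEStronglyMeasurable (fun x => (f x : ℂ)) (volume : Measure (RSpace d)) :=
      (Complex.measurable_ofReal.comp hf).aestronglyMeasurable
    refine (integral_abs_le_norm_lowerLp hp2 (chaosDerivative_ae_eq hW' hd hK ha hφ hf hM hR γ
      (hr η hη) k hε (hY ε hε) (hX.aemeasurable ε hε)).2).trans ?_
    refine (norm_lowerLp_chaosDerivative_le hW' hd hK ha hφ hp2 hfm hM hR γ (hr η hη) k hε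
      fun θ => hC _ hfm _ ENNReal.toReal_nonneg hM hR _ (hΛθ θ) ε hε).trans_eq ?_
    -- The growth rate is the inverse radius `r⁻¹` of the contour.
    rw [inv_div, mul_div_assoc', mul_comm (Real.sqrt 2)]
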